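/- Let $q\in\mathbf C$ with $|q|>1$ and let $\mathbf E_q=\mathbf C^*/q^{\mathbf Z}$ be the associated elliptic curve. Let $\mathcal P^{(0)}$ be the following $\mathbf C$-linear symmetric monoidal category. Its objects are the pairs $(n,A)$ with $n\ge 0$ and $A\in GL_n(\mathbf C)$ (constant $q$-difference systems $f(qz)=Af(z)$). A morphism from $(n,A)$ to $(p,B)$ is a matrix $F\in M_{p,n}(\mathbf C(\{z\}))$ of germs at $0$ of meromorphic functions such that $F(qz)A=BF(z)$; composition is the product of matrices. The tensor product of objects and of morphisms is the Kronecker product, the coordinates of $\mathbf C^n\otimes\mathbf C^{p}$ being numbered by $(i_1,i_2)\mapsto i_1+n(i_2-1)$, the unit is $(1,1)$, and the associativity, unit and commutativity constraints are the evident permutations of coordinates. Let $\mathrm{Fib}_p(\mathbf E_q)$ be the full subcategory of the category of holomorphic vector bundles over $\mathbf E_q$ (with holomorphic fibrewise linear maps over $\mathbf E_q$ as morphisms, and the usual tensor product) whose objects are the flat bundles, i.e. those which have holomorphic local trivializations over some open covering with constant transition matrices. For $A\in GL_n(\mathbf C)$ let $F_A=(\mathbf C^*\times\mathbf C^n)/\!\sim_A\;\to\mathbf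 E_q$, where $\sim_A$ is the equivalence relation generated by $(z,X)\sim_A(qz,AX)$; it is a flat holomorphic vector bundle. Write $[z,X]$ for the class of $(z,X)$. Every morphism $F:A\to B$ of $\mathcal P^{(0)}$ extends, through its functional equation, to a holomorphic function on $\mathbf C^*$ with $F(qz)A=BF(z)$ there, and induces the morphism $F_A\to F_B$, $[z,X]\mapsto[z,F(z)X]$. This defines a functor $A\mapsto F_A$ from $\mathcal P^{(0)}$ to $\mathrm{Fib}_p(\mathbf E_q)$. Theorem. The functor $A\mapsto F_A$ is an equivalence of $\mathbf C$-linear tensor categories: it is an equivalence of categories, it is additive and $\mathbf C$-linear, and it is a (strong, symmetric) monoidal functor for the isomorphisms $F_A\otimes F_B\to F_{A\otimes B}$, $[z,X]\otimes[z,Y]\mapsto[z,X\otimes Y]$, and $\mathbf E_q\times\mathbf C\to F_{(1,1)}$, which maps $c$ in the fibre over the image of $z$ to $[z,c]$. -/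

import Mathlib

open CategoryTheory Bundle Topology MonoidalCategory
open scoped Manifold ContDiff TensorProduct

noncomputable section

namespace QDiff

/-! ### Holomorphic vector bundles -/

/-- A holomorphic atlas of local frames of rank `n` for a family `E` of complex vector spaces over
a Riemann surface `X`: over the open set `U i`, the linear maps `toCoord i x` and `ofCoord i x` are
inverse isomorphisms between `E x` and `ℂⁿ` (their values off `U i` are irrelevant), and the
transition functions are holomorphic. -/
structure FrameAtlas {X : Type} [TopologicalSpace X] [ChartedSpace ℂ X] (n : ℕ) (E : X → Type)
    [∀ x, AddCommGroup (E x)] [∀ x, Module ℂ (E x)] where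
  ι : Type
  U : ι → Set X
  isOpen : ∀ i, IsOpen (U i)
  idx : X → ι
  mem_idx : ∀ x, x ∈ U (idx x)
  toCoord : ι → ∀ x, E x →ₗ[ℂ] (Fin n → ℂ)
  ofCoord : ι → ∀ x, (Fin n → ℂ) →ₗ[ℂ] E x
  of_to : ∀ i, ∀ x ∈ U i, ∀ v, ofCoord i x (toCoord i x v) = v
  to_of : ∀ i, ∀ x ∈ U i, ∀ v, toCoord i x (ofCoord i x v) = v
  holo : ∀ i j v, ContMDiffOn 𝓘(ℂ) 𝓘(ℂ, Fin n → ℂ) ω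
    (fun x => toCoord j x (ofCoord i x v)) (U i ∩ U j)

/-- A holomorphic vector bundle of rank `rank` over `X`. -/
structure HolBundle (X : Type) [TopologicalSpace X] [ChartedSpace ℂ X] where
  rank : ℕ
  fiber : X → Type
  [addCommGroup : ∀ x, AddCommGroup (fiber x)]
  [module : ∀ x, Module ℂ (fiber x)]
  [topFiber : ∀ x, TopologicalSpace (fiber x)]
  [topTotal : TopologicalSpace (TotalSpace (Fin rank → ℂ) fiber)]
  [fiberBundle : FiberBundle (Fin rank → ℂ) fiber]
  [vectorBundle : VectorBundle ℂ (Fin rank → ℂ) fiber]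
  [holomorphic : ContMDiffVectorBundle ω (Fin rank → ℂ) fiber 𝓘(ℂ)]

attribute [instance] HolBundle.addCommGroup HolBundle.module HolBundle.topFiber HolBundle.topTotal
  HolBundle.fiberBundle HolBundle.vectorBundle HolBundle.holomorphic

section General

variable {X : Type} [TopologicalSpace X] [ChartedSpace ℂ X]

/-- Holomorphy of a family of linear maps between coordinate spaces can be tested on vectors. -/
theorem contMDiffOn_clm {n m : ℕ} {g : X → (Fin n → ℂ) →L[ℂ] (Fin m → ℂ)} {s : Set X}
    (h : ∀ v, ContMDiffOn 𝓘(ℂ) 𝓘(ℂ, Fin m → ℂ) ω (fun x => g x v) s) :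
    ContMDiffOn 𝓘(ℂ) 𝓘(ℂ, (Fin n → ℂ) →L[ℂ] (Fin m → ℂ)) ω g s := by
  have key : g = fun x => ∑ i : Fin n,
      (ContinuousLinearMap.smulRightL ℂ (Fin n → ℂ) (Fin m → ℂ)
        (ContinuousLinearMap.proj (R := ℂ) (φ := fun _ : Fin n => ℂ) i)) (g x (Pi.single i 1)) := by
    funext x
    ext v j
    have : v = ∑ i : Fin n, v i • (Pi.single i (1 : ℂ) : Fin n → ℂ) := by
      ext k; simp [Finset.sum_apply, Pi.single_apply]
    conv_lhs => rw [this]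
    simp
  rw [key]
  refine contMDiffOn_finsetSum fun i _ => ?_
  exact (ContinuousLinearMap.contMDiff _).comp_contMDiffOn (h _)

namespace FrameAtlas

variable {n : ℕ} {E : X → Type} [∀ x, AddCommGroup (E x)] [∀ x, Module ℂ (E x)]

/-- The linear isomorphism `E x ≃ ℂⁿ` given by the frame `i`. -/
def equiv (A : FrameAtlas n E) (i : A.ι) (x : X) (hx : x ∈ A.U i) : E x ≃ₗ[ℂ] (Fin n → ℂ) where
  toLinearMap := A.toCoord i x
  invFun := A.ofCoord i x
  left_inv := A.of_to i x hx
  right_inv := A.to_of i x hx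

open Classical in
/-- The local trivialization of the total space given by the frame `i`. -/
def pretriv (A : FrameAtlas n E) (i : A.ι) : Pretrivialization (Fin n → ℂ) (π (Fin n → ℂ) E) where
  toFun p := (p.1, A.toCoord i p.1 p.2)
  invFun p := ⟨p.1, A.ofCoord i p.1 p.2⟩
  source := π (Fin n → ℂ) E ⁻¹' A.U i
  target := A.U i ×ˢ Set.univ
  baseSet := A.U i
  map_source' p hp := ⟨hp, trivial⟩
  map_target' p hp := hp.1
  left_inv' p hp := by
    obtain ⟨x, v⟩ := p
    simp [A.of_to i x hp v]
  right_inv' p hp := by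
    obtain ⟨x, v⟩ := p
    simp [A.to_of i x hp.1 v]
  open_target := (A.isOpen i).prod isOpen_univ
  open_baseSet := A.isOpen i
  source_eq := rfl
  target_eq := rfl
  proj_toFun p _ := rfl

theorem pretriv_symm (A : FrameAtlas n E) (i : A.ι) (x : X) (hx : x ∈ A.U i) (v : Fin n → ℂ) :
    (A.pretriv i).symm x v = A.ofCoord i x v := by
  rw [Pretrivialization.symm_apply _ hx]
  rfl

/-- The topology of `E x`, transported from `ℂⁿ`. -/
@[reducible] def topFiber (A : FrameAtlas n E) (x : X) : TopologicalSpace (E x) :=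
  TopologicalSpace.induced (A.toCoord (A.idx x) x) inferInstance

/-- The transition functions, as continuous linear maps. -/
def trans (A : FrameAtlas n E) (i j : A.ι) (x : X) : (Fin n → ℂ) →L[ℂ] (Fin n → ℂ) :=
  LinearMap.toContinuousLinearMap (A.toCoord j x ∘ₗ A.ofCoord i x)

theorem trans_holo (A : FrameAtlas n E) (i j : A.ι) :
    ContMDiffOn 𝓘(ℂ) 𝓘(ℂ, (Fin n → ℂ) →L[ℂ] (Fin n → ℂ)) ω (A.trans i j) (A.U i ∩ A.U j) :=
  contMDiffOn_clm fun v => A.holo i j v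

/-- The vector prebundle given by an atlas of frames. -/
def prebundle (A : FrameAtlas n E) :
    letI := A.topFiber
    VectorPrebundle ℂ (Fin n → ℂ) E :=
  letI := A.topFiber
  { pretrivializationAtlas := Set.range A.pretriv
    pretrivialization_linear' := by
      rintro _ ⟨i, rfl⟩
      exact ⟨fun x _ => (A.toCoord i x).isLinear⟩
    pretrivializationAt := fun x => A.pretriv (A.idx x)
    mem_base_pretrivializationAt := A.mem_idx
    pretrivialization_mem_atlas := fun x => ⟨_, rfl⟩
    exists_coordChange := by
      rintro _ ⟨i, rfl⟩ _ ⟨j, rfl⟩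
      refine ⟨A.trans i j, (A.trans_holo i j).continuousOn, fun x hx v => ?_⟩
      rw [A.pretriv_symm i x hx.1]
      rfl
    totalSpaceMk_isInducing := fun x => by
      have h1 : IsInducing (fun v : Fin n → ℂ => (x, v)) := (isEmbedding_prodMkRight x).isInducing
      exact h1.comp ⟨rfl⟩ }

theorem prebundle_holo (A : FrameAtlas n E) :
    letI := A.topFiber
    A.prebundle.IsContMDiff 𝓘(ℂ) ω :=
  letI := A.topFiber
  { exists_contMDiffCoordChange := by
      rintro _ ⟨i, rfl⟩ _ ⟨j, rfl⟩
      refine ⟨A.trans i j, A.trans_holo i j, fun x hx v => ?_⟩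
      rw [A.pretriv_symm i x hx.1]
      rfl }

/-- The holomorphic vector bundle glued from an atlas of frames. -/
def toHolBundle (A : FrameAtlas n E) : HolBundle X :=
  letI := A.topFiber
  letI := A.prebundle.totalSpaceTopology
  letI := A.prebundle.toFiberBundle
  letI := A.prebundle.toVectorBundle
  haveI := A.prebundle_holo
  { rank := n
    fiber := E
    holomorphic := A.prebundle.contMDiffVectorBundle 𝓘(ℂ) }

end FrameAtlas

namespace HolBundle

/-- The point of the total space of `E` given by a vector `v` in the fibre over `x`. -/
abbrev pt (E : HolBundle X) (x : X) (v : E.fiber x) : TotalSpace (Fin E.rank → ℂ) E.fiber :=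
  ⟨x, v⟩

/-- The frames of a holomorphic vector bundle given by its local trivializations. -/
def frames (E : HolBundle X) : FrameAtlas E.rank E.fiber where
  ι := {e : Trivialization (Fin E.rank → ℂ) (π (Fin E.rank → ℂ) E.fiber) //
    MemTrivializationAtlas e}
  U e := e.1.baseSet
  isOpen e := e.1.open_baseSet
  idx x := ⟨trivializationAt (Fin E.rank → ℂ) E.fiber x, inferInstance⟩
  mem_idx x := FiberBundle.mem_baseSet_trivializationAt' x
  toCoord e x := haveI := e.2; e.1.linearMapAt ℂ x
  ofCoord e x := haveI := e.2; e.1.symmₗ ℂ x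
  of_to e x hx v := haveI := e.2; e.1.symmₗ_linearMapAt hx v
  to_of e x hx v := haveI := e.2; e.1.linearMapAt_symmₗ hx v
  holo e e' v := by
    have := e.2
    have := e'.2
    have h := (contMDiffOn_coordChangeL (IB := 𝓘(ℂ)) (n := ω) e.1 e'.1).clm_apply
      (contMDiffOn_const (c := v))
    refine h.congr fun x hx => ?_
    simp only [ContinuousLinearEquiv.coe_coe, Trivialization.coordChangeL_apply _ _ hx]
    rw [Trivialization.coe_linearMapAt_of_mem _ hx.2, Trivialization.symmₗ_apply _ hx.1]

/-- The morphisms of holomorphic vector bundles over `X`: the families of linear maps between the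
fibres which are holomorphic as maps between the total spaces. -/
def IsHol (E E' : HolBundle X) (f : ∀ x, E.fiber x →ₗ[ℂ] E'.fiber x) : Prop :=
  ContMDiff (𝓘(ℂ).prod 𝓘(ℂ, Fin E.rank → ℂ)) (𝓘(ℂ).prod 𝓘(ℂ, Fin E'.rank → ℂ)) ω
    (fun p : TotalSpace (Fin E.rank → ℂ) E.fiber => E'.pt p.1 (f p.1 p.2))

/-- An atlas of frames consists of holomorphic frames of `E`. -/
structure Compat (E : HolBundle X) (A : FrameAtlas E.rank E.fiber) : Prop where
  toCoord_holo : ∀ i, ContMDiffOn (𝓘(ℂ).prod 𝓘(ℂ, Fin E.rank → ℂ)) 𝓘(ℂ, Fin E.rank → ℂ) ω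
    (fun p : TotalSpace (Fin E.rank → ℂ) E.fiber => A.toCoord i p.1 p.2) {p | p.1 ∈ A.U i}
  ofCoord_holo : ∀ i v, ContMDiffOn 𝓘(ℂ) (𝓘(ℂ).prod 𝓘(ℂ, Fin E.rank → ℂ)) ω
    (fun x => E.pt x (A.ofCoord i x v)) (A.U i)


theorem isOpen_preimage (E : HolBundle X) {U : Set X} (hU : IsOpen U) :
    IsOpen {p : TotalSpace (Fin E.rank → ℂ) E.fiber | p.1 ∈ U} :=
  hU.preimage (FiberBundle.continuous_proj (Fin E.rank → ℂ) E.fiber)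

theorem compat_frames (E : HolBundle X) : E.Compat E.frames where
  toCoord_holo := by
    rintro ⟨e, he⟩
    have h := (e.contMDiffOn (IB := 𝓘(ℂ)) (n := ω))
    have h2 := contMDiff_snd.comp_contMDiffOn h
    intro p hp
    have hp' : p ∈ e.source := e.mem_source.2 hp
    refine ((h2 p hp').mono ?_).congr ?_ ?_
    · intro y hy
      exact e.mem_source.2 hy
    · intro y hy
      have hy' : y.1 ∈ e.baseSet := hy
      simp only [frames, Trivialization.coe_linearMapAt_of_mem _ hy', Function.comp]
    · have hy' : p.1 ∈ e.baseSet := hp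
      simp only [frames, Trivialization.coe_linearMapAt_of_mem _ hy', Function.comp]
  ofCoord_holo := by
    rintro ⟨e, he⟩ v
    have := (e.contMDiffOn_section_baseSet_iff (IB := 𝓘(ℂ)) (n := ω)
      (s := fun x => e.symmₗ ℂ x v)).2 ?_
    · exact this
    · refine (contMDiffOn_const (c := v)).congr fun x hx => ?_
      rw [Trivialization.symmₗ_apply _ hx, Trivialization.apply_mk_symm _ hx]

theorem vec_sum {n : ℕ} (v : Fin n → ℂ) : v = ∑ k, v k • (Pi.single k (1 : ℂ) : Fin n → ℂ) := by
  ext j; simp [Finset.sum_apply, Pi.single_apply]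

theorem contMDiffAt_pt {E : HolBundle X} {A : FrameAtlas E.rank E.fiber} (hA : E.Compat A)
    {EM HM M : Type} [NormedAddCommGroup EM] [NormedSpace ℂ EM] [TopologicalSpace HM]
    {I : ModelWithCorners ℂ EM HM} [TopologicalSpace M] [ChartedSpace HM M]
    {b : M → X} {s : ∀ m, E.fiber (b m)} {m₀ : M} {i : A.ι} (hi : b m₀ ∈ A.U i)
    (hb : ContMDiffAt I 𝓘(ℂ) ω b m₀)
    (hs : ContMDiffAt I 𝓘(ℂ, Fin E.rank → ℂ) ω (fun m => A.toCoord i (b m) (s m)) m₀) :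
    ContMDiffAt I (𝓘(ℂ).prod 𝓘(ℂ, Fin E.rank → ℂ)) ω (fun m => E.pt (b m) (s m)) m₀ := by
  set e := trivializationAt (Fin E.rank → ℂ) E.fiber (b m₀) with he
  have hbe : b m₀ ∈ e.baseSet := FiberBundle.mem_baseSet_trivializationAt' _
  rw [e.contMDiffAt_iff (e.mem_source.2 hbe)]
  refine ⟨hb, ?_⟩
  have key : (fun m => (e (E.pt (b m) (s m))).2) =ᶠ[𝓝 m₀] fun m =>
      ∑ k, A.toCoord i (b m) (s m) k •
        (e (E.pt (b m) (A.ofCoord i (b m) (Pi.single k 1)))).2 := by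
    have hU : ∀ᶠ m in 𝓝 m₀, b m ∈ A.U i ∩ e.baseSet :=
      hb.continuousAt.preimage_mem_nhds
        (((A.isOpen i).inter e.open_baseSet).mem_nhds ⟨hi, hbe⟩)
    filter_upwards [hU] with m hm
    have h1 : ∀ w : E.fiber (b m), (e (E.pt (b m) w)).2 = e.linearMapAt ℂ (b m) w := fun w => by
      rw [Trivialization.coe_linearMapAt_of_mem _ hm.2]
    simp only [h1]
    conv_lhs => rw [← A.of_to i _ hm.1 (s m), vec_sum (A.toCoord i (b m) (s m))]
    simp only [map_sum, map_smul]
  refine ContMDiffAt.congr_of_eventuallyEq ?_ key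
  refine contMDiffAt_finsetSum fun k _ => ?_
  refine ContMDiffAt.smul (contMDiffAt_pi_space.1 hs k) ?_
  · have h3 := (hA.ofCoord_holo i (Pi.single k 1)).contMDiffAt ((A.isOpen i).mem_nhds hi)
    have h4 := (e.contMDiffAt_section_iff (IB := 𝓘(ℂ)) (n := ω) hbe).1 h3
    exact h4.comp m₀ hb

/-- Holomorphy of a morphism of vector bundles, in terms of holomorphic frames. -/
theorem isHol_iff {E E' : HolBundle X} {A : FrameAtlas E.rank E.fiber}
    {A' : FrameAtlas E'.rank E'.fiber} (hA : E.Compat A) (hA' : E'.Compat A')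
    (f : ∀ x, E.fiber x →ₗ[ℂ] E'.fiber x) :
    E.IsHol E' f ↔ ∀ i j v, ContMDiffOn 𝓘(ℂ) 𝓘(ℂ, Fin E'.rank → ℂ) ω
      (fun x => A'.toCoord j x (f x (A.ofCoord i x v))) (A.U i ∩ A'.U j) := by
  constructor
  · intro hf i j v x hx
    have h1 := (hA.ofCoord_holo i v).contMDiffAt ((A.isOpen i).mem_nhds hx.1)
    have h2 := (hf (E.pt x (A.ofCoord i x v))).comp x h1
    have h3 := (hA'.toCoord_holo j).contMDiffAt
      (x := E'.pt x (f x (A.ofCoord i x v))) ((E'.isOpen_preimage (A'.isOpen j)).mem_nhds hx.2)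
    exact (h3.comp x h2).contMDiffWithinAt
  · intro h p
    set i := A.idx p.1
    set j := A'.idx p.1
    have hi : p.1 ∈ A.U i := A.mem_idx _
    have hj : p.1 ∈ A'.U j := A'.mem_idx _
    refine contMDiffAt_pt (E := E') (b := fun p : TotalSpace (Fin E.rank → ℂ) E.fiber => p.1)
      (s := fun p => f p.1 p.2) hA' hj (contMDiff_proj E.fiber p) ?_
    have hc := (hA.toCoord_holo i).contMDiffAt ((E.isOpen_preimage (A.isOpen i)).mem_nhds hi)
    have key : (fun p : TotalSpace (Fin E.rank → ℂ) E.fiber => A'.toCoord j p.1 (f p.1 p.2))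
        =ᶠ[𝓝 p] fun p => ∑ k, A.toCoord i p.1 p.2 k •
          A'.toCoord j p.1 (f p.1 (A.ofCoord i p.1 (Pi.single k 1))) := by
      filter_upwards [(E.isOpen_preimage (A.isOpen i)).mem_nhds hi] with m hm
      conv_lhs => rw [← A.of_to i _ hm m.2, vec_sum (A.toCoord i m.1 m.2)]
      simp only [map_sum, map_smul]
    refine ContMDiffAt.congr_of_eventuallyEq ?_ key
    refine contMDiffAt_finsetSum fun k _ => ?_
    refine ContMDiffAt.smul (contMDiffAt_pi_space.1 hc k) ?_
    have h1 := (h i j (Pi.single k 1)).contMDiffAt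
      (((A.isOpen i).inter (A'.isOpen j)).mem_nhds ⟨hi, hj⟩)
    exact h1.comp p (contMDiff_proj E.fiber p)

/-- Frames are holomorphic as soon as they are so with respect to some holomorphic frames. -/
theorem compat_of_trans {E : HolBundle X} {A B : FrameAtlas E.rank E.fiber} (hA : E.Compat A)
    (h : ∀ i j v, ContMDiffOn 𝓘(ℂ) 𝓘(ℂ, Fin E.rank → ℂ) ω
      (fun x => B.toCoord j x (A.ofCoord i x v)) (A.U i ∩ B.U j))
    (h' : ∀ i j v, ContMDiffOn 𝓘(ℂ) 𝓘(ℂ, Fin E.rank → ℂ) ω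
      (fun x => A.toCoord j x (B.ofCoord i x v)) (B.U i ∩ A.U j)) :
    E.Compat B where
  toCoord_holo := by
    intro j p hp
    set i := A.idx p.1
    have hi : p.1 ∈ A.U i := A.mem_idx _
    have hc := (hA.toCoord_holo i).contMDiffAt ((E.isOpen_preimage (A.isOpen i)).mem_nhds hi)
    have key : (fun p : TotalSpace (Fin E.rank → ℂ) E.fiber => B.toCoord j p.1 p.2)
        =ᶠ[𝓝 p] fun p => ∑ k, A.toCoord i p.1 p.2 k •
          B.toCoord j p.1 (A.ofCoord i p.1 (Pi.single k 1)) := by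
      filter_upwards [(E.isOpen_preimage (A.isOpen i)).mem_nhds hi] with m hm
      conv_lhs => rw [← A.of_to i _ hm m.2, vec_sum (A.toCoord i m.1 m.2)]
      simp only [map_sum, map_smul]
    refine (ContMDiffAt.congr_of_eventuallyEq ?_ key).contMDiffWithinAt
    refine contMDiffAt_finsetSum fun k _ => ?_
    refine ContMDiffAt.smul (contMDiffAt_pi_space.1 hc k) ?_
    have h1 := (h i j (Pi.single k 1)).contMDiffAt
      (((A.isOpen i).inter (B.isOpen j)).mem_nhds ⟨hi, hp⟩)
    exact h1.comp p (contMDiff_proj E.fiber p)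
  ofCoord_holo := by
    intro j v x hx
    set i := A.idx x
    have hi : x ∈ A.U i := A.mem_idx _
    refine (contMDiffAt_pt (b := fun x => x) (s := fun x => B.ofCoord j x v) hA hi
      contMDiffAt_id ?_).contMDiffWithinAt
    exact (h' j i v).contMDiffAt (((B.isOpen j).inter (A.isOpen i)).mem_nhds ⟨hx, hi⟩)

end HolBundle

theorem FrameAtlas.compat {n : ℕ} {E : X → Type} [∀ x, AddCommGroup (E x)] [∀ x, Module ℂ (E x)]
    (A : FrameAtlas n E) : A.toHolBundle.Compat A := by
  have mem : ∀ e : A.toHolBundle.frames.ι, ∃ i : A.ι, ∃ h : A.U i = A.toHolBundle.frames.U e,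
      (∀ x ∈ A.U i, ∀ v, A.toHolBundle.frames.toCoord e x v = A.toCoord i x v) ∧
      (∀ x ∈ A.U i, ∀ v, A.toHolBundle.frames.ofCoord e x v = A.ofCoord i x v) := by
    rintro ⟨e, he⟩
    obtain ⟨_, ⟨i, rfl⟩, rfl⟩ := he.out
    have h1 : ∀ x ∈ A.U i, ∀ v, A.toHolBundle.frames.toCoord ⟨_, he⟩ x v = A.toCoord i x v := by
      intro x hx v
      exact congrFun (Trivialization.coe_linearMapAt_of_mem (R := ℂ) _ hx) v
    refine ⟨i, rfl, h1, fun x hx v => ?_⟩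
    rw [← A.of_to i x hx (A.toHolBundle.frames.ofCoord ⟨_, he⟩ x v), ← h1 x hx]
    congr 1
    exact A.toHolBundle.frames.to_of ⟨_, he⟩ x hx v
  refine HolBundle.compat_of_trans A.toHolBundle.compat_frames ?_ ?_
  · intro e j v
    obtain ⟨i, h, h1, h2⟩ := mem e
    rw [← h]
    exact (A.holo i j v).congr fun x hx => by rw [h2 x hx.1]; rfl
  · intro j e v
    obtain ⟨i, h, h1, h2⟩ := mem e
    rw [← h]
    exact (A.holo j i v).congr fun x hx => by rw [h1 x hx.2]; rfl

namespace HolBundle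

theorem smul_holo {n : ℕ} (c : ℂ) {f : X → Fin n → ℂ} {s : Set X}
    (hf : ContMDiffOn 𝓘(ℂ) 𝓘(ℂ, Fin n → ℂ) ω f s) :
    ContMDiffOn 𝓘(ℂ) 𝓘(ℂ, Fin n → ℂ) ω (fun x => c • f x) s :=
  ContMDiffOn.smul (I := 𝓘(ℂ)) (f := fun _ : X => c) contMDiffOn_const hf

theorem isHol_id (E : HolBundle X) : E.IsHol E (fun _ => LinearMap.id) :=
  contMDiff_id

theorem IsHol.comp {E E' E'' : HolBundle X} {f : ∀ x, E.fiber x →ₗ[ℂ] E'.fiber x}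
    {g : ∀ x, E'.fiber x →ₗ[ℂ] E''.fiber x} (hg : E'.IsHol E'' g) (hf : E.IsHol E' f) :
    E.IsHol E'' (fun x => g x ∘ₗ f x) :=
  ContMDiff.comp hg hf

/-- The complex vector space of morphisms `E ⟶ E'`. -/
def homs (E E' : HolBundle X) : Submodule ℂ (∀ x, E.fiber x →ₗ[ℂ] E'.fiber x) where
  carrier := {f | E.IsHol E' f}
  zero_mem' := by
    refine (isHol_iff E.compat_frames E'.compat_frames _).2 fun i j v => ?_
    simpa using contMDiffOn_const
  add_mem' {f g} hf hg := by
    refine (isHol_iff E.compat_frames E'.compat_frames _).2 fun i j v => ?_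
    have h1 := (isHol_iff E.compat_frames E'.compat_frames f).1 hf i j v
    have h2 := (isHol_iff E.compat_frames E'.compat_frames g).1 hg i j v
    exact (h1.add h2).congr fun x _ => by simp
  smul_mem' c f hf := by
    refine (isHol_iff E.compat_frames E'.compat_frames _).2 fun i j v => ?_
    have h1 := (isHol_iff E.compat_frames E'.compat_frames f).1 hf i j v
    exact (smul_holo c h1).congr fun x _ => by simp

/-- The category of holomorphic vector bundles over `X`. -/
instance : Category (HolBundle X) where
  Hom E E' := E.homs E'
  id E := ⟨fun _ => LinearMap.id, E.isHol_id⟩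
  comp f g := ⟨fun x => g.1 x ∘ₗ f.1 x, IsHol.comp g.2 f.2⟩

/-- The action of a morphism on the fibres over `x`. -/
def app {E E' : HolBundle X} (f : E ⟶ E') (x : X) : E.fiber x →ₗ[ℂ] E'.fiber x := f.1 x

/-- Constructor for morphisms. -/
def mkHom {E E' : HolBundle X} (f : ∀ x, E.fiber x →ₗ[ℂ] E'.fiber x) (hf : E.IsHol E' f) :
    E ⟶ E' := ⟨f, hf⟩

theorem app_holo {E E' : HolBundle X} (f : E ⟶ E') : E.IsHol E' (app f) := f.2

theorem hom_ext {E E' : HolBundle X} {f g : E ⟶ E'} (h : ∀ x, app f x = app g x) : f = g :=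
  Subtype.ext (funext h)

@[simp] theorem app_mkHom {E E' : HolBundle X} (f : ∀ x, E.fiber x →ₗ[ℂ] E'.fiber x)
    (hf : E.IsHol E' f) (x : X) : app (mkHom f hf) x = f x := rfl

@[simp] theorem app_id (E : HolBundle X) (x : X) : app (𝟙 E) x = LinearMap.id := rfl

@[simp] theorem app_comp {E E' E'' : HolBundle X} (f : E ⟶ E') (g : E' ⟶ E'') (x : X) :
    app (f ≫ g) x = app g x ∘ₗ app f x := rfl

instance (E E' : HolBundle X) : AddCommGroup (E ⟶ E') :=
  inferInstanceAs (AddCommGroup (E.homs E'))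

instance (E E' : HolBundle X) : Module ℂ (E ⟶ E') :=
  inferInstanceAs (Module ℂ (E.homs E'))

@[simp] theorem app_add {E E' : HolBundle X} (f g : E ⟶ E') (x : X) :
    app (f + g) x = app f x + app g x := rfl

@[simp] theorem app_smul {E E' : HolBundle X} (c : ℂ) (f : E ⟶ E') (x : X) :
    app (c • f) x = c • app f x := rfl

instance : Preadditive (HolBundle X) where
  add_comp _ _ _ f g h := hom_ext fun x => by simp [LinearMap.comp_add]
  comp_add _ _ _ f g h := hom_ext fun x => by simp [LinearMap.add_comp]

instance : Linear ℂ (HolBundle X) where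
  smul_comp _ _ _ c f g := hom_ext fun x => by simp [LinearMap.comp_smul]
  comp_smul _ _ _ f c g := hom_ext fun x => by simp [LinearMap.smul_comp]

end HolBundle
end General

/-! ### Tensor products -/

/-- The bijection `(i₁, i₂) ↦ i₁ + m i₂` used to number the coordinates of a tensor product. -/
def pairIdx (m n : ℕ) : Fin m × Fin n ≃ Fin (m * n) :=
  (Equiv.prodComm _ _).trans (finProdFinEquiv.trans (finCongr (Nat.mul_comm n m)))

/-- The coordinates of the tensor product of two vectors. -/
def kronVec {m n : ℕ} (v : Fin m → ℂ) (w : Fin n → ℂ) : Fin (m * n) → ℂ :=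
  fun k => v ((pairIdx m n).symm k).1 * w ((pairIdx m n).symm k).2

/-- The identification of `ℂᵐ ⊗ ℂⁿ` with `ℂᵐⁿ`. -/
def kronEquiv (m n : ℕ) : (Fin m → ℂ) ⊗[ℂ] (Fin n → ℂ) ≃ₗ[ℂ] (Fin (m * n) → ℂ) :=
  (((Pi.basisFun ℂ (Fin m)).tensorProduct (Pi.basisFun ℂ (Fin n))).reindex (pairIdx m n)).equivFun

@[simp] theorem kronEquiv_tmul {m n : ℕ} (v : Fin m → ℂ) (w : Fin n → ℂ) :
    kronEquiv m n (v ⊗ₜ w) = kronVec v w := by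
  ext k
  simp only [kronEquiv, kronVec, Module.Basis.equivFun_apply, Module.Basis.repr_reindex_apply]
  generalize (pairIdx m n).symm k = p
  obtain ⟨i, j⟩ := p
  rw [Module.Basis.tensorProduct_repr_tmul_apply]
  simp [mul_comm]

@[simp] theorem kronEquiv_symm {m n : ℕ} (v : Fin m → ℂ) (w : Fin n → ℂ) :
    (kronEquiv m n).symm (kronVec v w) = v ⊗ₜ w := by
  rw [LinearEquiv.symm_apply_eq, kronEquiv_tmul]

theorem kron_induction {m n : ℕ} {P : (Fin (m * n) → ℂ) → Prop} (h0 : P 0)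
    (hadd : ∀ a b, P a → P b → P (a + b)) (hk : ∀ v w, P (kronVec v w)) (a) : P a := by
  obtain ⟨t, rfl⟩ := (kronEquiv m n).surjective a
  induction t using TensorProduct.induction_on with
  | zero => simpa using h0
  | tmul v w => simpa using hk v w
  | add s t hs ht => simpa using hadd _ _ hs ht

section General

variable {X : Type} [TopologicalSpace X] [ChartedSpace ℂ X]

theorem kron_holo {m n : ℕ} {f : X → Fin m → ℂ} {g : X → Fin n → ℂ} {s t : Set X}
    (hf : ContMDiffOn 𝓘(ℂ) 𝓘(ℂ, Fin m → ℂ) ω f s) (hg : ContMDiffOn 𝓘(ℂ) 𝓘(ℂ, Fin n → ℂ) ω g t) :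
    ContMDiffOn 𝓘(ℂ) 𝓘(ℂ, Fin (m * n) → ℂ) ω (fun x => kronVec (f x) (g x)) (s ∩ t) := by
  refine contMDiffOn_pi_space.2 fun k => ?_
  exact ((contMDiffOn_pi_space.1 (hf.mono Set.inter_subset_left)) _).mul
    ((contMDiffOn_pi_space.1 (hg.mono Set.inter_subset_right)) _)

/-- To test holomorphy of a family of linear maps, decomposable vectors are enough. -/
theorem holo_of_kron {m n p : ℕ} {g : X → (Fin (m * n) → ℂ) →ₗ[ℂ] (Fin p → ℂ)} {s : Set X}
    (h : ∀ v w, ContMDiffOn 𝓘(ℂ) 𝓘(ℂ, Fin p → ℂ) ω (fun x => g x (kronVec v w)) s) (a) :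
    ContMDiffOn 𝓘(ℂ) 𝓘(ℂ, Fin p → ℂ) ω (fun x => g x a) s := by
  induction a using kron_induction with
  | h0 => simpa using contMDiffOn_const
  | hadd a b ha hb => exact (ha.add hb).congr fun x _ => by simp
  | hk v w => exact h v w

namespace FrameAtlas

section

variable {m n : ℕ} {E E' : X → Type} [∀ x, AddCommGroup (E x)] [∀ x, Module ℂ (E x)]
  [∀ x, AddCommGroup (E' x)] [∀ x, Module ℂ (E' x)]

theorem trans_holo' (A B : FrameAtlas m E) (A' B' : FrameAtlas n E')
    (h : ∀ i j v, ContMDiffOn 𝓘(ℂ) 𝓘(ℂ, Fin m → ℂ) ω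
      (fun x => B.toCoord j x (A.ofCoord i x v)) (A.U i ∩ B.U j))
    (h' : ∀ i j v, ContMDiffOn 𝓘(ℂ) 𝓘(ℂ, Fin n → ℂ) ω
      (fun x => B'.toCoord j x (A'.ofCoord i x v)) (A'.U i ∩ B'.U j)) (i j i' j' v) :
    ContMDiffOn 𝓘(ℂ) 𝓘(ℂ, Fin (m * n) → ℂ) ω
      (fun x => ((kronEquiv m n).toLinearMap ∘ₗ
          TensorProduct.map (B.toCoord j x) (B'.toCoord j' x))
        ((TensorProduct.map (A.ofCoord i x) (A'.ofCoord i' x) ∘ₗ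
          (kronEquiv m n).symm.toLinearMap) v))
      ((A.U i ∩ A'.U i') ∩ (B.U j ∩ B'.U j')) := by
  refine holo_of_kron (g := fun x => ((kronEquiv m n).toLinearMap ∘ₗ
      TensorProduct.map (B.toCoord j x) (B'.toCoord j' x)) ∘ₗ
        (TensorProduct.map (A.ofCoord i x) (A'.ofCoord i' x) ∘ₗ
          (kronEquiv m n).symm.toLinearMap)) (fun v w => ?_) v
  refine ((kron_holo (h i j v) (h' i' j' w)).mono ?_).congr fun x hx => ?_
  · rintro x ⟨⟨h1, h2⟩, h3, h4⟩
    exact ⟨⟨h1, h3⟩, h2, h4⟩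
  · simp

/-- The tensor product of two atlases of frames. -/
def tensor (A : FrameAtlas m E) (A' : FrameAtlas n E') :
    FrameAtlas (m * n) (fun x => E x ⊗[ℂ] E' x) where
  ι := A.ι × A'.ι
  U i := A.U i.1 ∩ A'.U i.2
  isOpen i := (A.isOpen _).inter (A'.isOpen _)
  idx x := (A.idx x, A'.idx x)
  mem_idx x := ⟨A.mem_idx x, A'.mem_idx x⟩
  toCoord i x := (kronEquiv m n).toLinearMap ∘ₗ
    TensorProduct.map (A.toCoord i.1 x) (A'.toCoord i.2 x)
  ofCoord i x := TensorProduct.map (A.ofCoord i.1 x) (A'.ofCoord i.2 x) ∘ₗ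
    (kronEquiv m n).symm.toLinearMap
  of_to i x hx v := by
    induction v using TensorProduct.induction_on with
    | zero => simp
    | tmul v w => simp [A.of_to _ x hx.1, A'.of_to _ x hx.2]
    | add s t hs ht => rw [map_add, map_add, hs, ht]
  to_of i x hx v := by
    induction v using kron_induction with
    | h0 => simp
    | hk v w => simp [A.to_of _ x hx.1, A'.to_of _ x hx.2]
    | hadd s t hs ht => rw [map_add, map_add, hs, ht]
  holo i j v := trans_holo' A A A' A' A.holo A'.holo _ _ _ _ v

end

theorem tensor_const {m n : ℕ} {E E' : X → Type} [∀ x, AddCommGroup (E x)] [∀ x, Module ℂ (E x)]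
    [∀ x, AddCommGroup (E' x)] [∀ x, Module ℂ (E' x)] (A : FrameAtlas m E) (B : FrameAtlas n E')
    (i j : A.ι) (i' j' : B.ι) (g : (Fin m → ℂ) →ₗ[ℂ] (Fin m → ℂ))
    (h : (Fin n → ℂ) →ₗ[ℂ] (Fin n → ℂ))
    (hg : ∀ x ∈ A.U i ∩ A.U j, ∀ v, A.toCoord j x (A.ofCoord i x v) = g v)
    (hh : ∀ x ∈ B.U i' ∩ B.U j', ∀ v, B.toCoord j' x (B.ofCoord i' x v) = h v) (x : X)
    (hx : x ∈ (A.tensor B).U (i, i') ∩ (A.tensor B).U (j, j')) (v) :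
    (A.tensor B).toCoord (j, j') x ((A.tensor B).ofCoord (i, i') x v) =
      ((kronEquiv m n).toLinearMap ∘ₗ TensorProduct.map g h ∘ₗ
        (kronEquiv m n).symm.toLinearMap) v := by
  obtain ⟨⟨h1, h2⟩, h3, h4⟩ := hx
  induction v using kron_induction with
  | h0 => simp
  | hadd a b ha hb => rw [map_add, map_add, map_add, ha, hb]
  | hk a b => simp [tensor, hg x ⟨h1, h3⟩, hh x ⟨h2, h4⟩]

/-- The atlas of the trivial line bundle. -/
def unit (X : Type) [TopologicalSpace X] [ChartedSpace ℂ X] : FrameAtlas 1 (fun _ : X => ℂ) where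
  ι := Unit
  U _ := Set.univ
  isOpen _ := isOpen_univ
  idx _ := ()
  mem_idx _ := trivial
  toCoord _ _ := (LinearEquiv.funUnique (Fin 1) ℂ ℂ).symm.toLinearMap
  ofCoord _ _ := (LinearEquiv.funUnique (Fin 1) ℂ ℂ).toLinearMap
  of_to _ _ _ v := by simp
  to_of _ _ _ v := (LinearEquiv.funUnique (Fin 1) ℂ ℂ).symm_apply_apply v
  holo _ _ v := contMDiffOn_const

end FrameAtlas

namespace HolBundle

/-- The trivial line bundle. -/
def unitBundle (X : Type) [TopologicalSpace X] [ChartedSpace ℂ X] : HolBundle X :=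
  (FrameAtlas.unit X).toHolBundle

/-- The tensor product of two holomorphic vector bundles; its fibre at `x` is the tensor product of
the fibres at `x`. -/
def tensor (E E' : HolBundle X) : HolBundle X :=
  (E.frames.tensor E'.frames).toHolBundle

theorem trans_of_compat {E : HolBundle X} {A B : FrameAtlas E.rank E.fiber} (hA : E.Compat A)
    (hB : E.Compat B) (i j v) : ContMDiffOn 𝓘(ℂ) 𝓘(ℂ, Fin E.rank → ℂ) ω
      (fun x => B.toCoord j x (A.ofCoord i x v)) (A.U i ∩ B.U j) :=
  (isHol_iff hA hB _).1 E.isHol_id i j v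

theorem Compat.tensor {E E' : HolBundle X} {A : FrameAtlas E.rank E.fiber}
    {A' : FrameAtlas E'.rank E'.fiber} (hA : E.Compat A) (hA' : E'.Compat A') :
    (E.tensor E').Compat (A.tensor A') := by
  refine compat_of_trans (E := E.tensor E') (E.frames.tensor E'.frames).compat ?_ ?_
  · intro i j v
    exact FrameAtlas.trans_holo' _ _ _ _ (trans_of_compat E.compat_frames hA)
      (trans_of_compat E'.compat_frames hA') _ _ _ _ v
  · intro i j v
    exact FrameAtlas.trans_holo' _ _ _ _ (trans_of_compat hA E.compat_frames)
      (trans_of_compat hA' E'.compat_frames) _ _ _ _ v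

theorem compat_unit : (unitBundle X).Compat (FrameAtlas.unit X) := (FrameAtlas.unit X).compat

/-- The tensor product of two morphisms. -/
def tensorMap {E E' F F' : HolBundle X} (f : E ⟶ E') (g : F ⟶ F') : E.tensor F ⟶ E'.tensor F' :=
  mkHom (E := E.tensor F) (E' := E'.tensor F')
    (fun x => TensorProduct.map (app f x) (app g x)) <| by
    refine (isHol_iff (E.compat_frames.tensor F.compat_frames)
      (E'.compat_frames.tensor F'.compat_frames) _).2 fun i j v => ?_
    have hf := (isHol_iff E.compat_frames E'.compat_frames _).1 (app_holo f) i.1 j.1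
    have hg := (isHol_iff F.compat_frames F'.compat_frames _).1 (app_holo g) i.2 j.2
    refine holo_of_kron (g := fun x => (E'.frames.tensor F'.frames).toCoord j x ∘ₗ
      TensorProduct.map (app f x) (app g x) ∘ₗ (E.frames.tensor F.frames).ofCoord i x)
      (fun v w => ?_) v
    refine ((kron_holo (hf v) (hg w)).mono ?_).congr fun x hx => ?_
    · rintro x ⟨⟨h1, h2⟩, h3, h4⟩
      exact ⟨⟨h1, h3⟩, h2, h4⟩
    · simp [FrameAtlas.tensor]

/-- Two mutually inverse families of linear maps which are holomorphic define an isomorphism. -/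
def mkIso {E E' : HolBundle X} (e : ∀ x, E.fiber x ≃ₗ[ℂ] E'.fiber x)
    (h : E.IsHol E' fun x => (e x).toLinearMap) (h' : E'.IsHol E fun x => (e x).symm.toLinearMap) :
    E ≅ E' where
  hom := mkHom _ h
  inv := mkHom _ h'
  hom_inv_id := hom_ext fun x => by ext; simp
  inv_hom_id := hom_ext fun x => by ext; simp

end HolBundle


namespace HolBundle

/-- The associativity isomorphism. -/
def assoc (E F G : HolBundle X) : (E.tensor F).tensor G ≅ E.tensor (F.tensor G) :=
  mkIso (E := (E.tensor F).tensor G) (E' := E.tensor (F.tensor G))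
    (fun x => TensorProduct.assoc ℂ (E.fiber x) (F.fiber x) (G.fiber x))
    (by
      refine (isHol_iff ((E.compat_frames.tensor F.compat_frames).tensor G.compat_frames)
        (E.compat_frames.tensor (F.compat_frames.tensor G.compat_frames)) _).2
          fun ⟨⟨i1, i2⟩, i3⟩ ⟨j1, j2, j3⟩ v => ?_
      refine holo_of_kron (g := fun x =>
        (E.frames.tensor (F.frames.tensor G.frames)).toCoord (j1, j2, j3) x ∘ₗ
        (TensorProduct.assoc ℂ (E.fiber x) (F.fiber x) (G.fiber x)).toLinearMap ∘ₗ
        ((E.frames.tensor F.frames).tensor G.frames).ofCoord ((i1, i2), i3) x) (fun v w => ?_) v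
      induction v using kron_induction with
      | h0 =>
        refine (contMDiffOn_const (c := 0)).congr fun x _ => ?_
        have : kronVec (0 : Fin (E.rank * F.rank) → ℂ) w = 0 := by ext; simp [kronVec]
        rw [this, map_zero]
      | hadd a b ha hb =>
        refine (ha.add hb).congr fun x _ => ?_
        have : kronVec (a + b) w = kronVec a w + kronVec b w := by ext; simp [kronVec, add_mul]
        rw [this, map_add]; rfl
      | hk a b =>
        refine ((kron_holo (E.frames.holo i1 j1 a) (kron_holo (F.frames.holo i2 j2 b)
          (G.frames.holo i3 j3 w))).mono ?_).congr fun x hx => ?_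
        · rintro x ⟨⟨⟨h1, h2⟩, h3⟩, h4, h5, h6⟩
          exact ⟨⟨h1, h4⟩, ⟨h2, h5⟩, h3, h6⟩
        · simp [FrameAtlas.tensor])
    (by
      refine (isHol_iff (E.compat_frames.tensor (F.compat_frames.tensor G.compat_frames))
        ((E.compat_frames.tensor F.compat_frames).tensor G.compat_frames) _).2
          fun ⟨j1, j2, j3⟩ ⟨⟨i1, i2⟩, i3⟩ v => ?_
      refine holo_of_kron (g := fun x =>
        ((E.frames.tensor F.frames).tensor G.frames).toCoord ((i1, i2), i3) x ∘ₗ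
        (TensorProduct.assoc ℂ (E.fiber x) (F.fiber x) (G.fiber x)).symm.toLinearMap ∘ₗ
        (E.frames.tensor (F.frames.tensor G.frames)).ofCoord (j1, j2, j3) x) (fun w v => ?_) v
      induction v using kron_induction with
      | h0 =>
        refine (contMDiffOn_const (c := 0)).congr fun x _ => ?_
        have : kronVec w (0 : Fin (F.rank * G.rank) → ℂ) = 0 := by ext; simp [kronVec]
        rw [this, map_zero]
      | hadd a b ha hb =>
        refine (ha.add hb).congr fun x _ => ?_
        have : kronVec w (a + b) = kronVec w a + kronVec w b := by ext; simp [kronVec, mul_add]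
        rw [this, map_add]; rfl
      | hk a b =>
        refine ((kron_holo (kron_holo (E.frames.holo j1 i1 w) (F.frames.holo j2 i2 a))
          (G.frames.holo j3 i3 b)).mono ?_).congr fun x hx => ?_
        · rintro x ⟨⟨h1, h2, h3⟩, ⟨h4, h5⟩, h6⟩
          exact ⟨⟨⟨h1, h4⟩, h2, h5⟩, h3, h6⟩
        · simp [FrameAtlas.tensor])

/-- The left unit isomorphism. -/
def leftUnit (E : HolBundle X) : (unitBundle X).tensor E ≅ E :=
  mkIso (E := (unitBundle X).tensor E) (E' := E) (fun x => TensorProduct.lid ℂ (E.fiber x))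
    (by
      refine (isHol_iff (compat_unit.tensor E.compat_frames) E.compat_frames _).2
          fun ⟨_, i⟩ j v => ?_
      refine holo_of_kron (g := fun x => E.frames.toCoord j x ∘ₗ
        (TensorProduct.lid ℂ (E.fiber x)).toLinearMap ∘ₗ
        ((FrameAtlas.unit X).tensor E.frames).ofCoord ((), i) x) (fun v w => ?_) v
      refine ((smul_holo (v 0) (E.frames.holo i j w)).mono ?_).congr
        fun x hx => ?_
      · rintro x ⟨⟨_, h1⟩, h2⟩
        exact ⟨h1, h2⟩
      · simp [FrameAtlas.tensor, FrameAtlas.unit])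
    (by
      refine (isHol_iff E.compat_frames (compat_unit.tensor E.compat_frames) _).2
          fun i ⟨_, j⟩ v => ?_
      refine ((kron_holo (contMDiffOn_const (c := fun _ => 1) (s := Set.univ))
        (E.frames.holo i j v)).mono ?_).congr fun x hx => ?_
      · rintro x ⟨h1, _, h2⟩
        exact ⟨trivial, h1, h2⟩
      · change kronEquiv 1 E.rank (TensorProduct.map _ _ ((1 : ℂ) ⊗ₜ[ℂ] _)) = _
        rw [TensorProduct.map_tmul, kronEquiv_tmul]
        rfl)

/-- The right unit isomorphism. -/
def rightUnit (E : HolBundle X) : E.tensor (unitBundle X) ≅ E :=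
  mkIso (E := E.tensor (unitBundle X)) (E' := E) (fun x => TensorProduct.rid ℂ (E.fiber x))
    (by
      refine (isHol_iff (E.compat_frames.tensor compat_unit) E.compat_frames _).2
          fun ⟨i, _⟩ j v => ?_
      refine holo_of_kron (g := fun x => E.frames.toCoord j x ∘ₗ
        (TensorProduct.rid ℂ (E.fiber x)).toLinearMap ∘ₗ
        (E.frames.tensor (FrameAtlas.unit X)).ofCoord (i, ()) x) (fun v w => ?_) v
      refine ((smul_holo (w 0) (E.frames.holo i j v)).mono ?_).congr
        fun x hx => ?_
      · rintro x ⟨⟨h1, _⟩, h2⟩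
        exact ⟨h1, h2⟩
      · simp [FrameAtlas.tensor, FrameAtlas.unit])
    (by
      refine (isHol_iff E.compat_frames (E.compat_frames.tensor compat_unit) _).2
          fun i ⟨j, _⟩ v => ?_
      refine ((kron_holo (E.frames.holo i j v) (contMDiffOn_const (c := fun _ => 1)
        (s := Set.univ))).mono ?_).congr fun x hx => ?_
      · rintro x ⟨h1, h2, _⟩
        exact ⟨⟨h1, h2⟩, trivial⟩
      · change kronEquiv E.rank 1 (TensorProduct.map _ _ (_ ⊗ₜ[ℂ] (1 : ℂ))) = _
        rw [TensorProduct.map_tmul, kronEquiv_tmul]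
        rfl)

theorem braid_holo (E F : HolBundle X) : (E.tensor F).IsHol (F.tensor E)
    (fun x => (TensorProduct.comm ℂ (E.fiber x) (F.fiber x)).toLinearMap) := by
  refine (isHol_iff (E.compat_frames.tensor F.compat_frames)
    (F.compat_frames.tensor E.compat_frames) _).2 fun ⟨i1, i2⟩ ⟨j1, j2⟩ v => ?_
  refine holo_of_kron (g := fun x => (F.frames.tensor E.frames).toCoord (j1, j2) x ∘ₗ
    (TensorProduct.comm ℂ (E.fiber x) (F.fiber x)).toLinearMap ∘ₗ
    (E.frames.tensor F.frames).ofCoord (i1, i2) x) (fun v w => ?_) v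
  refine ((kron_holo (F.frames.holo i2 j1 w) (E.frames.holo i1 j2 v)).mono ?_).congr fun x hx => ?_
  · rintro x ⟨⟨h1, h2⟩, h3, h4⟩
    exact ⟨⟨h2, h3⟩, h1, h4⟩
  · simp [FrameAtlas.tensor]

/-- The commutativity isomorphism. -/
def braid (E F : HolBundle X) : E.tensor F ≅ F.tensor E :=
  mkIso (E := E.tensor F) (E' := F.tensor E)
    (fun x => TensorProduct.comm ℂ (E.fiber x) (F.fiber x)) (braid_holo E F) (braid_holo F E)

instance : MonoidalCategoryStruct (HolBundle X) where
  tensorObj := tensor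
  whiskerLeft E _ _ f := tensorMap (𝟙 E) f
  whiskerRight f E := tensorMap f (𝟙 E)
  tensorHom := tensorMap
  tensorUnit := unitBundle X
  associator := assoc
  leftUnitor := leftUnit
  rightUnitor := rightUnit

instance : MonoidalCategory (HolBundle X) := MonoidalCategory.ofTensorHom
  (id_tensorHom_id := fun E F => hom_ext fun x => TensorProduct.map_id)
  (id_tensorHom := fun _ _ _ _ => rfl)
  (tensorHom_id := fun _ _ => rfl)
  (tensorHom_comp_tensorHom := fun f f' g g' => hom_ext fun x =>
    (TensorProduct.map_comp (app g x) (app g' x) (app f x) (app f' x)).symm)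
  (associator_naturality := fun f g h => hom_ext fun x =>
    TensorProduct.ext_threefold fun a b c => rfl)
  (leftUnitor_naturality := fun f => hom_ext fun x => TensorProduct.ext' fun a b => by
    exact ((app f x).map_smul a b).symm)
  (rightUnitor_naturality := fun f => hom_ext fun x => TensorProduct.ext' fun a b => by
    exact ((app f x).map_smul b a).symm)
  (pentagon := fun E F G H => hom_ext fun x =>
    TensorProduct.ext_fourfold fun a b c d => rfl)
  (triangle := fun E F => hom_ext fun x => TensorProduct.ext_threefold fun a b c => by
    exact (TensorProduct.smul_tmul (R := ℂ) (show ℂ from b) a c).symm)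

instance : SymmetricCategory (HolBundle X) where
  braiding := braid
  braiding_naturality_right _ _ _ _ := hom_ext fun _ => TensorProduct.ext' fun _ _ => rfl
  braiding_naturality_left _ _ := hom_ext fun _ => TensorProduct.ext' fun _ _ => rfl
  hexagon_forward _ _ _ := hom_ext fun _ => TensorProduct.ext_threefold fun _ _ _ => rfl
  hexagon_reverse _ _ _ := hom_ext fun _ => TensorProduct.ext_threefold' fun _ _ _ => rfl
  symmetry _ _ := hom_ext fun _ => TensorProduct.ext' fun _ _ => rfl

/-- A holomorphic vector bundle is flat if it has holomorphic local trivializations over some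
open covering whose transition matrices are constant. -/
def IsFlat : ObjectProperty (HolBundle X) := fun E =>
  ∃ A : FrameAtlas E.rank E.fiber, E.Compat A ∧
    ∀ i j, ∃ g : (Fin E.rank → ℂ) →ₗ[ℂ] (Fin E.rank → ℂ),
      ∀ x ∈ A.U i ∩ A.U j, ∀ v, A.toCoord j x (A.ofCoord i x v) = g v

instance : (IsFlat (X := X)).IsMonoidal where
  prop_unit := ⟨FrameAtlas.unit X, compat_unit, fun _ _ => ⟨LinearMap.id, fun x _ v =>
    (FrameAtlas.unit X).to_of () x trivial v⟩⟩
  prop_tensor := by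
    rintro E F ⟨A, hA, hA'⟩ ⟨B, hB, hB'⟩
    refine ⟨A.tensor B, hA.tensor hB, fun ⟨i1, i2⟩ ⟨j1, j2⟩ => ?_⟩
    obtain ⟨g, hg⟩ := hA' i1 j1
    obtain ⟨h, hh⟩ := hB' i2 j2
    exact ⟨_, A.tensor_const B i1 j1 i2 j2 g h hg hh⟩

end HolBundle

/-- The category of flat holomorphic vector bundles over `X`: a full subcategory of the category of
holomorphic vector bundles. -/
abbrev FlatBundle (X : Type) [TopologicalSpace X] [ChartedSpace ℂ X] :=
  (HolBundle.IsFlat (X := X)).FullSubcategory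

end General

/-! ### The elliptic curve `ℂˣ / q^ℤ` -/

/-- The elliptic curve `ℂˣ / q^ℤ`. -/
abbrev EllCurve (q : ℂˣ) : Type := ℂˣ ⧸ Subgroup.zpowers q

/-- The projection `ℂˣ → ℂˣ / q^ℤ`. -/
abbrev proj (q : ℂˣ) : ℂˣ → EllCurve q := QuotientGroup.mk

theorem proj_eq_iff {q z w : ℂˣ} : proj q z = proj q w ↔ ∃ k : ℤ, w = q ^ k * z := by
  rw [QuotientGroup.eq, Subgroup.mem_zpowers_iff]
  refine exists_congr fun k => ?_
  rw [eq_inv_mul_iff_mul_eq, mul_comm, eq_comm]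

/-- The logarithm of `|z|` to the base `|q|`. -/
def lev (q : ℂˣ) (z : ℂˣ) : ℝ := Real.log ‖(z : ℂ)‖ / Real.log ‖(q : ℂ)‖

theorem continuous_lev (q : ℂˣ) : Continuous (lev q) :=
  (Continuous.log (Units.continuous_val.norm) fun z => by simp).div_const _

set_option linter.unusedSectionVars false

section Curve

variable (q : ℂˣ) [hq : Fact (1 < ‖(q : ℂ)‖)]

theorem lev_mul (k : ℤ) (z : ℂˣ) : lev q (q ^ k * z) = k + lev q z := by
  have h1 : Real.log ‖(q : ℂ)‖ ≠ 0 := (Real.log_pos hq.out).ne'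
  have h2 : ‖(z : ℂ)‖ ≠ 0 := by simp
  have h3 : ‖(q : ℂ)‖ ^ k ≠ 0 := zpow_ne_zero _ (by simp)
  rw [lev, lev, Units.val_mul, Units.val_zpow_eq_zpow_val, norm_mul, norm_zpow,
    Real.log_mul h3 h2, Real.log_zpow]
  field_simp

variable {q} in
theorem zpow_mul_injective {k l : ℤ} {z : ℂˣ} (h : q ^ k * z = q ^ l * z) : k = l := by
  have := congrArg (lev q) h
  rw [lev_mul, lev_mul] at this
  exact_mod_cast add_right_cancel this

theorem isDiscrete_zpowers : IsDiscrete (Subgroup.zpowers q : Set ℂˣ) := by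
  rw [isDiscrete_iff_forall_mem_exists_isOpen]
  intro y hy
  refine ⟨lev q ⁻¹' Metric.ball (lev q y) 1, Metric.isOpen_ball.preimage (continuous_lev q), ?_⟩
  ext z
  constructor
  · rintro ⟨h1, h2⟩
    obtain ⟨k, rfl⟩ := hy
    obtain ⟨l, rfl⟩ := h2
    have hk := lev_mul q k 1
    have hl := lev_mul q l 1
    rw [mul_one] at hk hl
    have h3 : dist (lev q (q ^ l)) (lev q (q ^ k)) < 1 := h1
    rw [hk, hl, dist_add_right, Int.dist_cast_real, Int.dist_eq] at h3
    have h4 : |l - k| < 1 := by exact_mod_cast h3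
    have h5 : l = k := by rw [Int.abs_lt_one_iff] at h4; omega
    simp [h5]
  · rintro rfl
    exact ⟨Metric.mem_ball_self one_pos, hy⟩

theorem isQuotientCoveringMap_proj : IsQuotientCoveringMap (proj q) (Subgroup.zpowers q) :=
  (Subgroup.zpowers q).isQuotientCoveringMap_of_comm (isDiscrete_zpowers q)

theorem isLocalHomeomorph_proj : IsLocalHomeomorph (proj q) :=
  (isQuotientCoveringMap_proj q).isCoveringMap.isLocalHomeomorph

/-- The charts of `ℂˣ / q^ℤ` are the local sections of the projection `ℂˣ → ℂˣ / q^ℤ`. -/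
instance : ChartedSpace ℂ (EllCurve q) :=
  (isLocalHomeomorph_proj q).chartedSpace QuotientGroup.mk_surjective

variable {q} in
/-- Two continuous lifts to `ℂˣ` differ locally by a constant power of `q`. -/
theorem lift_eventually {α : Type*} [TopologicalSpace α] {a b : α → ℂˣ} {x₀ : α} {k : ℤ}
    (ha : ContinuousAt a x₀) (hb : ContinuousAt b x₀)
    (hab : ∀ᶠ x in 𝓝 x₀, proj q (a x) = proj q (b x)) (h0 : b x₀ = q ^ k * a x₀) :
    ∀ᶠ x in 𝓝 x₀, b x = q ^ k * a x := by
  have hc : ContinuousAt (fun x => lev q (b x) - lev q (a x)) x₀ :=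
    ((continuous_lev q).continuousAt.comp hb).sub ((continuous_lev q).continuousAt.comp ha)
  have h1 := hc.preimage_mem_nhds (Metric.ball_mem_nhds _ one_pos)
  filter_upwards [hab, h1] with x hx h2
  obtain ⟨l, hl⟩ := proj_eq_iff.1 hx
  have h3 : dist (lev q (b x) - lev q (a x)) (lev q (b x₀) - lev q (a x₀)) < 1 := h2
  rw [h0, hl, lev_mul, lev_mul, add_sub_cancel_right, add_sub_cancel_right, Int.dist_cast_real,
    Int.dist_eq] at h3
  have h4 : |l - k| < 1 := by exact_mod_cast h3
  have h5 : l = k := by rw [Int.abs_lt_one_iff] at h4; omega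
  rw [hl, h5]

theorem atlas_spec {e : OpenPartialHomeomorph (EllCurve q) ℂ} (he : e ∈ atlas ℂ (EllCurve q)) :
    ∃ l : OpenPartialHomeomorph (EllCurve q) ℂˣ, l.source = e.source ∧
      (∀ x ∈ e.source, proj q (l x) = x) ∧ ∀ x, e x = (l x : ℂ) := by
  obtain ⟨x₀, rfl⟩ := he
  refine ⟨(isLocalHomeomorph_proj q).localInverseAt (X := ℂˣ) (Y := EllCurve q) (f := proj q)
    ((QuotientGroup.mk_surjective (s := Subgroup.zpowers q)).hasRightInverse.choose x₀),
    ?_, fun x hx => ?_, fun x => ?_⟩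
  · rw [OpenPartialHomeomorph.trans_source, Units.chartAt_source]
    simp
  · refine (isLocalHomeomorph_proj q).apply_localInverseAt_of_mem ?_
    rw [OpenPartialHomeomorph.trans_source] at hx
    exact hx.1
  · rfl

instance : IsManifold 𝓘(ℂ) ω (EllCurve q) := by
  refine isManifold_of_contDiffOn _ _ _ fun e e' he he' => ?_
  obtain ⟨l, hl, hl1, hl2⟩ := atlas_spec q he
  obtain ⟨l', hl', hl1', hl2'⟩ := atlas_spec q he'
  intro w₀ hw₀
  have hw₀' : w₀ ∈ (e.symm ≫ₕ e').source := by simpa using hw₀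
  rw [OpenPartialHomeomorph.trans_source] at hw₀'
  obtain ⟨h1, h2⟩ := hw₀'
  have hx1 : e.symm w₀ ∈ e.source := e.map_target h1
  have hx2 : e.symm w₀ ∈ e'.source := h2
  have hc : ContinuousAt e.symm w₀ := e.continuousAt_symm h1
  obtain ⟨k, hk⟩ := proj_eq_iff.1 ((hl1 _ hx1).trans (hl1' _ hx2).symm)
  have hev := lift_eventually (q := q) (a := fun w => l (e.symm w)) (b := fun w => l' (e.symm w))
    (x₀ := w₀) (k := k) ((l.continuousAt (hl ▸ hx1)).comp hc) ((l'.continuousAt (hl' ▸ hx2)).comp hc)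
    (by
      filter_upwards [hc.preimage_mem_nhds (e.open_source.mem_nhds hx1),
        hc.preimage_mem_nhds (e'.open_source.mem_nhds hx2)] with w hw hw'
      exact (hl1 _ hw).trans (hl1' _ hw').symm) hk
  have key : (𝓘(ℂ) ∘ e.symm ≫ₕ e' ∘ 𝓘(ℂ).symm) =ᶠ[𝓝 w₀] fun w => ((q ^ k : ℂˣ) : ℂ) * w := by
    filter_upwards [hev, e.open_target.mem_nhds h1] with w hw hwt
    have h3 : (e.symm ≫ₕ e') w = ((l' (e.symm w) : ℂˣ) : ℂ) := hl2' _
    have h4 : w = ((l (e.symm w) : ℂˣ) : ℂ) := by rw [← hl2, e.right_inv hwt]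
    change (e.symm ≫ₕ e') w = _
    rw [h3, hw, Units.val_mul, ← h4]
  exact (ContDiffAt.congr_of_eventuallyEq (by fun_prop) key).contDiffWithinAt

/-- A continuous lift to `ℂˣ` is holomorphic. -/
theorem lift_holo {s : EllCurve q → ℂˣ} {x₀ : EllCurve q} (hs : ContinuousAt s x₀)
    (h : ∀ᶠ x in 𝓝 x₀, proj q (s x) = x) :
    ContMDiffAt 𝓘(ℂ) 𝓘(ℂ) ω (fun x => (s x : ℂ)) x₀ := by
  obtain ⟨l, hl, hl1, hl2⟩ := atlas_spec q (chart_mem_atlas ℂ x₀)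
  have hx := mem_chart_source ℂ x₀
  obtain ⟨k, hk⟩ := proj_eq_iff.1 ((hl1 _ hx).trans h.self_of_nhds.symm)
  have hev := lift_eventually (l.continuousAt (hl ▸ hx)) hs (by
    filter_upwards [h, (chartAt ℂ x₀).open_source.mem_nhds hx] with x h1 h2
    exact (hl1 _ h2).trans h1.symm) hk
  have hch : ContMDiffAt 𝓘(ℂ) 𝓘(ℂ) ω (chartAt ℂ x₀) x₀ := contMDiffAt_extChartAt
  have : ContMDiffAt 𝓘(ℂ) 𝓘(ℂ) ω (fun x => ((q ^ k : ℂˣ) : ℂ) * chartAt ℂ x₀ x) x₀ :=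
    contMDiffAt_const.mul hch
  refine this.congr_of_eventuallyEq ?_
  filter_upwards [hev] with x hx
  rw [hx, Units.val_mul, hl2]

/-- The annulus `s < lev z < s + 1/2`, on which the projection to `ℂˣ / q^ℤ` is injective. -/
def annulus (s : ℝ) : Set ℂˣ := {z | s < lev q z ∧ lev q z < s + 1 / 2}

theorem isOpen_annulus (s : ℝ) : IsOpen (annulus q s) :=
  (isOpen_lt continuous_const (continuous_lev q)).inter
    (isOpen_lt (continuous_lev q) continuous_const)

open Classical in
/-- The section of the projection `ℂˣ → ℂˣ / q^ℤ` with values in an annulus (extended arbitrarily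
outside the image of the annulus). -/
def lift (s : ℝ) (x : EllCurve q) : ℂˣ :=
  if h : ∃ z ∈ annulus q s, proj q z = x then h.choose else Quotient.out x

@[simp] theorem proj_lift (s : ℝ) (x : EllCurve q) : proj q (lift q s x) = x := by
  unfold lift
  split_ifs with h
  · exact h.choose_spec.2
  · exact QuotientGroup.out_eq' x

theorem lift_mem {s : ℝ} {x : EllCurve q} (hx : x ∈ proj q '' annulus q s) :
    lift q s x ∈ annulus q s := by
  have hx' : ∃ z ∈ annulus q s, proj q z = x := hx
  unfold lift
  rw [dif_pos hx']
  exact hx'.choose_spec.1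

theorem annulus_shift {s t : ℝ} {k : ℤ} {z w : ℂˣ} (hz : z ∈ annulus q s) (hw : w ∈ annulus q t)
    (h : w = q ^ k * z) : k = round (t - s) := by
  rw [h] at hw
  obtain ⟨h1, h2⟩ := hz
  obtain ⟨h3, h4⟩ := hw
  rw [lev_mul] at h3 h4
  rw [eq_comm, round_eq, Int.floor_eq_iff]
  constructor <;> linarith

theorem lift_proj {s : ℝ} {z : ℂˣ} (hz : z ∈ annulus q s) : lift q s (proj q z) = z := by
  obtain ⟨k, hk⟩ := proj_eq_iff.1 (proj_lift q s (proj q z))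
  have := annulus_shift q (lift_mem q ⟨z, hz, rfl⟩) hz hk
  rw [sub_self, round_zero] at this
  rw [this, zpow_zero, one_mul] at hk
  exact hk.symm

theorem lift_shift {s t : ℝ} {x : EllCurve q} (hs : x ∈ proj q '' annulus q s)
    (ht : x ∈ proj q '' annulus q t) : lift q t x = q ^ (round (t - s)) * lift q s x := by
  obtain ⟨k, hk⟩ := proj_eq_iff.1 ((proj_lift q s x).trans (proj_lift q t x).symm)
  rw [← annulus_shift q (lift_mem q hs) (lift_mem q ht) hk, hk]

theorem isOpen_image_annulus (s : ℝ) : IsOpen (proj q '' annulus q s) :=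
  (isLocalHomeomorph_proj q).isOpenMap _ (isOpen_annulus q s)

theorem lift_continuousAt {s : ℝ} {x : EllCurve q} (hx : x ∈ proj q '' annulus q s) :
    ContinuousAt (lift q s) x := by
  have h1 : (isLocalHomeomorph_proj q).localInverseAt (lift q s x) x = lift q s x := by
    have h := (isLocalHomeomorph_proj q).localInverseAt_apply_self (x := lift q s x)
    rwa [proj_lift] at h
  have hm : x ∈ ((isLocalHomeomorph_proj q).localInverseAt (lift q s x)).source := by
    have := (isLocalHomeomorph_proj q).apply_self_mem_localInverseAt_source (x := lift q s x)
    rwa [proj_lift] at this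
  have hc := ((isLocalHomeomorph_proj q).localInverseAt (lift q s x)).continuousAt hm
  refine hc.congr ?_
  have hmem : (isLocalHomeomorph_proj q).localInverseAt (lift q s x) x ∈ annulus q s := by
    rw [h1]; exact lift_mem q hx
  filter_upwards [hc.preimage_mem_nhds ((isOpen_annulus q s).mem_nhds hmem),
    ((isLocalHomeomorph_proj q).localInverseAt (lift q s x)).open_source.mem_nhds hm] with y hy hy'
  have h2 := (isLocalHomeomorph_proj q).apply_localInverseAt_of_mem hy'
  have h3 := lift_proj q hy
  rw [h2] at h3
  exact h3.symm

theorem lift_val_holo {s : ℝ} {x : EllCurve q} (hx : x ∈ proj q '' annulus q s) :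
    ContMDiffAt 𝓘(ℂ) 𝓘(ℂ) ω (fun x => (lift q s x : ℂ)) x :=
  lift_holo q (lift_continuousAt q hx) (Filter.Eventually.of_forall fun _ => proj_lift q s _)

end Curve

/-! ### The flat bundle attached to an invertible matrix -/

section FlatBundleOf

variable (q : ℂˣ) {n : ℕ} (A : GL (Fin n) ℂ)

/-- The relation `(z, X) ~ (q z, A X)` on `ℂˣ × ℂⁿ`. -/
def rel (p p' : ℂˣ × (Fin n → ℂ)) : Prop :=
  p' = (q * p.1, (A : Matrix (Fin n) (Fin n) ℂ).mulVec p.2)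

/-- The quotient of `ℂˣ × ℂⁿ` by the equivalence relation generated by `(z, X) ~ (q z, A X)`. -/
def Total : Type := Quot (rel q A)

variable {q} in
/-- The projection of the quotient to `ℂˣ / q^ℤ`. -/
def Total.base : Total q A → EllCurve q :=
  Quot.lift (fun p => proj q p.1) (by
    rintro p _ rfl
    exact proj_eq_iff.2 ⟨1, by simp⟩)

/-- The fibres of the projection to `ℂˣ / q^ℤ`. -/
def Fib (x : EllCurve q) : Type := {p : Total q A // Total.base A p = x}

variable {q}

theorem mk_zpow (k : ℤ) (z : ℂˣ) (X : Fin n → ℂ) :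
    Quot.mk (rel q A) (q ^ k * z, ((A ^ k : GL (Fin n) ℂ) : Matrix (Fin n) (Fin n) ℂ).mulVec X) =
      Quot.mk (rel q A) (z, X) := by
  have step : ∀ k : ℤ, Quot.mk (rel q A)
      (q ^ (k + 1) * z, ((A ^ (k + 1) : GL (Fin n) ℂ) : Matrix (Fin n) (Fin n) ℂ).mulVec X) =
      Quot.mk (rel q A)
        (q ^ k * z, ((A ^ k : GL (Fin n) ℂ) : Matrix (Fin n) (Fin n) ℂ).mulVec X) := by
    intro k
    refine (Quot.sound ?_).symm
    simp only [rel, Matrix.mulVec_mulVec, ← Units.val_mul, add_comm k, zpow_one_add, mul_assoc]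
  induction k with
  | zero => simp
  | succ k ih => rw [step, ih]
  | pred k ih => rw [← step, sub_add_cancel, ih]

theorem mk_eq_iff {z w : ℂˣ} {X Y : Fin n → ℂ} :
    Quot.mk (rel q A) (z, X) = Quot.mk (rel q A) (w, Y) ↔
      ∃ k : ℤ, w = q ^ k * z ∧
        Y = ((A ^ k : GL (Fin n) ℂ) : Matrix (Fin n) (Fin n) ℂ).mulVec X := by
  constructor
  · intro h
    suffices H : ∀ a b : ℂˣ × (Fin n → ℂ), Relation.EqvGen (rel q A) a b → ∃ k : ℤ,
        b.1 = q ^ k * a.1 ∧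
          b.2 = ((A ^ k : GL (Fin n) ℂ) : Matrix (Fin n) (Fin n) ℂ).mulVec a.2 from
      H _ _ (Quot.eqvGen_exact h)
    intro a b hab
    induction hab with
    | rel a b h => exact ⟨1, by rw [h]; simp⟩
    | refl a => exact ⟨0, by simp⟩
    | symm a b _ ih =>
      obtain ⟨k, h1, h2⟩ := ih
      refine ⟨-k, ?_, ?_⟩
      · rw [h1, zpow_neg, inv_mul_cancel_left]
      · rw [h2, Matrix.mulVec_mulVec, ← Units.val_mul, ← zpow_add]
        simp
    | trans a b c _ _ ih ih' =>
      obtain ⟨k, h1, h2⟩ := ih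
      obtain ⟨l, h3, h4⟩ := ih'
      refine ⟨l + k, ?_, ?_⟩
      · rw [h3, h1, zpow_add, mul_assoc]
      · rw [h4, h2, Matrix.mulVec_mulVec, ← Units.val_mul, ← zpow_add]
  · rintro ⟨k, rfl, rfl⟩
    exact (mk_zpow A k z X).symm

variable [hq : Fact (1 < ‖(q : ℂ)‖)]

/-- The class `[z, X]`, in the fibre at `x`, where `x` is the image of `z`. -/
def cls (z : ℂˣ) {x : EllCurve q} (h : proj q z = x) (X : Fin n → ℂ) : Fib q A x :=
  ⟨Quot.mk _ (z, X), h⟩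

theorem cls_bijective (z : ℂˣ) {x : EllCurve q} (h : proj q z = x) :
    Function.Bijective (cls A z h) := by
  constructor
  · intro X Y hXY
    obtain ⟨k, h1, h2⟩ := (mk_eq_iff A).1 (congrArg Subtype.val hXY)
    have : k = 0 := zpow_mul_injective (q := q) (z := z) (by rw [← h1]; simp)
    subst this
    simpa using h2.symm
  · rintro ⟨p, hp⟩
    obtain ⟨⟨w, Y⟩, rfl⟩ := Quot.exists_rep p
    obtain ⟨k, hk⟩ := proj_eq_iff.1 (h.trans hp.symm)
    refine ⟨((A ^ (-k) : GL (Fin n) ℂ) : Matrix (Fin n) (Fin n) ℂ).mulVec Y, Subtype.ext ?_⟩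
    refine (mk_eq_iff A).2 ⟨k, hk, ?_⟩
    rw [Matrix.mulVec_mulVec, ← Units.val_mul, ← zpow_add]
    simp

theorem cls_shift {z : ℂˣ} {x : EllCurve q} (h : proj q z = x) (k : ℤ) {w : ℂˣ}
    (hw : w = q ^ k * z) (h' : proj q w = x) (X : Fin n → ℂ) :
    cls A w h' (((A ^ k : GL (Fin n) ℂ) : Matrix (Fin n) (Fin n) ℂ).mulVec X) = cls A z h X := by
  subst hw
  exact Subtype.ext (mk_zpow A k z X)

/-- The identification of a fibre with `ℂⁿ`. -/
def stdEquiv (x : EllCurve q) : Fib q A x ≃ (Fin n → ℂ) :=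
  (Equiv.ofBijective _ (cls_bijective A (Quotient.out x) (QuotientGroup.out_eq' x))).symm

instance (x : EllCurve q) : AddCommGroup (Fib q A x) := (stdEquiv A x).addCommGroup

instance (x : EllCurve q) : Module ℂ (Fib q A x) := (stdEquiv A x).module ℂ

theorem stdEquiv_cls_out (x : EllCurve q) (X : Fin n → ℂ) :
    stdEquiv A x (cls A (Quotient.out x) (QuotientGroup.out_eq' x) X) = X :=
  Equiv.ofBijective_symm_apply_apply _ (cls_bijective A _ _) X

theorem exists_stdEquiv_cls (z : ℂˣ) {x : EllCurve q} (h : proj q z = x) :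
    ∃ M : Matrix (Fin n) (Fin n) ℂ, ∀ X, stdEquiv A x (cls A z h X) = M.mulVec X := by
  obtain ⟨k, hk⟩ := proj_eq_iff.1 (h.trans (QuotientGroup.out_eq' x).symm)
  refine ⟨((A ^ k : GL (Fin n) ℂ) : Matrix (Fin n) (Fin n) ℂ), fun X => ?_⟩
  rw [← cls_shift A h k hk (QuotientGroup.out_eq' x), stdEquiv_cls_out]

/-- `X ↦ [z, X]` is a linear isomorphism from `ℂⁿ` to the fibre at the image of `z`. -/
def clsEquiv (z : ℂˣ) {x : EllCurve q} (h : proj q z = x) : (Fin n → ℂ) ≃ₗ[ℂ] Fib q A x where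
  __ := Equiv.ofBijective _ (cls_bijective A z h)
  map_add' X Y := by
    obtain ⟨M, hM⟩ := exists_stdEquiv_cls A z h
    refine (stdEquiv A x).injective ?_
    rw [Equiv.add_def, Equiv.apply_symm_apply]
    simp [hM, Matrix.mulVec_add]
  map_smul' c X := by
    obtain ⟨M, hM⟩ := exists_stdEquiv_cls A z h
    refine (stdEquiv A x).injective ?_
    rw [Equiv.smul_def, Equiv.apply_symm_apply]
    simp [hM, Matrix.mulVec_smul]

@[simp] theorem clsEquiv_apply (z : ℂˣ) {x : EllCurve q} (h : proj q z = x) (X : Fin n → ℂ) :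
    clsEquiv A z h X = cls A z h X := rfl

@[simp] theorem clsEquiv_symm_cls (z : ℂˣ) {x : EllCurve q} (h : proj q z = x) (X : Fin n → ℂ) :
    (clsEquiv A z h).symm (cls A z h X) = X :=
  (clsEquiv A z h).symm_apply_apply X

theorem clsEquiv_symm_shift {z : ℂˣ} {x : EllCurve q} (h : proj q z = x) (k : ℤ) {w : ℂˣ}
    (hw : w = q ^ k * z) (h' : proj q w = x) (X : Fin n → ℂ) :
    (clsEquiv A w h').symm (cls A z h X) =
      ((A ^ k : GL (Fin n) ℂ) : Matrix (Fin n) (Fin n) ℂ).mulVec X := by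
  rw [← cls_shift A h k hw h', clsEquiv_symm_cls]

theorem flat_trans {s t : ℝ} {x : EllCurve q}
    (hx : x ∈ proj q '' annulus q s ∩ proj q '' annulus q t) (v : Fin n → ℂ) :
    (clsEquiv A (lift q t x) (proj_lift q t x)).symm
        (clsEquiv A (lift q s x) (proj_lift q s x) v) =
      ((A ^ round (t - s) : GL (Fin n) ℂ) : Matrix (Fin n) (Fin n) ℂ).mulVec v := by
  rw [clsEquiv_apply]
  exact clsEquiv_symm_shift A (proj_lift q s x) _ (lift_shift q hx.1 hx.2) (proj_lift q t x) v

/-- The frames of `(ℂˣ × ℂⁿ)/~` given by the constant vectors `X` over annuli on which the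
projection `ℂˣ → ℂˣ / q^ℤ` is injective. -/
def flatFrames : FrameAtlas n (Fib q A) where
  ι := ℝ
  U s := proj q '' annulus q s
  isOpen s := isOpen_image_annulus q s
  idx x := lev q (Quotient.out x) - 1 / 4
  mem_idx x := ⟨Quotient.out x, ⟨by linarith, by linarith⟩, QuotientGroup.out_eq' x⟩
  toCoord s x := (clsEquiv A (lift q s x) (proj_lift q s x)).symm.toLinearMap
  ofCoord s x := (clsEquiv A (lift q s x) (proj_lift q s x)).toLinearMap
  of_to s x _ v := LinearEquiv.apply_symm_apply _ v
  to_of s x _ v := LinearEquiv.symm_apply_apply _ v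
  holo s t v := by
    refine (contMDiffOn_const (c := ((A ^ round (t - s) : GL (Fin n) ℂ) :
      Matrix (Fin n) (Fin n) ℂ).mulVec v)).congr fun x hx => ?_
    exact flat_trans A hx v

/-- The holomorphic vector bundle `(ℂˣ × ℂⁿ)/~` over `ℂˣ / q^ℤ`. -/
def bundleOf : HolBundle (EllCurve q) := (flatFrames A).toHolBundle

theorem isFlat_bundleOf : (bundleOf (q := q) A).IsFlat :=
  ⟨flatFrames A, (flatFrames A).compat, fun (s t : ℝ) =>
    ⟨Matrix.mulVecLin ((A ^ round (t - s) : GL (Fin n) ℂ) : Matrix (Fin n) (Fin n) ℂ),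
      fun _ hx v => flat_trans A hx v⟩⟩

end FlatBundleOf

/-! ### Constant `q`-difference systems -/

/-- The Kronecker product, with rows and columns numbered by `pairIdx`. -/
def kron {p m r n : ℕ} (M : Matrix (Fin p) (Fin m) ℂ) (N : Matrix (Fin r) (Fin n) ℂ) :
    Matrix (Fin (p * r)) (Fin (m * n)) ℂ :=
  (Matrix.kronecker M N).submatrix (pairIdx p r).symm (pairIdx m n).symm

theorem kron_apply {p m r n : ℕ} (M : Matrix (Fin p) (Fin m) ℂ) (N : Matrix (Fin r) (Fin n) ℂ)
    (i j) : kron M N i j = M ((pairIdx p r).symm i).1 ((pairIdx m n).symm j).1 *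
      N ((pairIdx p r).symm i).2 ((pairIdx m n).symm j).2 := rfl

theorem kron_mul {p m l r n s : ℕ} (M : Matrix (Fin p) (Fin m) ℂ) (M' : Matrix (Fin m) (Fin l) ℂ)
    (N : Matrix (Fin r) (Fin n) ℂ) (N' : Matrix (Fin n) (Fin s) ℂ) :
    kron (M * M') (N * N') = kron M N * kron M' N' := by
  rw [kron, Matrix.kronecker, Matrix.mul_kronecker_mul, ← Matrix.submatrix_mul_equiv _ _ _ (pairIdx m n).symm]
  rfl

@[simp] theorem kron_one (m n : ℕ) :
    kron (1 : Matrix (Fin m) (Fin m) ℂ) (1 : Matrix (Fin n) (Fin n) ℂ) = 1 := by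
  rw [kron, Matrix.kronecker, Matrix.kroneckerMap_one_one _ (by simp) (by simp) (by simp)]
  simp

/-- The matrix of the linear isomorphism which permutes the coordinates by `σ`. -/
def perm {m n : ℕ} (σ : Fin m ≃ Fin n) : Matrix (Fin n) (Fin m) ℂ :=
  (1 : Matrix (Fin m) (Fin m) ℂ).submatrix σ.symm id

theorem perm_mul {m n l : ℕ} (σ : Fin m ≃ Fin n) (M : Matrix (Fin m) (Fin l) ℂ) :
    perm σ * M = M.submatrix σ.symm id := by
  ext i j
  simp [perm, Matrix.mul_apply, Matrix.one_apply]

theorem mul_perm {m n l : ℕ} (σ : Fin m ≃ Fin n) (M : Matrix (Fin l) (Fin n) ℂ) :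
    M * perm σ = M.submatrix id σ := by
  ext i j
  simp [perm, Matrix.mul_apply, Matrix.one_apply, Equiv.symm_apply_eq]

@[simp] theorem perm_refl (n : ℕ) : perm (Equiv.refl (Fin n)) = 1 := by simp [perm]

theorem perm_trans {m n l : ℕ} (σ : Fin m ≃ Fin n) (τ : Fin n ≃ Fin l) :
    perm τ * perm σ = perm (σ.trans τ) := by
  rw [perm_mul]; rfl

/-- The effect of two permutations of coordinates on a tensor product. -/
def tensEquiv {m n m' n' : ℕ} (σ : Fin m ≃ Fin m') (τ : Fin n ≃ Fin n') :
    Fin (m * n) ≃ Fin (m' * n') :=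
  (pairIdx m n).symm.trans ((σ.prodCongr τ).trans (pairIdx m' n'))

theorem kron_perm {m n m' n' : ℕ} (σ : Fin m ≃ Fin m') (τ : Fin n ≃ Fin n') :
    kron (perm σ) (perm τ) = perm (tensEquiv σ τ) := by
  ext i j
  obtain ⟨⟨i1, i2⟩, rfl⟩ := (pairIdx m' n').surjective i
  obtain ⟨⟨j1, j2⟩, rfl⟩ := (pairIdx m n).surjective j
  simp [kron_apply, perm, tensEquiv, Matrix.one_apply, ← ite_and, and_comm]

/-- The numbering of the coordinates of a triple tensor product. -/
def assocEquiv (l m n : ℕ) : Fin (l * m * n) ≃ Fin (l * (m * n)) :=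
  (pairIdx (l * m) n).symm.trans (((pairIdx l m).symm.prodCongr (Equiv.refl _)).trans
    ((Equiv.prodAssoc _ _ _).trans
      (((Equiv.refl _).prodCongr (pairIdx m n)).trans (pairIdx l (m * n)))))

/-- The exchange of the factors of a tensor product. -/
def swapEquiv (m n : ℕ) : Fin (m * n) ≃ Fin (n * m) :=
  (pairIdx m n).symm.trans ((Equiv.prodComm _ _).trans (pairIdx n m))

/-- The coordinates of a tensor product with the unit on the left. -/
def leftEquiv (n : ℕ) : Fin (1 * n) ≃ Fin n :=
  (pairIdx 1 n).symm.trans (Equiv.uniqueProd _ _)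

/-- The coordinates of a tensor product with the unit on the right. -/
def rightEquiv (n : ℕ) : Fin (n * 1) ≃ Fin n :=
  (pairIdx n 1).symm.trans (Equiv.prodUnique _ _)

theorem perm_assoc {l l' m m' n n' : ℕ} (L : Matrix (Fin l') (Fin l) ℂ)
    (M : Matrix (Fin m') (Fin m) ℂ) (N : Matrix (Fin n') (Fin n) ℂ) :
    perm (assocEquiv l' m' n') * kron (kron L M) N =
      kron L (kron M N) * perm (assocEquiv l m n) := by
  rw [perm_mul, mul_perm]
  ext i j
  simp [kron_apply, assocEquiv, mul_assoc]

theorem perm_swap {m m' n n' : ℕ} (M : Matrix (Fin m') (Fin m) ℂ) (N : Matrix (Fin n') (Fin n) ℂ) :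
    perm (swapEquiv m' n') * kron M N = kron N M * perm (swapEquiv m n) := by
  rw [perm_mul, mul_perm]
  ext i j
  simp [kron_apply, swapEquiv, mul_comm]

theorem perm_left {n n' : ℕ} (N : Matrix (Fin n') (Fin n) ℂ) :
    perm (leftEquiv n') * kron (1 : Matrix (Fin 1) (Fin 1) ℂ) N = N * perm (leftEquiv n) := by
  rw [perm_mul, mul_perm]
  ext i j
  simp [kron_apply, leftEquiv, Matrix.one_apply, Subsingleton.elim _ (0 : Fin 1)]

theorem perm_right {n n' : ℕ} (N : Matrix (Fin n') (Fin n) ℂ) :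
    perm (rightEquiv n') * kron N (1 : Matrix (Fin 1) (Fin 1) ℂ) = N * perm (rightEquiv n) := by
  rw [perm_mul, mul_perm]
  ext i j
  simp [kron_apply, rightEquiv, Matrix.one_apply, Subsingleton.elim _ (0 : Fin 1)]

theorem perm_pentagon (k l m n : ℕ) :
    kron (1 : Matrix (Fin k) (Fin k) ℂ) (perm (assocEquiv l m n)) *
      perm (assocEquiv k (l * m) n) *
        kron (perm (assocEquiv k l m)) (1 : Matrix (Fin n) (Fin n) ℂ) =
      perm (assocEquiv k l (m * n)) * perm (assocEquiv (k * l) m n) := by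
  rw [← perm_refl, ← perm_refl, kron_perm, kron_perm, perm_trans, perm_trans, perm_trans]
  refine congrArg perm (Equiv.ext fun x => ?_)
  obtain ⟨⟨y, d⟩, rfl⟩ := (pairIdx _ _).surjective x
  obtain ⟨⟨z, c⟩, rfl⟩ := (pairIdx _ _).surjective y
  obtain ⟨⟨a, b⟩, rfl⟩ := (pairIdx _ _).surjective z
  simp [assocEquiv, tensEquiv]

theorem perm_triangle (m n : ℕ) :
    kron (1 : Matrix (Fin m) (Fin m) ℂ) (perm (leftEquiv n)) * perm (assocEquiv m 1 n) =
      kron (perm (rightEquiv m)) (1 : Matrix (Fin n) (Fin n) ℂ) := by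
  rw [← perm_refl, ← perm_refl, kron_perm, kron_perm, perm_trans]
  refine congrArg perm (Equiv.ext fun x => ?_)
  obtain ⟨⟨z, c⟩, rfl⟩ := (pairIdx _ _).surjective x
  obtain ⟨⟨a, b⟩, rfl⟩ := (pairIdx _ _).surjective z
  simp [assocEquiv, tensEquiv, leftEquiv, rightEquiv]

theorem perm_hexagon (l m n : ℕ) :
    perm (assocEquiv m n l) * perm (swapEquiv l (m * n)) * perm (assocEquiv l m n) =
      kron (1 : Matrix (Fin m) (Fin m) ℂ) (perm (swapEquiv l n)) * perm (assocEquiv m l n) *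
        kron (perm (swapEquiv l m)) (1 : Matrix (Fin n) (Fin n) ℂ) := by
  rw [← perm_refl, ← perm_refl, kron_perm, kron_perm, perm_trans, perm_trans, perm_trans,
    perm_trans]
  refine congrArg perm (Equiv.ext fun x => ?_)
  obtain ⟨⟨z, c⟩, rfl⟩ := (pairIdx _ _).surjective x
  obtain ⟨⟨a, b⟩, rfl⟩ := (pairIdx _ _).surjective z
  simp [assocEquiv, tensEquiv, swapEquiv]

theorem perm_hexagon' (l m n : ℕ) :
    perm (assocEquiv n l m).symm * perm (swapEquiv (l * m) n) * perm (assocEquiv l m n).symm =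
      kron (perm (swapEquiv l n)) (1 : Matrix (Fin m) (Fin m) ℂ) * perm (assocEquiv l n m).symm *
        kron (1 : Matrix (Fin l) (Fin l) ℂ) (perm (swapEquiv m n)) := by
  rw [← perm_refl, ← perm_refl, kron_perm, kron_perm, perm_trans, perm_trans, perm_trans,
    perm_trans]
  refine congrArg perm (Equiv.ext fun x => ?_)
  obtain ⟨⟨a, z⟩, rfl⟩ := (pairIdx _ _).surjective x
  obtain ⟨⟨b, c⟩, rfl⟩ := (pairIdx _ _).surjective z
  simp [assocEquiv, tensEquiv, swapEquiv]

theorem perm_symmetry (m n : ℕ) : perm (swapEquiv n m) * perm (swapEquiv m n) = 1 := by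
  rw [← perm_refl, perm_trans]
  refine congrArg perm (Equiv.ext fun x => ?_)
  obtain ⟨⟨a, b⟩, rfl⟩ := (pairIdx _ _).surjective x
  simp [swapEquiv]

/-- A `q`-difference system `f(qz) = A f(z)` with constant invertible matrix `A`. -/
structure FlatSystem (q : ℂˣ) where
  rank : ℕ
  mat : GL (Fin rank) ℂ

namespace FlatSystem

variable {q : ℂˣ}

/-- The matrix of a constant `q`-difference system. -/
abbrev M (A : FlatSystem q) : Matrix (Fin A.rank) (Fin A.rank) ℂ := A.mat

/-- A matrix-valued function with entries meromorphic at `0`, such that `f(qz) A = B f(z)` near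
`0`. -/
def IsMor (A B : FlatSystem q) (f : ℂ → Matrix (Fin B.rank) (Fin A.rank) ℂ) : Prop :=
  (∀ i j, MeromorphicAt (fun z => f z i j) 0) ∧ ∀ᶠ z in 𝓝[≠] (0 : ℂ), f (q * z) * A.M = B.M * f z

/-- The complex vector space of morphisms `A ⟶ B`: the germs at `0` of meromorphic matrices `F`
such that `F(qz) A = B F(z)`. Germs are taken along punctured neighbourhoods of `0`. -/
def homs (A B : FlatSystem q) :
    Submodule ℂ ((𝓝[≠] (0 : ℂ)).Germ (Matrix (Fin B.rank) (Fin A.rank) ℂ)) where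
  carrier := {F | ∃ f, IsMor A B f ∧ (f : (𝓝[≠] (0 : ℂ)).Germ _) = F}
  zero_mem' := ⟨0, ⟨fun _ _ => MeromorphicAt.const 0 0, by simp⟩, rfl⟩
  add_mem' := by
    rintro _ _ ⟨f, hf, rfl⟩ ⟨g, hg, rfl⟩
    refine ⟨f + g, ⟨fun i j => (hf.1 i j).add (hg.1 i j), ?_⟩, rfl⟩
    filter_upwards [hf.2, hg.2] with z h1 h2
    simp only [Pi.add_apply, Matrix.add_mul, Matrix.mul_add, h1, h2]
  smul_mem' := by
    rintro c _ ⟨f, hf, rfl⟩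
    refine ⟨c • f, ⟨fun i j => (MeromorphicAt.const c 0).mul (hf.1 i j), ?_⟩, rfl⟩
    filter_upwards [hf.2] with z h1
    simp only [Pi.smul_apply, Matrix.smul_mul, Matrix.mul_smul, h1]

theorem IsMor.id (A : FlatSystem q) : IsMor A A (fun _ => 1) :=
  ⟨fun _ _ => MeromorphicAt.const _ 0, by simp⟩

theorem IsMor.comp {A B C : FlatSystem q} {f : ℂ → Matrix (Fin B.rank) (Fin A.rank) ℂ}
    {g : ℂ → Matrix (Fin C.rank) (Fin B.rank) ℂ} (hg : IsMor B C g) (hf : IsMor A B f) :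
    IsMor A C (fun z => g z * f z) := by
  constructor
  · intro i j
    simp only [Matrix.mul_apply]
    exact MeromorphicAt.fun_sum fun k _ => (hg.1 i k).mul (hf.1 k j)
  · filter_upwards [hf.2, hg.2] with z h1 h2
    rw [Matrix.mul_assoc, h1, ← Matrix.mul_assoc, h2, Matrix.mul_assoc]

/-- A function representing a morphism. -/
def rep {A B : FlatSystem q} (F : A.homs B) : ℂ → Matrix (Fin B.rank) (Fin A.rank) ℂ :=
  F.2.choose

theorem rep_isMor {A B : FlatSystem q} (F : A.homs B) : IsMor A B (rep F) := F.2.choose_spec.1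

theorem coe_rep {A B : FlatSystem q} (F : A.homs B) :
    (rep F : (𝓝[≠] (0 : ℂ)).Germ _) = F.1 := F.2.choose_spec.2

/-- The morphism represented by a function. -/
def mkHom {A B : FlatSystem q} (f : ℂ → Matrix (Fin B.rank) (Fin A.rank) ℂ) (hf : IsMor A B f) :
    A.homs B := ⟨f, f, hf, rfl⟩

theorem rep_mkHom {A B : FlatSystem q} {f : ℂ → Matrix (Fin B.rank) (Fin A.rank) ℂ}
    (hf : IsMor A B f) : rep (mkHom f hf) =ᶠ[𝓝[≠] 0] f :=
  Filter.Germ.coe_eq.1 (coe_rep (mkHom f hf))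

theorem mkHom_eq {A B : FlatSystem q} {f : ℂ → Matrix (Fin B.rank) (Fin A.rank) ℂ}
    {hf : IsMor A B f} {F : A.homs B} (h : f =ᶠ[𝓝[≠] 0] rep F) : mkHom f hf = F :=
  Subtype.ext ((Filter.Germ.coe_eq.2 h).trans (coe_rep F))

/-- The category of constant `q`-difference systems, with meromorphic germs at `0` as morphisms. -/
instance : Category (FlatSystem q) where
  Hom A B := A.homs B
  id A := mkHom (fun _ => 1) (IsMor.id A)
  comp F G := mkHom (fun z => rep G z * rep F z) ((rep_isMor G).comp (rep_isMor F))
  id_comp F := mkHom_eq (by filter_upwards [rep_mkHom (IsMor.id _)] with z h; rw [h, Matrix.mul_one])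
  comp_id F := mkHom_eq (by filter_upwards [rep_mkHom (IsMor.id _)] with z h; rw [h, Matrix.one_mul])
  assoc F G H := mkHom_eq (by
    filter_upwards [rep_mkHom ((rep_isMor G).comp (rep_isMor F)),
      rep_mkHom ((rep_isMor H).comp (rep_isMor G)),
      rep_mkHom ((rep_isMor (mkHom _ ((rep_isMor H).comp (rep_isMor G)))).comp (rep_isMor F))]
      with z h1 h2 h3
    rw [h1, h3, h2, Matrix.mul_assoc])

/-- A function representing a morphism. -/
def fn {A B : FlatSystem q} (F : A ⟶ B) : ℂ → Matrix (Fin B.rank) (Fin A.rank) ℂ := rep F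

/-- The morphism represented by a function. -/
def ofFn {A B : FlatSystem q} (f : ℂ → Matrix (Fin B.rank) (Fin A.rank) ℂ) (hf : IsMor A B f) :
    A ⟶ B := mkHom f hf

theorem fn_isMor {A B : FlatSystem q} (F : A ⟶ B) : IsMor A B (fn F) := rep_isMor F

theorem fn_ofFn {A B : FlatSystem q} {f : ℂ → Matrix (Fin B.rank) (Fin A.rank) ℂ}
    (hf : IsMor A B f) : fn (ofFn f hf) =ᶠ[𝓝[≠] 0] f := rep_mkHom hf

theorem hom_ext {A B : FlatSystem q} {F G : A ⟶ B} (h : fn F =ᶠ[𝓝[≠] 0] fn G) : F = G :=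
  Subtype.ext ((coe_rep F).symm.trans ((Filter.Germ.coe_eq.2 h).trans (coe_rep G)))

theorem fn_id (A : FlatSystem q) : fn (𝟙 A) =ᶠ[𝓝[≠] 0] fun _ => 1 := rep_mkHom (IsMor.id A)

theorem fn_comp {A B C : FlatSystem q} (F : A ⟶ B) (G : B ⟶ C) :
    fn (F ≫ G) =ᶠ[𝓝[≠] 0] fun z => fn G z * fn F z :=
  rep_mkHom ((rep_isMor G).comp (rep_isMor F))

instance (A B : FlatSystem q) : AddCommGroup (A ⟶ B) := inferInstanceAs (AddCommGroup (A.homs B))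

instance (A B : FlatSystem q) : Module ℂ (A ⟶ B) := inferInstanceAs (Module ℂ (A.homs B))

theorem fn_add {A B : FlatSystem q} (F G : A ⟶ B) : fn (F + G) =ᶠ[𝓝[≠] 0] fn F + fn G := by
  refine Filter.Germ.coe_eq.1 ((coe_rep (F + G)).trans ?_)
  rw [Filter.Germ.coe_add]
  exact (congrArg₂ (· + ·) (coe_rep F) (coe_rep G)).symm

theorem fn_smul {A B : FlatSystem q} (c : ℂ) (F : A ⟶ B) : fn (c • F) =ᶠ[𝓝[≠] 0] c • fn F := by
  refine Filter.Germ.coe_eq.1 ((coe_rep (c • F)).trans ?_)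
  rw [Filter.Germ.coe_smul]
  exact (congrArg (c • ·) (coe_rep F)).symm

instance : Preadditive (FlatSystem q) where
  add_comp _ _ _ F G H := hom_ext (by
    filter_upwards [fn_comp (F + G) H, fn_add F G, fn_add (F ≫ H) (G ≫ H), fn_comp F H,
      fn_comp G H] with z h1 h2 h3 h4 h5
    rw [h1, h2, h3, Pi.add_apply, Pi.add_apply, h4, h5, Matrix.mul_add])
  comp_add _ _ _ F G H := hom_ext (by
    filter_upwards [fn_comp F (G + H), fn_add G H, fn_add (F ≫ G) (F ≫ H), fn_comp F G,
      fn_comp F H] with z h1 h2 h3 h4 h5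
    rw [h1, h2, h3, Pi.add_apply, Pi.add_apply, h4, h5, Matrix.add_mul])

instance : Linear ℂ (FlatSystem q) where
  smul_comp _ _ _ c F G := hom_ext (by
    filter_upwards [fn_comp (c • F) G, fn_smul c F, fn_smul c (F ≫ G), fn_comp F G]
      with z h1 h2 h3 h4
    rw [h1, h2, h3, Pi.smul_apply, Pi.smul_apply, h4, Matrix.mul_smul])
  comp_smul _ _ _ F c G := hom_ext (by
    filter_upwards [fn_comp F (c • G), fn_smul c G, fn_smul c (F ≫ G), fn_comp F G]
      with z h1 h2 h3 h4
    rw [h1, h2, h3, Pi.smul_apply, Pi.smul_apply, h4, Matrix.smul_mul])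

/-- The morphism given by a constant matrix. -/
def cst {A B : FlatSystem q} (P : Matrix (Fin B.rank) (Fin A.rank) ℂ) (hP : P * A.M = B.M * P) :
    A ⟶ B :=
  ofFn (fun _ => P) ⟨fun _ _ => MeromorphicAt.const _ 0, Filter.Eventually.of_forall fun _ => hP⟩

theorem fn_cst {A B : FlatSystem q} (P : Matrix (Fin B.rank) (Fin A.rank) ℂ)
    (hP : P * A.M = B.M * P) : fn (cst P hP) =ᶠ[𝓝[≠] 0] fun _ => P :=
  fn_ofFn _

theorem perm_symm {A B : FlatSystem q} {σ : Fin A.rank ≃ Fin B.rank}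
    (h : perm σ * A.M = B.M * perm σ) : perm σ.symm * B.M = A.M * perm σ.symm := by
  have h1 : perm σ * perm σ.symm = 1 := by rw [perm_trans]; simp
  have h2 : perm σ.symm * perm σ = 1 := by rw [perm_trans]; simp
  calc perm σ.symm * B.M = perm σ.symm * (B.M * perm σ) * perm σ.symm := by
        rw [Matrix.mul_assoc, Matrix.mul_assoc, h1, Matrix.mul_one]
    _ = A.M * perm σ.symm := by
        rw [← h, ← Matrix.mul_assoc, h2, Matrix.one_mul]

/-- The isomorphism given by a permutation of the coordinates. -/
def permIso {A B : FlatSystem q} (σ : Fin A.rank ≃ Fin B.rank)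
    (h : perm σ * A.M = B.M * perm σ) : A ≅ B where
  hom := cst (perm σ) h
  inv := cst (perm σ.symm) (perm_symm h)
  hom_inv_id := hom_ext (by
    filter_upwards [fn_comp (cst (perm σ) h) (cst (perm σ.symm) (perm_symm h)), fn_cst (perm σ) h,
      fn_cst (perm σ.symm) (perm_symm h), fn_id A] with z h1 h2 h3 h4
    rw [h1, h2, h3, h4, perm_trans]; simp)
  inv_hom_id := hom_ext (by
    filter_upwards [fn_comp (cst (perm σ.symm) (perm_symm h)) (cst (perm σ) h), fn_cst (perm σ) h,
      fn_cst (perm σ.symm) (perm_symm h), fn_id B] with z h1 h2 h3 h4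
    rw [h1, h2, h3, h4, perm_trans]; simp)

/-- The tensor product of two systems: the Kronecker product of their matrices. -/
def tensor (A B : FlatSystem q) : FlatSystem q where
  rank := A.rank * B.rank
  mat :=
    { val := kron A.mat B.mat
      inv := kron (A.mat⁻¹ : GL _ ℂ) (B.mat⁻¹ : GL _ ℂ)
      val_inv := by rw [← kron_mul, Units.mul_inv, Units.mul_inv, kron_one]
      inv_val := by rw [← kron_mul, Units.inv_mul, Units.inv_mul, kron_one] }

theorem tensor_M (A B : FlatSystem q) : (tensor A B).M = kron A.M B.M := rfl

/-- The unit system `f(qz) = f(z)`. -/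
def unit : FlatSystem q := ⟨1, 1⟩

theorem unit_M : (unit : FlatSystem q).M = 1 := rfl

theorem IsMor.kron {A B A' B' : FlatSystem q} {f : ℂ → Matrix (Fin B.rank) (Fin A.rank) ℂ}
    {g : ℂ → Matrix (Fin B'.rank) (Fin A'.rank) ℂ} (hf : IsMor A B f) (hg : IsMor A' B' g) :
    IsMor (tensor A A') (tensor B B') (fun z => kron (f z) (g z)) := by
  constructor
  · intro i j
    exact (hf.1 _ _).mul (hg.1 _ _)
  · filter_upwards [hf.2, hg.2] with z h1 h2
    exact (kron_mul _ _ _ _).symm.trans ((congrArg₂ QDiff.kron h1 h2).trans (kron_mul _ _ _ _))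

/-- The tensor product of two morphisms: the Kronecker product of the matrices. -/
def tensorMap {A B A' B' : FlatSystem q} (F : A ⟶ B) (G : A' ⟶ B') : tensor A A' ⟶ tensor B B' :=
  ofFn (fun z => kron (fn F z) (fn G z)) ((fn_isMor F).kron (fn_isMor G))

theorem fn_tensorMap {A B A' B' : FlatSystem q} (F : A ⟶ B) (G : A' ⟶ B') :
    fn (tensorMap F G) =ᶠ[𝓝[≠] 0] fun z => kron (fn F z) (fn G z) := fn_ofFn _

/-- The associativity isomorphism. -/
def assoc (A B C : FlatSystem q) : tensor (tensor A B) C ≅ tensor A (tensor B C) :=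
  permIso (assocEquiv A.rank B.rank C.rank) (perm_assoc _ _ _)

/-- The left unit isomorphism. -/
def leftUnit (A : FlatSystem q) : tensor unit A ≅ A :=
  permIso (leftEquiv A.rank) (perm_left _)

/-- The right unit isomorphism. -/
def rightUnit (A : FlatSystem q) : tensor A unit ≅ A :=
  permIso (rightEquiv A.rank) (perm_right _)

/-- The commutativity isomorphism. -/
def braid (A B : FlatSystem q) : tensor A B ≅ tensor B A :=
  permIso (swapEquiv A.rank B.rank) (perm_swap _ _)

theorem fn_permIso {A B : FlatSystem q} (σ : Fin A.rank ≃ Fin B.rank)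
    (h : perm σ * A.M = B.M * perm σ) : fn (permIso σ h).hom =ᶠ[𝓝[≠] 0] fun _ => perm σ :=
  fn_cst _ h

instance : MonoidalCategoryStruct (FlatSystem q) where
  tensorObj := tensor
  whiskerLeft A _ _ F := tensorMap (𝟙 A) F
  whiskerRight F A := tensorMap F (𝟙 A)
  tensorHom := tensorMap
  tensorUnit := unit
  associator := assoc
  leftUnitor := leftUnit
  rightUnitor := rightUnit


theorem eq_of_fn {A B : FlatSystem q} {F G : A ⟶ B}
    {f g : ℂ → Matrix (Fin B.rank) (Fin A.rank) ℂ} (hF : fn F =ᶠ[𝓝[≠] 0] f)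
    (hG : fn G =ᶠ[𝓝[≠] 0] g) (h : ∀ z, f z = g z) : F = G :=
  hom_ext (hF.trans (by rw [funext h]; exact hG.symm))

theorem fn_comp' {A B C : FlatSystem q} {F : A ⟶ B} {G : B ⟶ C}
    {f : ℂ → Matrix (Fin B.rank) (Fin A.rank) ℂ} {g : ℂ → Matrix (Fin C.rank) (Fin B.rank) ℂ}
    (hF : fn F =ᶠ[𝓝[≠] 0] f) (hG : fn G =ᶠ[𝓝[≠] 0] g) :
    fn (F ≫ G) =ᶠ[𝓝[≠] 0] fun z => g z * f z := by
  filter_upwards [fn_comp F G, hF, hG] with z h1 h2 h3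
  rw [h1, h2, h3]

theorem fn_tensorMap' {A B A' B' : FlatSystem q} {F : A ⟶ B} {G : A' ⟶ B'}
    {f : ℂ → Matrix (Fin B.rank) (Fin A.rank) ℂ} {g : ℂ → Matrix (Fin B'.rank) (Fin A'.rank) ℂ}
    (hF : fn F =ᶠ[𝓝[≠] 0] f) (hG : fn G =ᶠ[𝓝[≠] 0] g) :
    fn (tensorMap F G) =ᶠ[𝓝[≠] 0] fun z => kron (f z) (g z) := by
  filter_upwards [fn_tensorMap F G, hF, hG] with z h1 h2 h3
  rw [h1, h2, h3]

theorem fn_rfl {A B : FlatSystem q} (F : A ⟶ B) : fn F =ᶠ[𝓝[≠] 0] fn F :=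
  Filter.EventuallyEq.rfl

instance : MonoidalCategory (FlatSystem q) := MonoidalCategory.ofTensorHom
  (id_tensorHom_id := fun A B =>
    eq_of_fn (fn_tensorMap' (fn_id A) (fn_id B)) (fn_id _) fun _ => kron_one _ _)
  (id_tensorHom := fun _ _ _ _ => rfl)
  (tensorHom_id := fun _ _ => rfl)
  (tensorHom_comp_tensorHom := fun F F' G G' =>
    eq_of_fn (fn_comp' (fn_tensorMap F F') (fn_tensorMap G G'))
      (fn_tensorMap' (fn_comp F G) (fn_comp F' G')) fun _ => (kron_mul _ _ _ _).symm)
  (associator_naturality := fun F G H =>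
    eq_of_fn (fn_comp' (fn_tensorMap' (fn_tensorMap F G) (fn_rfl H)) (fn_permIso _ _))
      (fn_comp' (fn_permIso _ _) (fn_tensorMap' (fn_rfl F) (fn_tensorMap G H)))
      fun _ => perm_assoc _ _ _)
  (leftUnitor_naturality := fun F =>
    eq_of_fn (fn_comp' (fn_tensorMap' (fn_id unit) (fn_rfl F)) (fn_permIso _ _))
      (fn_comp' (fn_permIso _ _) (fn_rfl F)) fun _ => perm_left _)
  (rightUnitor_naturality := fun F =>
    eq_of_fn (fn_comp' (fn_tensorMap' (fn_rfl F) (fn_id unit)) (fn_permIso _ _))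
      (fn_comp' (fn_permIso _ _) (fn_rfl F)) fun _ => perm_right _)
  (pentagon := fun A _ _ D =>
    eq_of_fn
      (fn_comp' (fn_tensorMap' (fn_permIso _ _) (fn_id D))
        (fn_comp' (fn_permIso _ _) (fn_tensorMap' (fn_id A) (fn_permIso _ _))))
      (fn_comp' (fn_permIso _ _) (fn_permIso _ _)) fun _ => perm_pentagon _ _ _ _)
  (triangle := fun A B =>
    eq_of_fn (fn_comp' (fn_permIso _ _) (fn_tensorMap' (fn_id A) (fn_permIso _ _)))
      (fn_tensorMap' (fn_permIso _ _) (fn_id B)) fun _ => perm_triangle _ _)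

instance : SymmetricCategory (FlatSystem q) where
  braiding := braid
  braiding_naturality_right A _ _ F :=
    eq_of_fn (fn_comp' (fn_tensorMap' (fn_id A) (fn_rfl F)) (fn_permIso _ _))
      (fn_comp' (fn_permIso _ _) (fn_tensorMap' (fn_rfl F) (fn_id A))) fun _ => perm_swap _ _
  braiding_naturality_left F A :=
    eq_of_fn (fn_comp' (fn_tensorMap' (fn_rfl F) (fn_id A)) (fn_permIso _ _))
      (fn_comp' (fn_permIso _ _) (fn_tensorMap' (fn_id A) (fn_rfl F))) fun _ => perm_swap _ _
  hexagon_forward _ B C :=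
    eq_of_fn (fn_comp' (fn_permIso _ _) (fn_comp' (fn_permIso _ _) (fn_permIso _ _)))
      (fn_comp' (fn_tensorMap' (fn_permIso _ _) (fn_id C))
        (fn_comp' (fn_permIso _ _) (fn_tensorMap' (fn_id B) (fn_permIso _ _))))
      fun _ => perm_hexagon _ _ _
  hexagon_reverse A B _ :=
    eq_of_fn (fn_comp' (fn_permIso _ (perm_symm (perm_assoc _ _ _)))
        (fn_comp' (fn_permIso _ _) (fn_permIso _ (perm_symm (perm_assoc _ _ _)))))
      (fn_comp' (fn_tensorMap' (fn_id A) (fn_permIso _ _))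
        (fn_comp' (fn_permIso _ (perm_symm (perm_assoc _ _ _)))
          (fn_tensorMap' (fn_permIso _ _) (fn_id B))))
      fun _ => perm_hexagon' _ _ _
  symmetry _ _ := eq_of_fn (fn_comp' (fn_permIso _ _) (fn_permIso _ _)) (fn_id _)
    fun _ => perm_symmetry _ _

end FlatSystem

/-! ### The functor -/

namespace FlatSystem

section Functor

variable {q : ℂˣ}

/-- The power `Aᵏ`. -/
abbrev pw (A : FlatSystem q) (k : ℤ) : Matrix (Fin A.rank) (Fin A.rank) ℂ :=
  ((A.mat ^ k : GL (Fin A.rank) ℂ) : Matrix (Fin A.rank) (Fin A.rank) ℂ)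

theorem pw_add (A : FlatSystem q) (k l : ℤ) : A.pw (k + l) = A.pw k * A.pw l := by
  rw [← Units.val_mul, ← zpow_add]

theorem pw_one (A : FlatSystem q) : A.pw 1 = A.M := by rw [pw, zpow_one]

theorem pw_zero (A : FlatSystem q) : A.pw 0 = 1 := by rw [pw, zpow_zero, Units.val_one]

variable {A B : FlatSystem q}

/-- The function `Bᵏ f(q⁻ᵏ z) A⁻ᵏ`. -/
def extK (f : ℂ → Matrix (Fin B.rank) (Fin A.rank) ℂ) (k : ℤ) (z : ℂˣ) :
    Matrix (Fin B.rank) (Fin A.rank) ℂ :=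
  B.pw k * f ((q ^ (-k) * z : ℂˣ) : ℂ) * A.pw (-k)

/-- `r` is so small that `f(qz) A = B f(z)` for `0 < |z| < r`, where `f` is holomorphic. -/
structure IsRadius (A B : FlatSystem q) (f : ℂ → Matrix (Fin B.rank) (Fin A.rank) ℂ) (r : ℝ) :
    Prop where
  pos : 0 < r
  eq : ∀ z : ℂˣ, ‖(z : ℂ)‖ < r → f (q * z) * A.M = B.M * f z
  analytic : ∀ z : ℂˣ, ‖(z : ℂ)‖ < r → ∀ i j, AnalyticAt ℂ (fun z => f z i j) z

theorem eventually_units {P : ℂ → Prop} (h : ∀ᶠ z in 𝓝[≠] (0 : ℂ), P z) :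
    ∃ r > 0, ∀ z : ℂˣ, ‖(z : ℂ)‖ < r → P z := by
  obtain ⟨r, hr, h⟩ := Metric.mem_nhdsWithin_iff.1 h
  exact ⟨r, hr, fun z hz => h ⟨by simpa using hz, z.ne_zero⟩⟩

theorem exists_isRadius {f : ℂ → Matrix (Fin B.rank) (Fin A.rank) ℂ} (hf : IsMor A B f) :
    ∃ r, IsRadius A B f r := by
  have h : ∀ᶠ z in 𝓝[≠] (0 : ℂ), f (q * z) * A.M = B.M * f z ∧
      ∀ i j, AnalyticAt ℂ (fun z => f z i j) z :=
    hf.2.and (Filter.eventually_all.2 fun i => Filter.eventually_all.2 fun j =>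
      (hf.1 i j).eventually_analyticAt)
  obtain ⟨r, hr, h⟩ := eventually_units h
  exact ⟨r, hr, fun z hz => (h z hz).1, fun z hz => (h z hz).2⟩

variable [hq : Fact (1 < ‖(q : ℂ)‖)]

theorem norm_shift_lt (z : ℂˣ) {r : ℝ} (hr : 0 < r) :
    ∀ᶠ k : ℤ in Filter.atTop, ‖((q ^ (-k) * z : ℂˣ) : ℂ)‖ < r := by
  obtain ⟨n, hn⟩ := pow_unbounded_of_one_lt (‖(z : ℂ)‖ / r) hq.out
  filter_upwards [Filter.eventually_ge_atTop (n : ℤ)] with k hk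
  have h1 : ‖(q : ℂ)‖ ^ n ≤ ‖(q : ℂ)‖ ^ k := by
    rw [← zpow_natCast]
    exact zpow_le_zpow_right₀ hq.out.le hk
  have h2 : 0 < ‖(q : ℂ)‖ ^ k := zpow_pos (by simp) _
  rw [Units.val_mul, Units.val_zpow_eq_zpow_val, norm_mul, norm_zpow, zpow_neg,
    inv_mul_lt_iff₀ h2]
  exact (div_lt_iff₀ hr).1 (hn.trans_le h1)

theorem norm_shift_mono {k l : ℤ} (hkl : k ≤ l) {z : ℂˣ} {r : ℝ}
    (hz : ‖((q ^ (-k) * z : ℂˣ) : ℂ)‖ < r) : ‖((q ^ (-l) * z : ℂˣ) : ℂ)‖ < r := by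
  refine lt_of_le_of_lt ?_ hz
  rw [Units.val_mul, Units.val_mul, norm_mul, norm_mul, Units.val_zpow_eq_zpow_val,
    Units.val_zpow_eq_zpow_val, norm_zpow, norm_zpow]
  exact mul_le_mul_of_nonneg_right (zpow_le_zpow_right₀ hq.out.le (neg_le_neg hkl)) (norm_nonneg _)

theorem extK_succ {f : ℂ → Matrix (Fin B.rank) (Fin A.rank) ℂ} {r : ℝ} (hr : IsRadius A B f r)
    {k : ℤ} {z : ℂˣ} (hz : ‖((q ^ (-k) * z : ℂˣ) : ℂ)‖ < r) : extK f (k + 1) z = extK f k z := by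
  have h := hr.eq _ (norm_shift_mono (Int.le_add_one le_rfl) hz)
  have e : (q : ℂ) * ((q ^ (-(k + 1)) * z : ℂˣ) : ℂ) = ((q ^ (-k) * z : ℂˣ) : ℂ) := by
    rw [← Units.val_mul, ← mul_assoc, ← zpow_one_add]
    congr 3
    ring
  rw [e] at h
  have hA : A.pw (-k) = A.M * A.pw (-(k + 1)) := by
    rw [← pw_one, ← pw_add]
    congr 1
    ring
  rw [extK, extK, hA, pw_add, pw_one, Matrix.mul_assoc _ B.M, ← h]
  simp only [Matrix.mul_assoc]

theorem extK_eq {f : ℂ → Matrix (Fin B.rank) (Fin A.rank) ℂ} {r : ℝ} (hr : IsRadius A B f r)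
    {k l : ℤ} (hkl : k ≤ l) {z : ℂˣ} (hz : ‖((q ^ (-k) * z : ℂˣ) : ℂ)‖ < r) :
    extK f l z = extK f k z := by
  induction l, hkl using Int.leInduction with
  | base => rfl
  | succ l hl ih => rw [extK_succ hr (norm_shift_mono hl hz), ih]

theorem exists_ext (F : A ⟶ B) (z : ℂˣ) :
    ∃ M, ∀ᶠ k : ℤ in Filter.atTop, extK (fn F) k z = M := by
  obtain ⟨r, hr⟩ := exists_isRadius (fn_isMor F)
  obtain ⟨k, hk⟩ := (norm_shift_lt (q := q) z hr.pos).exists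
  exact ⟨_, (Filter.eventually_ge_atTop k).mono fun l hl => extK_eq hr hl hk⟩

/-- The value at `z ∈ ℂˣ` of a germ `F` such that `F(qz) A = B F(z)`, extended to `ℂˣ` by means of
this functional equation: it is `Bᵏ F(q⁻ᵏ z) A⁻ᵏ` for all large `k`. -/
def ext (F : A ⟶ B) (z : ℂˣ) : Matrix (Fin B.rank) (Fin A.rank) ℂ := (exists_ext F z).choose

theorem ext_spec (F : A ⟶ B) (z : ℂˣ) :
    ∀ᶠ k : ℤ in Filter.atTop, extK (fn F) k z = ext F z := (exists_ext F z).choose_spec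

/-- The extension does not depend on the function representing the germ. -/
theorem ext_eq {F : A ⟶ B} {f : ℂ → Matrix (Fin B.rank) (Fin A.rank) ℂ}
    (h : fn F =ᶠ[𝓝[≠] 0] f) (z : ℂˣ) {M : Matrix (Fin B.rank) (Fin A.rank) ℂ}
    (hM : ∃ᶠ k : ℤ in Filter.atTop, extK f k z = M) : ext F z = M := by
  obtain ⟨r, hr, h⟩ := eventually_units h
  obtain ⟨k, h2, h1, h3⟩ :=
    (hM.and_eventually ((ext_spec F z).and (norm_shift_lt (q := q) z hr))).exists
  rw [← h1, ← h2, extK, extK, h _ h3]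

/-- The extension coincides with `F` near `0`. -/
theorem ext_eventually (F : A ⟶ B) : ∃ r > 0, ∀ z : ℂˣ, ‖(z : ℂ)‖ < r → ext F z = fn F z := by
  obtain ⟨r, hr⟩ := exists_isRadius (fn_isMor F)
  refine ⟨r, hr.pos, fun z hz => ?_⟩
  obtain ⟨k, hk, hk0⟩ := ((ext_spec F z).and (Filter.eventually_ge_atTop 0)).exists
  rw [← hk, extK_eq hr hk0 (by simpa using hz), extK, neg_zero, zpow_zero, one_mul, pw_zero,
    pw_zero, Matrix.one_mul, Matrix.mul_one]

theorem ext_zpow (F : A ⟶ B) (k : ℤ) (z : ℂˣ) :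
    ext F (q ^ k * z) * A.pw k = B.pw k * ext F z := by
  have h1 := (Filter.tendsto_atTop_add_const_right _ k Filter.tendsto_id).eventually
    (ext_spec F (q ^ k * z))
  obtain ⟨l, h1, h2⟩ := (h1.and (ext_spec F z)).exists
  rw [← h1, ← h2, extK, extK, id]
  have e : q ^ (-(l + k)) * (q ^ k * z) = q ^ (-l) * z := by
    rw [← mul_assoc, ← zpow_add, neg_add, neg_add_cancel_right]
  rw [e, Matrix.mul_assoc _ (A.pw _), ← pw_add, add_comm l, pw_add, neg_add, neg_add_cancel_comm]
  simp only [Matrix.mul_assoc]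

theorem ext_holo (F : A ⟶ B) (w : ℂˣ) (i j) : ∃ g : ℂ → ℂ, AnalyticAt ℂ g w ∧
    ∀ᶠ z : ℂˣ in 𝓝 w, ext F z i j = g z := by
  obtain ⟨r, hr⟩ := exists_isRadius (fn_isMor F)
  obtain ⟨k, hk⟩ := (norm_shift_lt (q := q) w hr.pos).exists
  refine ⟨fun z => (B.pw k * fn F ((q ^ (-k) : ℂˣ) * z) * A.pw (-k)) i j, ?_, ?_⟩
  · simp only [Matrix.mul_apply]
    refine Finset.analyticAt_fun_sum _ fun l _ => AnalyticAt.mul ?_ analyticAt_const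
    refine Finset.analyticAt_fun_sum _ fun m _ => analyticAt_const.mul ?_
    have h1 := hr.analytic _ hk m l
    rw [Units.val_mul] at h1
    exact AnalyticAt.fun_comp h1 (analyticAt_const.mul analyticAt_id)
  · have hc : Continuous fun z : ℂˣ => ‖((q ^ (-k) * z : ℂˣ) : ℂ)‖ :=
      (Units.continuous_val.comp (continuous_const.mul continuous_id)).norm
    filter_upwards [hc.continuousAt.eventually_lt continuousAt_const hk] with z hz
    obtain ⟨l, hl, hkl⟩ := ((ext_spec F z).and (Filter.eventually_ge_atTop k)).exists
    rw [← hl, extK_eq hr hkl hz, extK, Units.val_mul]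

theorem ext_id (A : FlatSystem q) (z : ℂˣ) : ext (𝟙 A) z = 1 := by
  refine ext_eq (fn_id A) z (Filter.Eventually.frequently (Filter.Eventually.of_forall fun k => ?_))
  rw [extK, Matrix.mul_one, ← pw_add, add_neg_cancel, pw_zero]

theorem ext_comp {C : FlatSystem q} (F : A ⟶ B) (G : B ⟶ C) (z : ℂˣ) :
    ext (F ≫ G) z = ext G z * ext F z := by
  refine ext_eq (fn_comp F G) z (Filter.Eventually.frequently ?_)
  filter_upwards [ext_spec F z, ext_spec G z] with k h1 h2
  have h3 : B.pw (-k) * B.pw k = 1 := by rw [← pw_add, neg_add_cancel, pw_zero]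
  rw [← h1, ← h2, extK, extK, extK, Matrix.mul_assoc _ (B.pw (-k)), ← Matrix.mul_assoc (B.pw (-k)),
    ← Matrix.mul_assoc (B.pw (-k)), h3, Matrix.one_mul]
  simp only [Matrix.mul_assoc]

/-- The linear map between the fibres induced by a morphism of systems. -/
def fibMap (F : A ⟶ B) (x : EllCurve q) : Fib q A.mat x →ₗ[ℂ] Fib q B.mat x :=
  (clsEquiv B.mat (Quotient.out x) (QuotientGroup.out_eq' x)).toLinearMap ∘ₗ
    Matrix.mulVecLin (ext F (Quotient.out x)) ∘ₗ
      (clsEquiv A.mat (Quotient.out x) (QuotientGroup.out_eq' x)).symm.toLinearMap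

/-- The linear map between the fibres maps `[z, X]` to `[z, F(z) X]`. -/
theorem fibMap_cls (F : A ⟶ B) (z : ℂˣ) {x : EllCurve q} (h : proj q z = x)
    (X : Fin A.rank → ℂ) :
    fibMap F x (cls A.mat z h X) = cls B.mat z h ((ext F z).mulVec X) := by
  obtain ⟨k, hk⟩ := proj_eq_iff.1 (h.trans (QuotientGroup.out_eq' x).symm)
  have e := ext_zpow F k z
  rw [← hk] at e
  rw [fibMap, LinearMap.comp_apply, LinearMap.comp_apply, LinearEquiv.coe_coe, LinearEquiv.coe_coe,
    clsEquiv_symm_shift A.mat h k hk, Matrix.mulVecLin_apply, Matrix.mulVec_mulVec, e,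
    ← Matrix.mulVec_mulVec, clsEquiv_apply]
  exact cls_shift B.mat h k hk _ _

theorem fibMap_holo (F : A ⟶ B) :
    (bundleOf (q := q) A.mat).IsHol (bundleOf B.mat) (fibMap F) := by
  refine (HolBundle.isHol_iff (flatFrames A.mat).compat (flatFrames B.mat).compat _).2
    fun (s t : ℝ) v x hx => ContMDiffAt.contMDiffWithinAt ?_
  have h1 : ∀ᶠ y in 𝓝 x, (flatFrames B.mat).toCoord t y
      (fibMap F y ((flatFrames A.mat).ofCoord s y v)) =
        (B.pw (round (t - s))).mulVec ((ext F (lift q s y)).mulVec v) := by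
    filter_upwards [(isOpen_image_annulus q s).mem_nhds hx.1,
      (isOpen_image_annulus q t).mem_nhds hx.2] with y h1 h2
    refine (congrArg _ (fibMap_cls F (lift q s y) (proj_lift q s y) v)).trans ?_
    exact clsEquiv_symm_shift B.mat (proj_lift q s y) _ (lift_shift q h1 h2) (proj_lift q t y) _
  refine ContMDiffAt.congr_of_eventuallyEq ?_ h1
  have h2 : ∀ i j, ContMDiffAt 𝓘(ℂ) 𝓘(ℂ) ω (fun y => ext F (lift q s y) i j) x := by
    intro i j
    obtain ⟨g, hg, hg2⟩ := ext_holo F (lift q s x) i j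
    have h3 : ContMDiffAt 𝓘(ℂ) 𝓘(ℂ) ω (fun y => g (lift q s y)) x :=
      (hg.contDiffAt (n := ω)).contMDiffAt.comp x (lift_val_holo q hx.1)
    exact h3.congr_of_eventuallyEq ((lift_continuousAt q hx.1).eventually hg2)
  refine contMDiffAt_pi_space.2 fun i => ?_
  simp only [Matrix.mulVec, dotProduct]
  refine contMDiffAt_finsetSum fun j _ => contMDiffAt_const.mul ?_
  exact contMDiffAt_finsetSum fun k _ => (h2 j k).mul contMDiffAt_const

theorem cls_surjective {n : ℕ} (A : GL (Fin n) ℂ) {x : EllCurve q} (v : Fib q A x) :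
    ∃ z, ∃ h : proj q z = x, ∃ X, v = cls A z h X :=
  ⟨_, QuotientGroup.out_eq' x, _, ((cls_bijective A _ _).2 v).choose_spec.symm⟩

end Functor

end FlatSystem

open FlatSystem in
/-- The functor which maps a constant `q`-difference system with matrix `A` to the flat bundle
`(ℂˣ × ℂⁿ)/~`, and a morphism `F` to `[z, X] ↦ [z, F(z) X]`. -/
def flatFunctor (q : ℂˣ) [Fact (1 < ‖(q : ℂ)‖)] : FlatSystem q ⥤ FlatBundle (EllCurve q) where
  obj A := ⟨bundleOf A.mat, isFlat_bundleOf A.mat⟩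
  map F := ObjectProperty.homMk (HolBundle.mkHom (fibMap F) (fibMap_holo F))
  map_id A := by
    refine ObjectProperty.hom_ext _ (HolBundle.hom_ext fun x => LinearMap.ext fun v => ?_)
    obtain ⟨z, h, X, rfl⟩ := cls_surjective A.mat v
    refine (fibMap_cls (𝟙 A) z h X).trans ?_
    rw [ext_id, Matrix.one_mulVec]
    rfl
  map_comp {A B C} F G := by
    refine ObjectProperty.hom_ext _ (HolBundle.hom_ext fun x => LinearMap.ext fun v => ?_)
    obtain ⟨z, h, X, rfl⟩ := cls_surjective A.mat v
    refine (fibMap_cls (F ≫ G) z h X).trans ?_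
    rw [ext_comp, ← Matrix.mulVec_mulVec, ← fibMap_cls G, ← fibMap_cls F]
    rfl

/-- The point `[z, X]` of the bundle attached to `A`, in the fibre at the image of `z`. -/
def point {q : ℂˣ} [Fact (1 < ‖(q : ℂ)‖)] (A : FlatSystem q) (z : ℂˣ) (X : Fin A.rank → ℂ) :
    ((flatFunctor q).obj A).obj.fiber (proj q z) :=
  cls A.mat z rfl X

end QDiff

end

noncomputable section

/-! ### Logarithms in finite-dimensional algebras -/

/-! Everything rests on reading a morphism of bundles in the bases `X ↦ [z, X]`, which identify `ℂⁿ`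
with the fibre over the image of `z`. The germ `F` is extended to `ℂˣ` by `F(z) = Bᵏ F(q⁻ᵏ z) A⁻ᵏ`
for large `k`, and the map induced by `F` has matrix `F(z)` in these bases.

Faithful: the matrices `F(z)` are determined by the map between the bundles, and near `0` they give
back the germ (`eq_of_ext`).

Full: a morphism `φ : F_A → F_B` has a matrix `G(z)` which is holomorphic on `ℂˣ`. Since `[qz, AX] =
[z, X]`, it satisfies `G(qz) A = B G(z)` (`bundleMatrix_zpow`). The closed annulus `1 ≤ |z| ≤ |q|`
is compact and its translates by powers of `q` cover `ℂˣ`, so iterating `G(z) = B⁻¹ G(qz) A` bounds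
`G` near `0` by a power of `|z|⁻¹` (`exists_norm_le_of_zpow`). Hence the singularity at `0` is at
most a pole (`meromorphicAt_of_norm_le`), and the germ of `G` is a morphism of systems that induces
`φ`.

Essentially surjective: pull a flat bundle back to `ℂ` along `w ↦ exp w mod q^ℤ`. As `ℂ` is simply
connected, parallel transport gives a flat frame `T(w)` there (`FrameAtlas.exists_isFlatFamily`).
The translations by `2πi` and by a logarithm of `q` multiply `T` on the right by constant invertible
matrices `M₁` and `M₂`, the monodromy, and these commute because the translations do. To descend to
`ℂˣ` the first one must be removed. Choose `N` with `exp(-2πi N) = M₁` which commutes with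
everything commuting with `M₁`. Then `S(w) = T(w) exp(wN)` is holomorphic, has period `2πi`, and is
multiplied by the constant matrix `M₂ exp(N log q)` under the other translation. With `A` the
inverse of that matrix, `[exp w, X] ↦ S(w) X` is an isomorphism from `F_A` to the given bundle
(`FrameAtlas.IsConst.exists_equivariantFrame`, `EquivariantFrame.fibEquiv`). The frame `S` is no
longer flat, so the isomorphism is holomorphic but need not respect the flat structures; morphisms
of the target category are not required to do so.

The matrix `N` comes from `NormedSpace.exists_exp_eq`: in a finite-dimensional commutative algebra
the image of `exp` is a subgroup containing a neighbourhood of `1`, and any invertible element is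
joined to `1` inside the invertible elements of a complex line.

Tensor structure: in the bases `X ↦ [z, X]` every constraint becomes an identity between
permutations of coordinates and Kronecker products of vectors. -/

theorem spectrum_finite_of_finiteDimensional {R : Type*} [Ring R] [Algebra ℂ R]
    [FiniteDimensional ℂ R] (a : R) : (spectrum ℂ a).Finite := by
  rcases subsingleton_or_nontrivial R with h | h
  · rw [spectrum.of_subsingleton]
    exact Set.finite_empty
  have hp : minpoly ℂ a ≠ 0 := minpoly.ne_zero (Algebra.IsIntegral.isIntegral a)
  refine (Polynomial.rootSet_finite (minpoly ℂ a) ℂ).subset fun l hl => ?_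
  have h1 := spectrum.subset_polynomial_aeval a (minpoly ℂ a) ⟨l, hl, rfl⟩
  rw [minpoly.aeval, spectrum.zero_eq, Set.mem_singleton_iff] at h1
  rw [Polynomial.mem_rootSet]
  exact ⟨hp, by simpa using h1⟩

/-- Only finitely many points `t`, among the `-λ⁻¹` with `λ` in the spectrum of `b`, are removed
from the plane. A plane minus a countable set is connected. -/
theorem isConnected_setOf_isUnit_line {R : Type*} [Ring R] [Algebra ℂ R] [FiniteDimensional ℂ R]
    (b : R) : IsConnected {t : ℂ | IsUnit (1 + t • b)} := by
  have hfin : {t : ℂ | IsUnit (1 + t • b)}ᶜ.Finite := by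
    refine ((spectrum_finite_of_finiteDimensional b).image fun l => -l⁻¹).subset fun t ht => ?_
    have ht' : ¬ IsUnit (1 + t • b) := ht
    have h0 : t ≠ 0 := by
      rintro rfl
      simp at ht'
    refine ⟨-t⁻¹, fun hu => ht' ?_, by simp⟩
    have hu' : IsUnit (algebraMap ℂ R (-t⁻¹) - b) := hu
    -- Factoring out `-t` turns `1 + t b` into a nonzero multiple of the resolvent expression at
    -- `-t⁻¹`; the point `t = 0` causes no trouble, since it gives the unit `1`.
    have e : 1 + t • b = algebraMap ℂ R (-t) * (algebraMap ℂ R (-t⁻¹) - b) := by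
      rw [mul_sub, ← map_mul, neg_mul_neg, mul_inv_cancel₀ h0, map_one, map_neg, neg_mul,
        sub_neg_eq_add, Algebra.smul_def]
    rw [e]
    exact ((isUnit_iff_ne_zero.2 (neg_ne_zero.2 h0)).map (algebraMap ℂ R)).mul hu'
  have := hfin.countable.isConnected_compl_of_one_lt_rank (E := ℂ) (by simp)
  rwa [compl_compl] at this

/-- By commutativity the image of `exp` is a subgroup of the units, and it contains a neighbourhood
of `1` by the inverse function theorem. Membership in it is therefore locally constant along the
connected set of invertible elements of the line through `1` and `a`. -/
theorem NormedSpace.range_exp_eq_setOf_isUnit {R : Type*} [NormedCommRing R] [NormedAlgebra ℂ R]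
    [FiniteDimensional ℂ R] : Set.range (NormedSpace.exp : R → R) = {a | IsUnit a} := by
  have : CompleteSpace R := FiniteDimensional.complete ℂ R
  let : NormedAlgebra ℚ R := NormedAlgebra.restrictScalars ℚ ℂ R
  refine Set.Subset.antisymm (by rintro _ ⟨x, rfl⟩; exact NormedSpace.isUnit_exp x) fun a ha => ?_
  have hn : Set.range (NormedSpace.exp : R → R) ∈ 𝓝 (1 : R) := by
    have h := (hasStrictFDerivAt_exp_zero (𝕂 := ℂ) (𝔸 := R)).map_nhds_eq_of_equiv
      (f' := ContinuousLinearEquiv.refl ℂ R)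
    rw [NormedSpace.exp_zero] at h
    rw [← h]
    exact Filter.mem_map.2 (Filter.univ_mem' fun x => ⟨x, rfl⟩)
  have hconn := isConnected_setOf_isUnit_line (a - 1)
  set D := {t : ℂ | IsUnit (1 + t • (a - 1))}
  have : PreconnectedSpace D := isPreconnected_iff_preconnectedSpace.1 hconn.isPreconnected
  let g : D → R := fun t => 1 + (t : ℂ) • (a - 1)
  have hg : Continuous g := by fun_prop
  have hloc : IsLocallyConstant fun t : D => g t ∈ Set.range (NormedSpace.exp : R → R) := by
    refine (IsLocallyConstant.iff_eventually_eq _).2 fun t₀ => ?_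
    obtain ⟨u, hu⟩ : IsUnit (g t₀) := t₀.2
    -- The quotient `g t / g t₀` tends to `1`, so it is an exponential for `t` near `t₀`;
    -- multiplying by an exponential does not change membership in the subgroup.
    have hc : Filter.Tendsto (fun t => g t * (u⁻¹ : Rˣ)) (𝓝 t₀) (𝓝 1) := by
      have := (hg.mul (continuous_const (y := ((u⁻¹ : Rˣ) : R)))).tendsto t₀
      rwa [Pi.mul_apply, ← hu, Units.mul_inv] at this
    filter_upwards [hc hn] with t ⟨x, hx⟩
    have e : g t = NormedSpace.exp x * g t₀ := by rw [hx, ← hu, Units.inv_mul_cancel_right]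
    refine propext ⟨?_, ?_⟩
    · rintro ⟨y, hy⟩
      refine ⟨-x + y, ?_⟩
      rw [NormedSpace.exp_add, hy, e, ← mul_assoc, ← NormedSpace.exp_add, neg_add_cancel,
        NormedSpace.exp_zero, one_mul]
    · rintro ⟨y, hy⟩
      exact ⟨x + y, by rw [NormedSpace.exp_add, hy, e]⟩
  have h0 : (0 : ℂ) ∈ D := by simp [D]
  have h1 : (1 : ℂ) ∈ D := by simpa [D] using ha
  have key := hloc.apply_eq_of_preconnectedSpace ⟨0, h0⟩ ⟨1, h1⟩
  have h2 : g ⟨1, h1⟩ ∈ Set.range (NormedSpace.exp : R → R) := by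
    rw [← key]
    exact ⟨0, by simp [g]⟩
  simpa [g] using h2

/-- An invertible element `a` of a finite-dimensional algebra has a logarithm which is a polynomial
in `a`. -/
theorem NormedSpace.exists_exp_eq {R : Type*} [NormedRing R] [NormedAlgebra ℂ R]
    [FiniteDimensional ℂ R] {a : R} (ha : IsUnit a) :
    ∃ x : R, NormedSpace.exp x = a ∧ ∀ b, Commute a b → Commute x b := by
  have : CompleteSpace R := FiniteDimensional.complete ℂ R
  let : NormedAlgebra ℚ R := NormedAlgebra.restrictScalars ℚ ℂ R
  -- The commutative case is applied in the subalgebra generated by `a`, which also makes the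
  -- logarithm commute with everything that commutes with `a`.
  let S := Algebra.adjoin ℂ {a}
  let : NormedCommRing S :=
    { (inferInstance : NormedRing S) with
      mul_comm := fun x y => (Algebra.isMulCommutative_adjoin ℂ (s := {a}) (by
        rintro x rfl y rfl; rfl)).is_comm.comm x y }
  let a' : S := ⟨a, Algebra.self_mem_adjoin_singleton ℂ a⟩
  have ha' : IsUnit a' := by
    -- The inverse of `a` must be found inside `S`: multiplication by `a` is injective on the
    -- finite-dimensional space `S`, hence surjective.
    have hinj : Function.Injective (LinearMap.mulLeft ℂ a') := by
      intro x y hxy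
      exact Subtype.ext (ha.mul_left_cancel (congrArg Subtype.val hxy))
    obtain ⟨y, hy⟩ := LinearMap.surjective_of_injective hinj 1
    exact IsUnit.of_mul_eq_one y hy
  obtain ⟨x, hx⟩ : a' ∈ Set.range (NormedSpace.exp : S → S) := by
    rw [NormedSpace.range_exp_eq_setOf_isUnit]
    exact ha'
  have : CompleteSpace S := FiniteDimensional.complete ℂ S
  let : NormedAlgebra ℚ S := NormedAlgebra.restrictScalars ℚ ℂ S
  refine ⟨x, ?_, fun b hb => ?_⟩
  · have := NormedSpace.map_exp S.val continuous_subtype_val x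
    rw [hx] at this
    exact this.symm
  · have h1 : S ≤ Subalgebra.centralizer ℂ {b} := by
      refine Algebra.adjoin_le ?_
      rintro _ rfl
      rw [SetLike.mem_coe, Subalgebra.mem_centralizer_iff]
      rintro _ rfl
      exact hb.symm.eq
    exact ((Subalgebra.mem_centralizer_iff ℂ).1 (h1 x.2) b rfl).symm

end

/-! ### / Extended germs: linearity, tensor products, and faithfulness -/

namespace QDiff

namespace FlatSystem

variable {q : ℂˣ} [hq : Fact (1 < ‖(q : ℂ)‖)] {A B : FlatSystem q}

/-- The extension is the value of `Bᵏ F(q⁻ᵏ z) A⁻ᵏ` for all large `k`, so identities between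
extensions can be checked at a single large `k`, where they are identities of matrices. -/
theorem ext_add (F G : A ⟶ B) (z : ℂˣ) : ext (F + G) z = ext F z + ext G z := by
  refine ext_eq (fn_add F G) z (Filter.Eventually.frequently ?_)
  filter_upwards [ext_spec F z, ext_spec G z] with k h1 h2
  rw [← h1, ← h2, extK, extK, extK, Pi.add_apply, Matrix.mul_add, Matrix.add_mul]

theorem ext_smul (c : ℂ) (F : A ⟶ B) (z : ℂˣ) : ext (c • F) z = c • ext F z := by
  refine ext_eq (fn_smul c F) z (Filter.Eventually.frequently ?_)
  filter_upwards [ext_spec F z] with k h1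
  rw [← h1, extK, extK, Pi.smul_apply, Matrix.mul_smul, Matrix.smul_mul]

/-- A constant matrix intertwining `A` and `B` intertwines all their integral powers, so `Bᵏ P A⁻ᵏ =
P` for every `k`. -/
theorem ext_cst (P : Matrix (Fin B.rank) (Fin A.rank) ℂ) (hP : P * A.M = B.M * P) (z : ℂˣ) :
    ext (cst P hP) z = P := by
  have h1 : P * A.pw 1 = B.pw 1 * P := by rw [pw_one, pw_one, hP]
  -- Insert `B⁻¹ B` on the left and move `B` through `P`, where it becomes `A` and cancels `A⁻¹`.
  have h2 : P * A.pw (-1) = B.pw (-1) * P := by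
    calc P * A.pw (-1) = B.pw (-1 + 1) * P * A.pw (-1) := by
          rw [neg_add_cancel, pw_zero, Matrix.one_mul]
      _ = B.pw (-1) * P * A.pw (1 + -1) := by
          rw [pw_add, pw_add, Matrix.mul_assoc (B.pw (-1)), ← h1]
          simp only [Matrix.mul_assoc]
      _ = B.pw (-1) * P := by rw [add_neg_cancel, pw_zero, Matrix.mul_one]
  have hz (k : ℤ) : P * A.pw k = B.pw k * P := by
    induction k with
    | zero => rw [pw_zero, pw_zero, Matrix.mul_one, Matrix.one_mul]
    | succ k ih =>
      rw [pw_add, pw_add, ← Matrix.mul_assoc, ih, Matrix.mul_assoc, h1, Matrix.mul_assoc]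
    | pred k ih =>
      rw [sub_eq_add_neg, pw_add, pw_add, ← Matrix.mul_assoc, ih, Matrix.mul_assoc, h2,
        Matrix.mul_assoc]
  refine ext_eq (fn_cst P hP) z (Filter.Eventually.frequently (Filter.Eventually.of_forall fun k => ?_))
  rw [extK, ← hz, Matrix.mul_assoc, ← pw_add, add_neg_cancel, pw_zero, Matrix.mul_one]

theorem ext_permIso (σ : Fin A.rank ≃ Fin B.rank) (h : perm σ * A.M = B.M * perm σ) (z : ℂˣ) :
    ext (permIso σ h).hom z = perm σ :=
  ext_cst _ h z

/-- The Kronecker product is a group homomorphism on pairs of invertible matrices, so it respects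
negative powers as well. -/
theorem kron_pw {q : ℂˣ} (A A' : FlatSystem q) (k : ℤ) :
    (tensor A A').pw k = kron (A.pw k) (A'.pw k) := by
  let f : GL (Fin A.rank) ℂ × GL (Fin A'.rank) ℂ →* GL (Fin (A.rank * A'.rank)) ℂ :=
    { toFun := fun p => (tensor (q := q) ⟨_, p.1⟩ ⟨_, p.2⟩).mat
      map_one' := Units.ext (kron_one _ _)
      map_mul' := fun _ _ => Units.ext (kron_mul _ _ _ _) }
  exact congrArg Units.val (map_zpow f (A.mat, A'.mat) k).symm

theorem ext_tensorMap {A' B' : FlatSystem q} (F : A ⟶ B) (G : A' ⟶ B') (z : ℂˣ) :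
    ext (tensorMap F G) z = kron (ext F z) (ext G z) := by
  refine ext_eq (fn_tensorMap F G) z (Filter.Eventually.frequently ?_)
  filter_upwards [ext_spec F z, ext_spec G z] with k h1 h2
  rw [← h1, ← h2, extK, extK, kron_mul, kron_mul, ← kron_pw, ← kron_pw]
  rfl

/-- Near `0` the extension agrees with any function representing the germ, so it determines the
germ. -/
theorem eq_of_ext {F G : A ⟶ B} (h : ∀ z, ext F z = ext G z) : F = G := by
  obtain ⟨r, hr, h1⟩ := ext_eventually F
  obtain ⟨s, hs, h2⟩ := ext_eventually G
  refine hom_ext (Metric.mem_nhdsWithin_iff.2 ⟨min r s, lt_min hr hs, ?_⟩)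
  rintro z ⟨hz, hz0⟩
  have hz' : ‖z‖ < min r s := by simpa using hz
  have e1 := h1 (Units.mk0 z hz0) (hz'.trans_le (min_le_left _ _))
  have e2 := h2 (Units.mk0 z hz0) (hz'.trans_le (min_le_right _ _))
  exact e1.symm.trans ((h _).trans e2)

end FlatSystem

open FlatSystem

variable {q : ℂˣ} [hq : Fact (1 < ‖(q : ℂ)‖)]

theorem app_map_cls {A B : FlatSystem q} (F : A ⟶ B) (z : ℂˣ) {x : EllCurve q} (h : proj q z = x)
    (X : Fin A.rank → ℂ) :
    HolBundle.app ((flatFunctor q).map F).hom x (cls A.mat z h X) =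
      cls B.mat z h ((ext F z).mulVec X) :=
  fibMap_cls F z h X

theorem cls_add {n : ℕ} (A : GL (Fin n) ℂ) (z : ℂˣ) {x : EllCurve q} (h : proj q z = x)
    (X Y : Fin n → ℂ) : cls A z h (X + Y) = cls A z h X + cls A z h Y :=
  map_add (clsEquiv A z h) X Y

theorem cls_smul {n : ℕ} (A : GL (Fin n) ℂ) (z : ℂˣ) {x : EllCurve q} (h : proj q z = x)
    (c : ℂ) (X : Fin n → ℂ) : cls A z h (c • X) = c • cls A z h X :=
  map_smul (clsEquiv A z h) c X

/-- Morphisms out of `bundleOf A` can be compared on the classes `[z, X]`. -/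
theorem flatBundle_hom_ext {A : FlatSystem q} {E : FlatBundle (EllCurve q)}
    {f g : (flatFunctor q).obj A ⟶ E}
    (h : ∀ z X, HolBundle.app f.hom (proj q z) (cls A.mat z rfl X) =
      HolBundle.app g.hom (proj q z) (cls A.mat z rfl X)) : f = g := by
  refine ObjectProperty.hom_ext _ (HolBundle.hom_ext fun x => LinearMap.ext fun v => ?_)
  obtain ⟨z, rfl, X, rfl⟩ := cls_surjective A.mat v
  exact h z X

instance : (flatFunctor q).Additive where
  map_add {A B F G} := flatBundle_hom_ext fun z X => by
    rw [app_map_cls, ext_add, Matrix.add_mulVec, cls_add, ← app_map_cls, ← app_map_cls]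
    rfl

instance : (flatFunctor q).Linear ℂ where
  map_smul {A B} F c := flatBundle_hom_ext fun z X => by
    rw [app_map_cls, ext_smul, Matrix.smul_mulVec, cls_smul, ← app_map_cls]
    rfl

/-- Since `X ↦ [z, X]` is injective, the induced map determines `F(z) X` for each basis vector `X`,
that is, every column of `F(z)`. -/
instance : (flatFunctor q).Faithful where
  map_injective {A B F G} h := eq_of_ext fun z => Matrix.ext_of_mulVec_single fun i => by
    apply (cls_bijective (q := q) B.mat z rfl).1
    rw [← app_map_cls, ← app_map_cls, h]

end QDiff

/-! ### Fullness: the matrix of a morphism of bundles is meromorphic at `0` -/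

namespace QDiff

open FlatSystem

/-- The unit of `ℂ` given by a nonzero number (and `1` at `0`). -/
noncomputable def toUnit (z : ℂ) : ℂˣ := if h : z = 0 then 1 else Units.mk0 z h

theorem toUnit_coe (z : ℂˣ) : toUnit (z : ℂ) = z := by
  rw [toUnit, dif_neg z.ne_zero]
  exact Units.ext rfl

theorem coe_toUnit {z : ℂ} (h : z ≠ 0) : (toUnit z : ℂ) = z := by
  rw [toUnit, dif_neg h]
  rfl

/-- The inclusion of `ℂˣ` in `ℂ` is open, so neighbourhoods of `w` in `ℂ` are seen already on units,
where `toUnit` is the identity; the artificial value at `0` plays no role. -/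
theorem continuousAt_toUnit (w : ℂˣ) : ContinuousAt toUnit (w : ℂ) := by
  have h := (Units.isOpenEmbedding_val (R := ℂ)).isOpenMap.nhds_le w
  refine Filter.Tendsto.mono_left (x := Filter.map ((↑) : ℂˣ → ℂ) (𝓝 w)) ?_ h
  rw [toUnit_coe, Filter.tendsto_map'_iff]
  exact Filter.tendsto_id.congr fun z => (toUnit_coe z).symm

section

variable {q : ℂˣ} [hq : Fact (1 < ‖(q : ℂ)‖)]

/-- A chart of the curve is a local section `l` of the projection. Both `z` and `l` of its class are
continuous lifts of the same point, so they differ near `w` by a constant power of `q`: in the chart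
the projection is `z ↦ qᵏ z`. -/
theorem proj_toUnit_holo (w : ℂˣ) :
    ContMDiffAt 𝓘(ℂ) 𝓘(ℂ) ω (fun z : ℂ => proj q (toUnit z)) w := by
  have hc : ContinuousAt (fun z : ℂ => proj q (toUnit z)) w :=
    ContinuousAt.comp (g := proj q) (QuotientGroup.continuous_mk.continuousAt)
      (continuousAt_toUnit w)
  rw [contMDiffAt_iff_target]
  refine ⟨hc, ?_⟩
  set x₀ := proj q (toUnit w) with hx₀
  obtain ⟨l, hl, hl1, hl2⟩ := atlas_spec q (chart_mem_atlas ℂ x₀)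
  have hx := mem_chart_source ℂ x₀
  obtain ⟨k, hk⟩ := proj_eq_iff.1 (hl1 _ hx).symm
  have hev := lift_eventually (q := q) (a := toUnit) (b := fun z => l (proj q (toUnit z)))
    (x₀ := (w : ℂ)) (k := k) (continuousAt_toUnit w)
    (ContinuousAt.comp (g := l) (l.continuousAt (hl ▸ hx)) hc) (by
      filter_upwards [hc.preimage_mem_nhds ((chartAt ℂ x₀).open_source.mem_nhds hx)] with z hz
      exact (hl1 _ hz).symm) hk
  have h1 : ContMDiffAt 𝓘(ℂ) 𝓘(ℂ) ω (fun z : ℂ => ((q ^ k : ℂˣ) : ℂ) * z) w :=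
    contMDiffAt_const.mul contMDiffAt_id
  refine h1.congr_of_eventuallyEq ?_
  filter_upwards [hev, isOpen_ne.mem_nhds w.ne_zero] with z hz hz0
  have h2 : extChartAt 𝓘(ℂ) x₀ (proj q (toUnit z)) = l (proj q (toUnit z)) := hl2 _
  rw [Function.comp_apply, h2, hz, Units.val_mul, coe_toUnit hz0]

variable {A B : FlatSystem q} (φ : bundleOf (q := q) A.mat ⟶ bundleOf B.mat)

/-- The matrix of a morphism of bundles in the bases given by `X ↦ [z, X]`. -/
noncomputable def bundleMatrix (z : ℂˣ) : Matrix (Fin B.rank) (Fin A.rank) ℂ :=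
  LinearMap.toMatrix' ((clsEquiv (q := q) B.mat z rfl).symm.toLinearMap ∘ₗ
    HolBundle.app φ (proj q z) ∘ₗ (clsEquiv (q := q) A.mat z rfl).toLinearMap)

theorem bundleMatrix_mulVec (z : ℂˣ) (X : Fin A.rank → ℂ) :
    (bundleMatrix φ z).mulVec X =
      (clsEquiv (q := q) B.mat z rfl).symm
        (HolBundle.app φ (proj q z) (cls (q := q) A.mat z rfl X)) := by
  rw [bundleMatrix, LinearMap.toMatrix'_mulVec]
  rfl

theorem cls_bundleMatrix_mulVec (z : ℂˣ) (X : Fin A.rank → ℂ) :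
    cls (q := q) B.mat z rfl ((bundleMatrix φ z).mulVec X) =
      HolBundle.app φ (proj q z) (cls (q := q) A.mat z rfl X) := by
  rw [bundleMatrix_mulVec]
  exact (clsEquiv (q := q) B.mat z rfl).apply_symm_apply _

theorem cls_bundleMatrix_mulVec' (z : ℂˣ) {x : EllCurve q} (h : proj q z = x)
    (X : Fin A.rank → ℂ) :
    cls (q := q) B.mat z h ((bundleMatrix φ z).mulVec X) =
      HolBundle.app φ x (cls (q := q) A.mat z h X) := by
  subst h
  exact cls_bundleMatrix_mulVec φ z X

/-- The functional equation expresses that `φ` takes one value on `[z, X] = [qᵏ z, Aᵏ X]`, computed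
in the two bases at `z` and at `qᵏ z`. -/
theorem bundleMatrix_zpow (k : ℤ) (z : ℂˣ) :
    bundleMatrix φ (q ^ k * z) * A.pw k = B.pw k * bundleMatrix φ z := by
  refine Matrix.ext_of_mulVec_single fun i => ?_
  have h : proj q (q ^ k * z) = proj q z := (proj_eq_iff.2 ⟨k, rfl⟩).symm
  apply (cls_bijective (q := q) B.mat (q ^ k * z) h).1
  rw [← Matrix.mulVec_mulVec, ← Matrix.mulVec_mulVec, cls_bundleMatrix_mulVec',
    cls_shift A.mat rfl k rfl h, cls_shift B.mat rfl k rfl h, cls_bundleMatrix_mulVec]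

theorem bundleMatrix_eq (k : ℤ) (z : ℂˣ) :
    bundleMatrix φ z = B.pw (-k) * bundleMatrix φ (q ^ k * z) * A.pw k := by
  rw [Matrix.mul_assoc, bundleMatrix_zpow, ← Matrix.mul_assoc, ← pw_add, neg_add_cancel, pw_zero,
    Matrix.one_mul]

/-- On an annulus where the projection is injective, the lift of the class of `z` is `z` itself. The
entries of the matrix are there the coordinates of `φ` in the flat frames, which are holomorphic. -/
theorem bundleMatrix_holo (w : ℂˣ) (i j) :
    DifferentiableAt ℂ (fun z : ℂ => bundleMatrix φ (toUnit z) i j) w := by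
  -- This puts `w` in the middle of the annulus, whose width in `lev` is `1/2`.
  set s : ℝ := lev q w - 1 / 4 with hs
  have hw : w ∈ annulus q s := ⟨by linarith, by linarith⟩
  have hx : proj q w ∈ proj q '' annulus q s := ⟨w, hw, rfl⟩
  have h1 := (HolBundle.isHol_iff (flatFrames (q := q) A.mat).compat (flatFrames B.mat).compat _).1
    (HolBundle.app_holo φ) s s (Pi.single j 1)
  have h2 := h1.contMDiffAt (((isOpen_image_annulus q s).inter
    (isOpen_image_annulus q s)).mem_nhds ⟨hx, hx⟩)
  have h2' := h2
  rw [← toUnit_coe w] at h2'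
  have h3 := ContMDiffAt.comp (w : ℂ) h2' (proj_toUnit_holo w)
  have h4 := (contMDiffAt_pi_space.1 h3 i).contDiffAt.differentiableAt (by simp)
  refine h4.congr_of_eventuallyEq ?_
  have h5 := (continuousAt_toUnit w).preimage_mem_nhds
    ((isOpen_annulus q s).mem_nhds (by rwa [toUnit_coe]))
  filter_upwards [h5] with z hz
  have e := lift_proj q (s := s) hz
  have h6 : (bundleMatrix φ (toUnit z)).mulVec (Pi.single j 1) =
      (flatFrames (q := q) B.mat).toCoord s (proj q (toUnit z))
        (HolBundle.app φ (proj q (toUnit z))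
          ((flatFrames (q := q) A.mat).ofCoord s (proj q (toUnit z)) (Pi.single j 1))) := by
    -- The base point is kept as a variable so that `lift` of the class, which is only
    -- propositionally equal to `toUnit z`, can be substituted without transport between fibres.
    have aux : ∀ (y : ℂˣ) (x : EllCurve q) (h : proj q y = x),
        (bundleMatrix φ y).mulVec (Pi.single j 1) = (clsEquiv (q := q) B.mat y h).symm
          (HolBundle.app φ x (clsEquiv (q := q) A.mat y h (Pi.single j 1))) := by
      rintro y x rfl
      exact bundleMatrix_mulVec φ y _
    exact (congrArg (fun y => (bundleMatrix φ y).mulVec _) e).symm.trans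
      (aux _ _ (proj_lift q s _))
  have h7 := congrFun h6 i
  rw [Matrix.mulVec_single_one] at h7
  exact h7

attribute [local instance] Matrix.linftyOpNormedAddCommGroup Matrix.linftyOpNormedRing in
/-- A function on `ℂˣ` whose values satisfy `G(z) = B⁻ᵏ G(qᵏz) Aᵏ` grows at most like a power
of `|z|⁻¹` at `0`. -/
theorem exists_norm_le_of_zpow {G : ℂˣ → Matrix (Fin B.rank) (Fin A.rank) ℂ}
    (hG : ∀ (k : ℤ) z, G z = B.pw (-k) * G (q ^ k * z) * A.pw k)
    (hc : ∀ (w : ℂˣ), ContinuousAt (fun z : ℂ => G (toUnit z)) w) :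
    ∃ (N : ℕ) (C : ℝ), ∀ z : ℂˣ, ‖(z : ℂ)‖ ≤ 1 → ∀ i j, ‖(z : ℂ)‖ ^ N * ‖G z i j‖ ≤ C := by
  -- The closed annulus `1 ≤ |z| ≤ |q|` meets every orbit of `q^ℤ`, and `G` is bounded on it by
  -- compactness.
  have hK : IsCompact (Metric.closedBall (0 : ℂ) ‖(q : ℂ)‖ \ Metric.ball 0 1) :=
    (isCompact_closedBall _ _).diff Metric.isOpen_ball
  have hne : ∀ z ∈ Metric.closedBall (0 : ℂ) ‖(q : ℂ)‖ \ Metric.ball 0 1, z ≠ 0 := by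
    rintro z ⟨-, hz⟩ rfl
    exact hz (Metric.mem_ball_self one_pos)
  obtain ⟨C, hC⟩ := hK.exists_bound_of_continuousOn (f := fun z => G (toUnit z))
    fun z hz => (hc (Units.mk0 z (hne z hz))).continuousWithinAt
  have hC' (z : ℂˣ) (h1 : 1 ≤ ‖(z : ℂ)‖) (h2 : ‖(z : ℂ)‖ ≤ ‖(q : ℂ)‖) : ‖G z‖ ≤ C := by
    have := hC z ⟨by simpa using h2, by simpa using h1⟩
    rwa [toUnit_coe] at this
  -- Each step `z ↦ qz` costs a factor of at most `‖B⁻¹‖ ‖A‖`; the exponent `N` is chosen so that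
  -- `|q|^N` exceeds it.
  obtain ⟨N, hN⟩ := pow_unbounded_of_one_lt (‖B.pw (-1)‖ * ‖A.pw 1‖) hq.out
  have hC0 : 0 ≤ C := (norm_nonneg _).trans (hC' 1 (by simp) (by simpa using hq.out.le))
  refine ⟨N, ‖(q : ℂ)‖ ^ N * C, fun z hz i j => ?_⟩
  have hz0 : 0 < ‖(z : ℂ)‖ := by simp
  -- From `|q|ⁿ ≤ |z|⁻¹ < |q|ⁿ⁺¹` it follows that `qⁿ⁺¹ z` lies in the compact annulus.
  obtain ⟨n, hn1, hn2⟩ := exists_nat_pow_near ((one_le_inv₀ hz0).2 hz) hq.out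
  have e1 : ‖((q ^ ((n + 1 : ℕ) : ℤ) * z : ℂˣ) : ℂ)‖ = ‖(q : ℂ)‖ ^ (n + 1) * ‖(z : ℂ)‖ := by
    rw [zpow_natCast]
    simp
  have b1 : 1 ≤ ‖(q : ℂ)‖ ^ (n + 1) * ‖(z : ℂ)‖ := by
    rw [← inv_le_iff_one_le_mul₀ hz0]
    exact hn2.le
  have b2 : ‖(q : ℂ)‖ ^ (n + 1) * ‖(z : ℂ)‖ ≤ ‖(q : ℂ)‖ := by
    have : ‖(q : ℂ)‖ ^ n * ‖(z : ℂ)‖ ≤ 1 := (le_inv_mul_iff₀' hz0).1 (by simpa using hn1)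
    calc _ = ‖(q : ℂ)‖ * (‖(q : ℂ)‖ ^ n * ‖(z : ℂ)‖) := by ring
      _ ≤ _ := mul_le_of_le_one_right (norm_nonneg _) this
  have h3 := hC' _ (e1 ▸ b1) (e1 ▸ b2)
  -- The exponent `n + 1` is positive, so the norm of the identity matrix does not enter; it is `0`
  -- in rank `0`.
  have pA : ‖A.pw ((n + 1 : ℕ) : ℤ)‖ ≤ ‖A.pw 1‖ ^ (n + 1) := by
    rw [pw, zpow_natCast, Units.val_pow_eq_pow_val, pw_one]
    exact norm_pow_le' _ n.succ_pos
  have pB : ‖B.pw (-((n + 1 : ℕ) : ℤ))‖ ≤ ‖B.pw (-1)‖ ^ (n + 1) := by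
    rw [pw, zpow_neg, zpow_natCast, ← inv_pow, Units.val_pow_eq_pow_val, pw, zpow_neg_one]
    exact norm_pow_le' _ n.succ_pos
  -- An entry is a coordinate of the image of a basis vector of norm `1`, hence bounded by the
  -- operator norm.
  have hent : ‖G z i j‖ ≤ ‖G z‖ := by
    have h := (norm_le_pi_norm _ i).trans (Matrix.linfty_opNorm_mulVec (G z) (Pi.single j 1))
    rwa [Matrix.mulVec_single_one, Pi.norm_single, norm_one, mul_one] at h
  have h4 : ‖G z‖ ≤ (‖(q : ℂ)‖ ^ (n + 1)) ^ N * C := by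
    rw [hG ((n + 1 : ℕ) : ℤ) z]
    refine (Matrix.linfty_opNorm_mul _ _).trans ?_
    calc _ ≤ (‖B.pw (-1)‖ ^ (n + 1) * C) * ‖A.pw 1‖ ^ (n + 1) := by
          refine mul_le_mul ((Matrix.linfty_opNorm_mul _ _).trans ?_) pA (norm_nonneg _)
            (by positivity)
          exact mul_le_mul pB h3 (norm_nonneg _) (by positivity)
      _ = (‖B.pw (-1)‖ * ‖A.pw 1‖) ^ (n + 1) * C := by ring
      _ ≤ (‖(q : ℂ)‖ ^ N) ^ (n + 1) * C := by gcongr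
      _ = _ := by ring
  calc ‖(z : ℂ)‖ ^ N * ‖G z i j‖ ≤ ‖(z : ℂ)‖ ^ N * ((‖(q : ℂ)‖ ^ (n + 1)) ^ N * C) := by
        gcongr
        exact hent.trans h4
    _ = (‖(q : ℂ)‖ ^ (n + 1) * ‖(z : ℂ)‖) ^ N * C := by ring
    _ ≤ _ := by gcongr

/-- A function which is holomorphic on a punctured neighbourhood of `0` and grows at most like a
power of `|z|⁻¹` is meromorphic at `0`. -/
theorem meromorphicAt_of_norm_le {g : ℂ → ℂ} (hg : ∀ᶠ z in 𝓝[≠] 0, DifferentiableAt ℂ g z)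
    {N : ℕ} {C : ℝ} (hC : ∀ᶠ z in 𝓝[≠] 0, ‖z‖ ^ N * ‖g z‖ ≤ C) : MeromorphicAt g 0 := by
  -- One power more than the growth bound gives `|z^(N+1) g(z)| ≤ |z| C`, which tends to `0`, the
  -- value of the product at `0`. The product is thus continuous there, and the singularity is
  -- removable.
  refine ⟨N + 1, ?_⟩
  refine Complex.analyticAt_of_differentiable_on_punctured_nhds_of_continuousAt ?_ ?_
  · filter_upwards [hg] with z hz
    fun_prop
  · have h0 : ((0 : ℂ) - 0) ^ (N + 1) • g 0 = 0 := by simp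
    rw [continuousAt_iff_punctured_nhds, h0]
    refine squeeze_zero_norm' (a := fun z => ‖z‖ * C) ?_ ?_
    · filter_upwards [hC] with z hz
      rw [sub_zero, smul_eq_mul, norm_mul, norm_pow, pow_succ']
      rw [mul_assoc]
      gcongr
    · have : Filter.Tendsto (fun z : ℂ => ‖z‖ * C) (𝓝 0) (𝓝 (‖(0 : ℂ)‖ * C)) :=
        (continuous_norm.mul continuous_const).tendsto 0
      rw [norm_zero, zero_mul] at this
      exact this.mono_left nhdsWithin_le_nhds

theorem isMor_bundleMatrix : IsMor A B fun z => bundleMatrix φ (toUnit z) := by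
  constructor
  · obtain ⟨N, C, h⟩ := exists_norm_le_of_zpow (bundleMatrix_eq φ) fun w =>
      continuousAt_pi.2 fun i => continuousAt_pi.2 fun j => (bundleMatrix_holo φ w i j).continuousAt
    intro i j
    refine meromorphicAt_of_norm_le (N := N) (C := C) ?_ ?_
    · filter_upwards [self_mem_nhdsWithin] with z hz
      exact bundleMatrix_holo φ (Units.mk0 z hz) i j
    · filter_upwards [self_mem_nhdsWithin,
        nhdsWithin_le_nhds (Metric.closedBall_mem_nhds (0 : ℂ) one_pos)] with z hz hz1
      have := h (toUnit z)
      rw [coe_toUnit hz] at this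
      exact this (by simpa using hz1) i j
  · filter_upwards [self_mem_nhdsWithin] with z hz
    have h := bundleMatrix_zpow φ 1 (toUnit z)
    rw [pw_one, pw_one, zpow_one] at h
    rw [← h]
    congr 2
    rw [← toUnit_coe (q * toUnit z), Units.val_mul, coe_toUnit hz]

instance : (flatFunctor q).Full where
  map_surjective {A B} φ := by
    refine ⟨ofFn _ (isMor_bundleMatrix φ.hom), flatBundle_hom_ext fun z X => ?_⟩
    rw [app_map_cls]
    -- The functional equation holds on all of `ℂˣ`, so `Bᵏ G(q⁻ᵏ z) A⁻ᵏ` equals `G(z)` for every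
    -- `k`, and extending the germ of `G` returns `G`.
    have : ext (ofFn _ (isMor_bundleMatrix φ.hom)) z = bundleMatrix φ.hom z := by
      refine ext_eq (fn_ofFn _) z
        (Filter.Eventually.frequently (Filter.Eventually.of_forall fun k => ?_))
      rw [extK, toUnit_coe, bundleMatrix_eq φ.hom (-k) z, neg_neg]
    rw [this]
    exact cls_bundleMatrix_mulVec φ.hom z X

end

end QDiff

/-! ### The tensor structure of the functor -/

namespace QDiff

open FlatSystem

variable {q : ℂˣ} [hq : Fact (1 < ‖(q : ℂ)‖)]

theorem kron_mulVec {p m r n : ℕ} (M : Matrix (Fin p) (Fin m) ℂ) (N : Matrix (Fin r) (Fin n) ℂ)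
    (v : Fin m → ℂ) (w : Fin n → ℂ) :
    (kron M N).mulVec (kronVec v w) = kronVec (M.mulVec v) (N.mulVec w) := by
  ext i
  simp only [Matrix.mulVec, dotProduct, kronVec, kron_apply, Finset.sum_mul_sum]
  rw [← Fintype.sum_prod_type', ← (pairIdx m n).sum_comp]
  refine Finset.sum_congr rfl fun x _ => ?_
  simp only [Equiv.symm_apply_apply]
  ring

theorem perm_mulVec {m n : ℕ} (σ : Fin m ≃ Fin n) (v : Fin m → ℂ) :
    (perm σ).mulVec v = v ∘ σ.symm := by
  ext i
  simp [perm, Matrix.mulVec, dotProduct, Matrix.one_apply]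

/-- The identification `[z, X] ⊗ [z, Y] ↦ [z, X ⊗ Y]` on the fibres. -/
noncomputable def tensorFib (A B : FlatSystem q) (x : EllCurve q) :
    Fib q A.mat x ⊗[ℂ] Fib q B.mat x ≃ₗ[ℂ] Fib q (tensor A B).mat x :=
  (TensorProduct.congr (clsEquiv A.mat (Quotient.out x) (QuotientGroup.out_eq' x)).symm
    (clsEquiv B.mat (Quotient.out x) (QuotientGroup.out_eq' x)).symm).trans
  ((kronEquiv A.rank B.rank).trans
    (clsEquiv (tensor A B).mat (Quotient.out x) (QuotientGroup.out_eq' x)))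

/-- Changing the representative `z` to `qᵏ z` multiplies `X` by `Aᵏ` and `Y` by `Bᵏ`, hence their
Kronecker product by the `k`-th power of the matrix of the tensor product. The definition through
one chosen representative therefore agrees with every other choice. -/
theorem tensorFib_cls (A B : FlatSystem q) (z : ℂˣ) {x : EllCurve q} (h : proj q z = x)
    (X : Fin A.rank → ℂ) (Y : Fin B.rank → ℂ) :
    tensorFib A B x (cls A.mat z h X ⊗ₜ cls B.mat z h Y) =
      cls (tensor A B).mat z h (kronVec X Y) := by
  obtain ⟨k, hk⟩ := proj_eq_iff.1 (h.trans (QuotientGroup.out_eq' x).symm)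
  change cls (tensor A B).mat _ _ (kronEquiv _ _ (TensorProduct.congr _ _ (_ ⊗ₜ _))) = _
  rw [TensorProduct.congr_tmul, clsEquiv_symm_shift A.mat h k hk, clsEquiv_symm_shift B.mat h k hk, kronEquiv_tmul,
    ← kron_mulVec, ← kron_pw]
  exact cls_shift (tensor A B).mat h k hk _ _

theorem tensorFib_symm_cls (A B : FlatSystem q) (z : ℂˣ) {x : EllCurve q} (h : proj q z = x)
    (X : Fin A.rank → ℂ) (Y : Fin B.rank → ℂ) :
    (tensorFib A B x).symm (cls (tensor A B).mat z h (kronVec X Y)) =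
      cls A.mat z h X ⊗ₜ cls B.mat z h Y := by
  rw [LinearEquiv.symm_apply_eq, tensorFib_cls]

theorem flatFrames_toCoord_cls {n : ℕ} (A : GL (Fin n) ℂ) (s t : ℝ) {x : EllCurve q}
    (hs : x ∈ proj q '' annulus q s) (ht : x ∈ proj q '' annulus q t) (X : Fin n → ℂ) :
    (flatFrames A).toCoord t x (cls A (lift q s x) (proj_lift q s x) X) =
      ((A ^ round (t - s) : GL (Fin n) ℂ) : Matrix (Fin n) (Fin n) ℂ).mulVec X :=
  clsEquiv_symm_shift A (proj_lift q s x) _ (lift_shift q hs ht) (proj_lift q t x) X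

/-- In the flat frames the coordinates of this map are constant: only powers of `A` and `B` with
exponents fixed by the annuli occur. -/
theorem tensorFib_holo (A B : FlatSystem q) :
    ((bundleOf (q := q) A.mat).tensor (bundleOf B.mat)).IsHol (bundleOf (tensor A B).mat)
      fun x => (tensorFib A B x).toLinearMap := by
  refine (HolBundle.isHol_iff ((flatFrames A.mat).compat.tensor (flatFrames B.mat).compat)
    (flatFrames (tensor A B).mat).compat _).2 fun ⟨(s : ℝ), (s' : ℝ)⟩ (t : ℝ) v => ?_
  refine holo_of_kron (g := fun x => (flatFrames (tensor A B).mat).toCoord t x ∘ₗ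
    (tensorFib A B x).toLinearMap ∘ₗ
      ((flatFrames A.mat).tensor (flatFrames B.mat)).ofCoord (s, s') x) (fun X Y => ?_) v
  -- The two factors may use different annuli `s` and `s'`. The vector `Y` is first moved to the
  -- lift in the annulus `s`, which costs `B` to the power `round (s - s')`; the product then moves
  -- from `s` to `t`.
  refine (contMDiffOn_const (c := ((tensor A B).pw (round (t - s))).mulVec
    (kronVec X ((B.pw (round (s - s'))).mulVec Y)))).congr fun x hx => ?_
  obtain ⟨⟨h1, h2⟩, h3⟩ := hx
  have e : ((flatFrames A.mat).tensor (flatFrames B.mat)).ofCoord (s, s') x (kronVec X Y) =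
      cls A.mat (lift q s x) (proj_lift q s x) X ⊗ₜ
        cls B.mat (lift q s x) (proj_lift q s x) ((B.pw (round (s - s'))).mulVec Y) := by
    rw [cls_shift B.mat (proj_lift q s' x) _ (lift_shift q h2 h1)]
    change TensorProduct.map _ _ ((kronEquiv _ _).symm (kronVec X Y)) = _
    rw [kronEquiv_symm]
    rfl
  rw [LinearMap.comp_apply, LinearMap.comp_apply, e]
  refine (congrArg _ (tensorFib_cls A B _ _ _ _)).trans ?_
  exact flatFrames_toCoord_cls (tensor A B).mat s t h1 h3 _

theorem tensorFib_symm_holo (A B : FlatSystem q) :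
    (bundleOf (q := q) (tensor A B).mat).IsHol ((bundleOf A.mat).tensor (bundleOf B.mat))
      fun x => (tensorFib A B x).symm.toLinearMap := by
  refine (HolBundle.isHol_iff (flatFrames (tensor A B).mat).compat
    ((flatFrames A.mat).compat.tensor (flatFrames B.mat).compat) _).2
      fun (t : ℝ) ⟨(s : ℝ), (s' : ℝ)⟩ v => ?_
  refine holo_of_kron (g := fun x =>
    ((flatFrames A.mat).tensor (flatFrames B.mat)).toCoord (s, s') x ∘ₗ
      (tensorFib A B x).symm.toLinearMap ∘ₗ (flatFrames (tensor A B).mat).ofCoord t x)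
      (fun X Y => ?_) v
  -- Conversely, each factor is moved separately from the lift in the annulus `t` to the lift in its
  -- own annulus.
  refine (contMDiffOn_const (c := kronVec ((A.pw (round (s - t))).mulVec X)
    ((B.pw (round (s' - t))).mulVec Y))).congr fun x hx => ?_
  obtain ⟨h3, h1, h2⟩ := hx
  refine (congrArg (((flatFrames A.mat).tensor (flatFrames B.mat)).toCoord (s, s') x)
    (tensorFib_symm_cls A B _ (proj_lift q t x) X Y)).trans ?_
  change kronEquiv _ _ (TensorProduct.map _ _ _) = _
  rw [TensorProduct.map_tmul, kronEquiv_tmul]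
  exact congrArg₂ kronVec (flatFrames_toCoord_cls A.mat t s h3 h1 X)
    (flatFrames_toCoord_cls B.mat t s' h3 h2 Y)

/-- The identification of the trivial line with the fibres of the bundle attached to the unit. -/
noncomputable def unitFib (q : ℂˣ) [Fact (1 < ‖(q : ℂ)‖)] (x : EllCurve q) :
    ℂ ≃ₗ[ℂ] Fib q (unit : FlatSystem q).mat x :=
  (LinearEquiv.funUnique (Fin 1) ℂ ℂ).symm.trans
    (clsEquiv (unit : FlatSystem q).mat (Quotient.out x) (QuotientGroup.out_eq' x))

/-- The matrix of the unit system is `1`, so `[z, c]` depends only on `c` and on the image of `z`.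
-/
theorem unitFib_apply (z : ℂˣ) {x : EllCurve q} (h : proj q z = x) (c : ℂ) :
    unitFib q x c = cls (unit : FlatSystem q).mat z h (fun _ : Fin 1 => c) := by
  obtain ⟨k, hk⟩ := proj_eq_iff.1 (h.trans (QuotientGroup.out_eq' x).symm)
  refine Eq.trans ?_ (cls_shift (unit : FlatSystem q).mat h k hk (QuotientGroup.out_eq' x) _)
  have : (unit : FlatSystem q).pw k = 1 := by
    rw [pw, show (unit : FlatSystem q).mat = 1 from rfl, one_zpow, Units.val_one]
  exact congrArg (cls _ _ _) ((congrArg (Matrix.mulVec · _) this).trans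
    (Matrix.one_mulVec _)).symm

theorem unitFib_holo : (HolBundle.unitBundle (EllCurve q)).IsHol (bundleOf (unit : FlatSystem q).mat)
    fun x => (unitFib q x).toLinearMap := by
  refine (HolBundle.isHol_iff HolBundle.compat_unit (flatFrames (unit : FlatSystem q).mat).compat
    _).2 fun i (t : ℝ) (v : Fin 1 → ℂ) => ?_
  refine (contMDiffOn_const (I' := 𝓘(ℂ, Fin 1 → ℂ)) (M' := Fin 1 → ℂ) (c := v)).congr fun x hx => ?_
  refine (congrArg ((flatFrames (unit : FlatSystem q).mat).toCoord t x)
    (unitFib_apply (lift q t x) (proj_lift q t x) (v 0))).trans ?_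
  refine ((flatFrames (unit : FlatSystem q).mat).to_of t x hx.2 _).trans ?_
  ext j
  rw [Subsingleton.elim j 0]

theorem unitFib_symm_holo :
    (bundleOf (unit : FlatSystem q).mat).IsHol (HolBundle.unitBundle (EllCurve q))
      fun x => (unitFib q x).symm.toLinearMap := by
  refine (HolBundle.isHol_iff (flatFrames (unit : FlatSystem q).mat).compat HolBundle.compat_unit
    _).2 fun (t : ℝ) i (v : Fin 1 → ℂ) => ?_
  refine (contMDiffOn_const (I' := 𝓘(ℂ, Fin 1 → ℂ)) (M' := Fin 1 → ℂ) (c := v)).congr fun x hx => ?_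
  have h : (unitFib q x).symm ((flatFrames (unit : FlatSystem q).mat).ofCoord t x v) = v 0 := by
    rw [LinearEquiv.symm_apply_eq, unitFib_apply (lift q t x) (proj_lift q t x) (v 0)]
    refine congrArg (cls (unit : FlatSystem q).mat _ _) ?_
    ext j
    rw [Subsingleton.elim j 0]
  refine (congrArg ((FrameAtlas.unit (EllCurve q)).toCoord i x) h).trans ?_
  ext j
  rw [Subsingleton.elim j 0]
  rfl

/-- The isomorphism `F_A ⊗ F_B ≅ F_{A ⊗ B}`. -/
noncomputable def flatTensorIso (A B : FlatSystem q) :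
    (flatFunctor q).obj A ⊗ (flatFunctor q).obj B ≅ (flatFunctor q).obj (A ⊗ B) :=
  ObjectProperty.isoMk _ (HolBundle.mkIso (E := (bundleOf A.mat).tensor (bundleOf B.mat))
    (E' := bundleOf (tensor A B).mat) (tensorFib A B) (tensorFib_holo A B) (tensorFib_symm_holo A B))

/-- The isomorphism between the trivial line bundle and the bundle attached to the unit. -/
noncomputable def flatUnitIso (q : ℂˣ) [Fact (1 < ‖(q : ℂ)‖)] :
    𝟙_ (FlatBundle (EllCurve q)) ≅ (flatFunctor q).obj (𝟙_ (FlatSystem q)) :=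
  ObjectProperty.isoMk _ (HolBundle.mkIso (E := HolBundle.unitBundle (EllCurve q))
    (E' := bundleOf (unit : FlatSystem q).mat) (unitFib q) unitFib_holo unitFib_symm_holo)

theorem flatTensorIso_cls (A B : FlatSystem q) (z : ℂˣ) {x : EllCurve q} (h : proj q z = x)
    (X : Fin A.rank → ℂ) (Y : Fin B.rank → ℂ) :
    HolBundle.app (flatTensorIso A B).hom.hom x
      (show Fib q A.mat x ⊗[ℂ] Fib q B.mat x from cls A.mat z h X ⊗ₜ cls B.mat z h Y) =
      cls (tensor A B).mat z h (kronVec X Y) :=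
  tensorFib_cls A B z h X Y

theorem flatUnitIso_cls (z : ℂˣ) {x : EllCurve q} (h : proj q z = x) (c : ℂ) :
    HolBundle.app (flatUnitIso q).hom.hom x c =
      cls (unit : FlatSystem q).mat z h (fun _ : Fin 1 => c) :=
  unitFib_apply z h c

/-- Linear maps out of a tensor product of fibres can be compared on the `[z, X] ⊗ [z, Y]`. -/
theorem fib_tensor_ext {A B : FlatSystem q} {V : Type*} [AddCommGroup V] [Module ℂ V]
    {x : EllCurve q} {f g : Fib q A.mat x ⊗[ℂ] Fib q B.mat x →ₗ[ℂ] V} (z : ℂˣ) (h : proj q z = x)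
    (hfg : ∀ X Y, f (cls A.mat z h X ⊗ₜ cls B.mat z h Y) = g (cls A.mat z h X ⊗ₜ cls B.mat z h Y)) :
    f = g := by
  refine TensorProduct.ext' fun a b => ?_
  obtain ⟨X, rfl⟩ := (cls_bijective A.mat z h).2 a
  obtain ⟨Y, rfl⟩ := (cls_bijective B.mat z h).2 b
  exact hfg X Y

theorem kronVec_assoc {l m n : ℕ} (u : Fin l → ℂ) (v : Fin m → ℂ) (w : Fin n → ℂ) :
    (perm (assocEquiv l m n)).mulVec (kronVec (kronVec u v) w) = kronVec u (kronVec v w) := by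
  rw [perm_mulVec]
  ext i
  simp [kronVec, assocEquiv, mul_assoc]

theorem kronVec_swap {m n : ℕ} (v : Fin m → ℂ) (w : Fin n → ℂ) :
    (perm (swapEquiv m n)).mulVec (kronVec v w) = kronVec w v := by
  rw [perm_mulVec]
  ext i
  simp [kronVec, swapEquiv, mul_comm]

theorem kronVec_left {n : ℕ} (c : ℂ) (v : Fin n → ℂ) :
    (perm (leftEquiv n)).mulVec (kronVec (fun _ : Fin 1 => c) v) = c • v := by
  rw [perm_mulVec]
  ext i
  simp [kronVec, leftEquiv]

theorem kronVec_right {n : ℕ} (c : ℂ) (v : Fin n → ℂ) :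
    (perm (rightEquiv n)).mulVec (kronVec v (fun _ : Fin 1 => c)) = c • v := by
  rw [perm_mulVec]
  ext i
  simp [kronVec, rightEquiv, mul_comm]

/-- Both sides send `[z, X] ⊗ [z, Y]` to `[z, F(z)X ⊗ G(z)Y]`, because extending germs and applying
matrices to vectors both commute with Kronecker products. -/
theorem flatTensorIso_natural {A B A' B' : FlatSystem q} (F : A ⟶ B) (G : A' ⟶ B') :
    ((flatFunctor q).map F ⊗ₘ (flatFunctor q).map G) ≫ (flatTensorIso B B').hom =
      (flatTensorIso A A').hom ≫ (flatFunctor q).map (tensorMap F G) := by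
  refine ObjectProperty.hom_ext _ (HolBundle.hom_ext fun x => ?_)
  refine fib_tensor_ext _ (QuotientGroup.out_eq' x) fun X Y => ?_
  -- The fibre of a tensor product of bundles is a tensor product of fibres only by unfolding
  -- definitions. The known values are therefore substituted through `congrArg` with explicit types
  -- rather than by rewriting.
  refine Eq.trans (congrArg (HolBundle.app (flatTensorIso B B').hom.hom x)
    (congrArg₂ (fun a b => (a ⊗ₜ[ℂ] b : Fib q B.mat x ⊗[ℂ] Fib q B'.mat x))
      (app_map_cls F _ _ X) (app_map_cls G _ _ Y))) ?_
  refine (flatTensorIso_cls B B' _ _ _ _).trans ?_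
  refine Eq.trans ?_ (congrArg (HolBundle.app ((flatFunctor q).map (tensorMap F G)).hom x)
    (flatTensorIso_cls A A' _ _ X Y)).symm
  refine Eq.trans ?_ (app_map_cls (tensorMap F G) _ _ _).symm
  exact congrArg (cls _ _ _) ((congrArg (Matrix.mulVec · _) (ext_tensorMap F G _)).trans
    (kron_mulVec _ _ X Y)).symm

/-- On `([z, X] ⊗ [z, Y]) ⊗ [z, Z]`, with the same `z` in all three factors, the diagram reduces to
`kronVec_assoc`: the associativity constraint of systems is the permutation that regroups the
coordinates. -/
theorem flatTensorIso_assoc (A B C : FlatSystem q) :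
    ((flatTensorIso A B).hom ▷ (flatFunctor q).obj C) ≫ (flatTensorIso (A ⊗ B) C).hom ≫
        (flatFunctor q).map (α_ A B C).hom =
      (α_ ((flatFunctor q).obj A) ((flatFunctor q).obj B) ((flatFunctor q).obj C)).hom ≫
        ((flatFunctor q).obj A ◁ (flatTensorIso B C).hom) ≫ (flatTensorIso A (B ⊗ C)).hom := by
  refine ObjectProperty.hom_ext _ (HolBundle.hom_ext fun x => ?_)
  refine TensorProduct.ext_threefold fun a b c => ?_
  have h := QuotientGroup.out_eq' x
  obtain ⟨X, rfl⟩ := (cls_bijective A.mat _ h).2 a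
  obtain ⟨Y, rfl⟩ := (cls_bijective B.mat _ h).2 b
  obtain ⟨Z, rfl⟩ := (cls_bijective C.mat _ h).2 c
  have l1 : HolBundle.app (flatTensorIso (A ⊗ B) C).hom.hom x
      (HolBundle.app ((flatTensorIso A B).hom ▷ (flatFunctor q).obj C).hom x
        (show (Fib q A.mat x ⊗[ℂ] Fib q B.mat x) ⊗[ℂ] Fib q C.mat x from
          (cls A.mat _ h X ⊗ₜ cls B.mat _ h Y) ⊗ₜ cls C.mat _ h Z)) =
      cls (tensor (tensor A B) C).mat _ h (kronVec (kronVec X Y) Z) :=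
    (congrArg (fun a => HolBundle.app (flatTensorIso (A ⊗ B) C).hom.hom x
      (a ⊗ₜ[ℂ] cls C.mat _ h Z : Fib q (tensor A B).mat x ⊗[ℂ] Fib q C.mat x))
        (flatTensorIso_cls A B _ h X Y)).trans (flatTensorIso_cls (tensor A B) C _ h _ Z)
  have l2 : HolBundle.app (flatTensorIso A (B ⊗ C)).hom.hom x
      (HolBundle.app ((flatFunctor q).obj A ◁ (flatTensorIso B C).hom).hom x
        (show Fib q A.mat x ⊗[ℂ] (Fib q B.mat x ⊗[ℂ] Fib q C.mat x) from
          cls A.mat _ h X ⊗ₜ (cls B.mat _ h Y ⊗ₜ cls C.mat _ h Z))) =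
      cls (tensor A (tensor B C)).mat _ h (kronVec X (kronVec Y Z)) :=
    (congrArg (fun a => HolBundle.app (flatTensorIso A (B ⊗ C)).hom.hom x
      (cls A.mat _ h X ⊗ₜ[ℂ] a : Fib q A.mat x ⊗[ℂ] Fib q (tensor B C).mat x))
        (flatTensorIso_cls B C _ h Y Z)).trans (flatTensorIso_cls A (tensor B C) _ h X _)
  refine (congrArg (HolBundle.app ((flatFunctor q).map (α_ A B C).hom).hom x) l1).trans ?_
  refine Eq.trans ?_ l2.symm
  refine (app_map_cls (α_ A B C).hom _ h _).trans (congrArg (cls _ _ h) ?_)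
  refine (congrArg (Matrix.mulVec · _) (ext_permIso _ _ _)).trans ?_
  exact kronVec_assoc X Y Z

theorem flatTensorIso_left (A : FlatSystem q) :
    (λ_ ((flatFunctor q).obj A)).hom = ((flatUnitIso q).hom ▷ (flatFunctor q).obj A) ≫
      (flatTensorIso (𝟙_ (FlatSystem q)) A).hom ≫ (flatFunctor q).map (λ_ A).hom := by
  refine ObjectProperty.hom_ext _ (HolBundle.hom_ext fun x => ?_)
  refine TensorProduct.ext' fun (c : ℂ) a => ?_
  have h := QuotientGroup.out_eq' x
  obtain ⟨X, rfl⟩ := (cls_bijective A.mat _ h).2 a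
  have l1 : HolBundle.app (flatTensorIso (𝟙_ (FlatSystem q)) A).hom.hom x
      (HolBundle.app ((flatUnitIso q).hom ▷ (flatFunctor q).obj A).hom x
        (show ℂ ⊗[ℂ] Fib q A.mat x from c ⊗ₜ cls A.mat _ h X)) =
      cls (tensor unit A).mat _ h (kronVec (fun _ : Fin 1 => c) X) :=
    (congrArg (fun a => HolBundle.app (flatTensorIso (𝟙_ (FlatSystem q)) A).hom.hom x
      (a ⊗ₜ[ℂ] cls A.mat _ h X : Fib q (unit : FlatSystem q).mat x ⊗[ℂ] Fib q A.mat x))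
        (flatUnitIso_cls _ h c)).trans (flatTensorIso_cls unit A _ h _ X)
  refine Eq.trans ?_ (congrArg (HolBundle.app ((flatFunctor q).map (λ_ A).hom).hom x) l1).symm
  refine Eq.trans ?_ (app_map_cls (λ_ A).hom _ h _).symm
  refine Eq.trans ?_ (congrArg (cls _ _ h) ((congrArg (Matrix.mulVec · _)
    (ext_permIso _ _ _)).trans (kronVec_left c X))).symm
  exact (cls_smul A.mat _ h c X).symm

theorem flatTensorIso_right (A : FlatSystem q) :
    (ρ_ ((flatFunctor q).obj A)).hom = ((flatFunctor q).obj A ◁ (flatUnitIso q).hom) ≫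
      (flatTensorIso A (𝟙_ (FlatSystem q))).hom ≫ (flatFunctor q).map (ρ_ A).hom := by
  refine ObjectProperty.hom_ext _ (HolBundle.hom_ext fun x => ?_)
  refine TensorProduct.ext' fun a (c : ℂ) => ?_
  have h := QuotientGroup.out_eq' x
  obtain ⟨X, rfl⟩ := (cls_bijective A.mat _ h).2 a
  have l1 : HolBundle.app (flatTensorIso A (𝟙_ (FlatSystem q))).hom.hom x
      (HolBundle.app ((flatFunctor q).obj A ◁ (flatUnitIso q).hom).hom x
        (show Fib q A.mat x ⊗[ℂ] ℂ from cls A.mat _ h X ⊗ₜ c)) =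
      cls (tensor A unit).mat _ h (kronVec X (fun _ : Fin 1 => c)) :=
    (congrArg (fun a => HolBundle.app (flatTensorIso A (𝟙_ (FlatSystem q))).hom.hom x
      (cls A.mat _ h X ⊗ₜ[ℂ] a : Fib q A.mat x ⊗[ℂ] Fib q (unit : FlatSystem q).mat x))
        (flatUnitIso_cls _ h c)).trans (flatTensorIso_cls A unit _ h X _)
  refine Eq.trans ?_ (congrArg (HolBundle.app ((flatFunctor q).map (ρ_ A).hom).hom x) l1).symm
  refine Eq.trans ?_ (app_map_cls (ρ_ A).hom _ h _).symm
  refine Eq.trans ?_ (congrArg (cls _ _ h) ((congrArg (Matrix.mulVec · _)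
    (ext_permIso _ _ _)).trans (kronVec_right c X))).symm
  exact (cls_smul A.mat _ h c X).symm

/-- The commutativity constraint of systems has the constant matrix `perm (swapEquiv _ _)`, which
exchanges the factors of a Kronecker product of vectors. -/
theorem flatTensorIso_braid (A B : FlatSystem q) :
    (flatTensorIso A B).hom ≫ (flatFunctor q).map (β_ A B).hom =
      (β_ ((flatFunctor q).obj A) ((flatFunctor q).obj B)).hom ≫ (flatTensorIso B A).hom := by
  refine ObjectProperty.hom_ext _ (HolBundle.hom_ext fun x => ?_)
  have h := QuotientGroup.out_eq' x
  refine fib_tensor_ext _ h fun X Y => ?_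
  refine (congrArg (HolBundle.app ((flatFunctor q).map (β_ A B).hom).hom x)
    (flatTensorIso_cls A B _ h X Y)).trans ?_
  refine Eq.trans ?_ (flatTensorIso_cls B A _ h Y X).symm
  refine (app_map_cls (β_ A B).hom _ h _).trans (congrArg (cls _ _ h) ?_)
  exact (congrArg (Matrix.mulVec · _) (ext_permIso _ _ _)).trans (kronVec_swap X Y)

/-- The tensor structure of the functor `A ↦ F_A`. -/
noncomputable def flatCoreMonoidal (q : ℂˣ) [Fact (1 < ‖(q : ℂ)‖)] :
    (flatFunctor q).CoreMonoidal where
  εIso := flatUnitIso q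
  μIso := flatTensorIso
  μIso_hom_natural_left F A' := by
    rw [← MonoidalCategory.tensorHom_id, ← (flatFunctor q).map_id]
    exact flatTensorIso_natural F (𝟙 A')
  μIso_hom_natural_right A' F := by
    rw [← MonoidalCategory.id_tensorHom, ← (flatFunctor q).map_id]
    exact flatTensorIso_natural (𝟙 A') F
  associativity := flatTensorIso_assoc
  left_unitality := flatTensorIso_left
  right_unitality := flatTensorIso_right

/-- The symmetric tensor structure of the functor `A ↦ F_A`. -/
@[reducible]
noncomputable def flatBraided (q : ℂˣ) [Fact (1 < ‖(q : ℂ)‖)] : (flatFunctor q).Braided :=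
  { (flatCoreMonoidal q).toMonoidal with
    braided := flatTensorIso_braid }

end QDiff

/-! ### Parallel transport and monodromy of flat frames -/

namespace QDiff

section FlatFamily

variable {X : Type} [TopologicalSpace X] [ChartedSpace ℂ X] {n : ℕ} {E : X → Type}
  [∀ x, AddCommGroup (E x)] [∀ x, Module ℂ (E x)] {Y : Type} [TopologicalSpace Y]

/-- The transition functions of an atlas of frames are constant. -/
def FrameAtlas.IsConst (A : FrameAtlas n E) : Prop :=
  ∀ i j, ∃ g : (Fin n → ℂ) →ₗ[ℂ] (Fin n → ℂ),
    ∀ x ∈ A.U i ∩ A.U j, ∀ v, A.toCoord j x (A.ofCoord i x v) = g v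

/-- A family of linear maps `ℂⁿ → E (p y)` is flat if it is locally constant in the frames. -/
def FrameAtlas.IsFlatFamily (A : FrameAtlas n E) (p : Y → X)
    (T : ∀ y x, p y = x → ((Fin n → ℂ) →ₗ[ℂ] E x)) : Prop :=
  ∀ i y, p y ∈ A.U i → ∀ᶠ y' in 𝓝 y,
    A.toCoord i (p y') ∘ₗ T y' _ rfl = A.toCoord i (p y) ∘ₗ T y _ rfl

/-- The space of linear maps from `ℂⁿ` to the fibres of a flat bundle, as a covering of the base:
its model fibre is endowed with the discrete topology. -/
def FrameAtlas.endCore (A : FrameAtlas n E) (hA : A.IsConst) :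
    letI : TopologicalSpace ((Fin n → ℂ) →ₗ[ℂ] (Fin n → ℂ)) := ⊥
    FiberBundleCore A.ι X ((Fin n → ℂ) →ₗ[ℂ] (Fin n → ℂ)) :=
  letI : TopologicalSpace ((Fin n → ℂ) →ₗ[ℂ] (Fin n → ℂ)) := ⊥
  haveI : DiscreteTopology ((Fin n → ℂ) →ₗ[ℂ] (Fin n → ℂ)) := ⟨rfl⟩
  { baseSet := A.U
    isOpen_baseSet := A.isOpen
    indexAt := A.idx
    mem_baseSet_at := A.mem_idx
    coordChange := fun i j x f => (A.toCoord j x ∘ₗ A.ofCoord i x) ∘ₗ f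
    coordChange_self := fun i x hx f => LinearMap.ext fun v => A.to_of i x hx (f v)
    -- Constancy of the transition matrices is needed here: the coordinate change does not depend on
    -- `x`, so it is continuous although the model fibre is discrete.
    continuousOn_coordChange := fun i j => by
      obtain ⟨g, hg⟩ := hA i j
      have hc : Continuous fun f : (Fin n → ℂ) →ₗ[ℂ] (Fin n → ℂ) => g ∘ₗ f :=
        continuous_of_discreteTopology
      refine (hc.comp continuous_snd).continuousOn.congr fun p hp => ?_
      exact LinearMap.ext fun v => hg p.1 hp.1 (p.2 v)
    coordChange_comp := fun i j k x hx f => LinearMap.ext fun v => by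
      simp [A.of_to j x hx.1.2] }

/-- This is parallel transport: the map `p` from a simply connected space lifts to the covering of
the base by linear maps from `ℂⁿ` to the fibres, and a continuous lift is locally constant in the
frames. -/
theorem FrameAtlas.exists_isFlatFamily (A : FrameAtlas n E) (hA : A.IsConst)
    [SimplyConnectedSpace Y] [LocallyPathConnectedSpace Y] (p : C(Y, X)) (y₀ : Y) :
    ∃ T, A.IsFlatFamily p T ∧ Function.Bijective (T y₀ _ rfl) := by
  let _ : TopologicalSpace ((Fin n → ℂ) →ₗ[ℂ] (Fin n → ℂ)) := ⊥
  have : DiscreteTopology ((Fin n → ℂ) →ₗ[ℂ] (Fin n → ℂ)) := ⟨rfl⟩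
  let Z := A.endCore hA
  have hcov : IsCoveringMap (π ((Fin n → ℂ) →ₗ[ℂ] (Fin n → ℂ)) Z.Fiber) :=
    FiberBundle.isCoveringMap
  -- A point of the covering over `x` is recorded by its coordinates in the preferred frame `A.idx
  -- x`. Starting from the identity makes the family bijective at `y₀`, and it explains the
  -- `A.ofCoord (A.idx x) x` in the definition of the family below.
  obtain ⟨s, ⟨hs0, hs⟩, -⟩ := hcov.existsUnique_continuousMap_lifts p y₀
    ⟨p y₀, (LinearMap.id : (Fin n → ℂ) →ₗ[ℂ] (Fin n → ℂ))⟩ rfl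
  have hsp (y : Y) : (s y).1 = p y := congrFun hs y
  let m (y : Y) : (Fin n → ℂ) →ₗ[ℂ] (Fin n → ℂ) := (s y).2
  refine ⟨fun y x _ => A.ofCoord (A.idx x) x ∘ₗ m y, fun i y hy => ?_, ?_⟩
  · have hc : ContinuousAt (fun y => (Z.localTriv i (s y)).2) y := by
      refine continuous_snd.continuousAt.comp (ContinuousAt.comp (g := Z.localTriv i) ?_
        s.continuous.continuousAt)
      refine (Z.localTriv i).continuousAt ?_
      rw [(Z.localTriv i).mem_source]
      change (s y).1 ∈ A.U i
      rwa [hsp]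
    have h1 : ∀ y', (Z.localTriv i (s y')).2 =
        A.toCoord i (p y') ∘ₗ (A.ofCoord (A.idx (p y')) (p y') ∘ₗ m y') := by
      intro y'
      rw [← hsp y']
      rfl
    -- In a discrete space the singletons are neighbourhoods, so continuity means local constancy.
    have h2 := hc.eventually (p := fun f => f = (Z.localTriv i (s y)).2)
      (by rw [nhds_discrete]; exact rfl)
    filter_upwards [h2] with y' hy'
    rw [← h1, ← h1]
    exact hy'
  · have hm : m y₀ = LinearMap.id := by
      change (s y₀).2 = _
      rw [hs0]
    beta_reduce
    rw [hm]
    exact (A.equiv (A.idx (p y₀)) (p y₀) (A.mem_idx _)).symm.bijective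

variable {A : FrameAtlas n E} {p : Y → X} {T T' : ∀ y x, p y = x → ((Fin n → ℂ) →ₗ[ℂ] E x)}

theorem FrameAtlas.toCoord_injective (A : FrameAtlas n E) {i : A.ι} {x : X} (hx : x ∈ A.U i) :
    Function.Injective (A.toCoord i x) :=
  (A.equiv i x hx).injective

theorem FrameAtlas.toCoord_bijective (A : FrameAtlas n E) {i : A.ι} {x : X} (hx : x ∈ A.U i) :
    Function.Bijective (A.toCoord i x) :=
  (A.equiv i x hx).bijective

/-- In a frame the family is locally constant, so bijectivity is a locally constant property, and
the parameter space is connected. -/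
theorem FrameAtlas.IsFlatFamily.bijective [PreconnectedSpace Y] (hT : A.IsFlatFamily p T)
    (hp : Continuous p) {y₀ : Y} (h0 : Function.Bijective (T y₀ _ rfl)) (y : Y) :
    Function.Bijective (T y _ rfl) := by
  have hloc : IsLocallyConstant fun y => Function.Bijective (T y _ rfl) := by
    refine (IsLocallyConstant.iff_eventually_eq _).2 fun y => ?_
    have hy := A.mem_idx (p y)
    filter_upwards [hT _ y hy, hp.continuousAt.preimage_mem_nhds ((A.isOpen _).mem_nhds hy)]
      with y' h1 h2
    have e (z : Y) (hz : p z ∈ A.U (A.idx (p y))) : Function.Bijective (T z _ rfl) ↔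
        Function.Bijective (A.toCoord (A.idx (p y)) (p z) ∘ₗ T z _ rfl) := by
      rw [LinearMap.coe_comp]
      exact (Function.Bijective.of_comp_iff' (A.toCoord_bijective hz) _).symm
    exact propext ((e y' h2).trans ((by rw [h1]) : _ ↔ _) |>.trans (e y hy).symm)
  have := hloc.apply_eq_of_preconnectedSpace y₀ y
  exact this.mp h0

/-- The ratio `T⁻¹ T'` of two flat families is locally constant, hence constant. Applied to a family
and its translate by a period, it gives the monodromy matrix. -/
theorem FrameAtlas.IsFlatFamily.exists_comp [PreconnectedSpace Y] [Nonempty Y]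
    (hT : A.IsFlatFamily p T) (hT' : A.IsFlatFamily p T') (hp : Continuous p)
    (hb : ∀ y, Function.Bijective (T y _ rfl)) :
    ∃ M : (Fin n → ℂ) →ₗ[ℂ] (Fin n → ℂ), ∀ y x h, T' y x h = T y x h ∘ₗ M := by
  let M (y : Y) : (Fin n → ℂ) →ₗ[ℂ] (Fin n → ℂ) :=
    (LinearEquiv.ofBijective _ (hb y)).symm.toLinearMap ∘ₗ T' y _ rfl
  have hM (y : Y) : T' y _ rfl = T y _ rfl ∘ₗ M y := LinearMap.ext fun v =>
    ((LinearEquiv.ofBijective _ (hb y)).apply_symm_apply _).symm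
  have hloc : IsLocallyConstant M := by
    refine (IsLocallyConstant.iff_eventually_eq _).2 fun y => ?_
    have hy := A.mem_idx (p y)
    filter_upwards [hT _ y hy, hT' _ y hy,
      hp.continuousAt.preimage_mem_nhds ((A.isOpen _).mem_nhds hy)] with y' h1 h2 h3
    rw [hM, hM, ← LinearMap.comp_assoc, ← LinearMap.comp_assoc, h1] at h2
    refine LinearMap.ext fun v => (hb y).1 (A.toCoord_injective hy ?_)
    exact LinearMap.congr_fun h2 v
  obtain ⟨y₀⟩ := ‹Nonempty Y›
  refine ⟨M y₀, ?_⟩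
  rintro y _ rfl
  rw [hM, hloc.apply_eq_of_preconnectedSpace y y₀]

/-- The translated family must take values in the fibre over `p y`, which equals `p (σ y)` only
propositionally; this is why families take a point `x` and a proof of `p y = x` as arguments. -/
theorem FrameAtlas.IsFlatFamily.comp (hT : A.IsFlatFamily p T) {σ : Y → Y} (hσ : Continuous σ)
    (h : ∀ y, p (σ y) = p y) :
    A.IsFlatFamily p fun y x hy => T (σ y) x ((h y).trans hy) := by
  have e' : ∀ i z x (hz : p z = x), A.toCoord i x ∘ₗ T z x hz =
      A.toCoord i (p z) ∘ₗ T z _ rfl := by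
    rintro i z _ rfl
    rfl
  intro i y hy
  filter_upwards [hσ.continuousAt.eventually (hT i (σ y) ((h y).symm ▸ hy))] with y' hy'
  exact (e' i (σ y') _ (h y')).trans (hy'.trans (e' i (σ y) _ (h y)).symm)

end FlatFamily

end QDiff

/-! ### The exponential covering and one-parameter groups -/

namespace QDiff

/-- The exponential `ℂ → ℂˣ`. -/
noncomputable def expUnit (w : ℂ) : ℂˣ := Units.mk0 (Complex.exp w) (Complex.exp_ne_zero w)

theorem coe_expUnit (w : ℂ) : (expUnit w : ℂ) = Complex.exp w := rfl

theorem expUnit_add (w w' : ℂ) : expUnit (w + w') = expUnit w * expUnit w' :=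
  Units.ext (Complex.exp_add w w')

theorem expUnit_log (z : ℂˣ) : expUnit (Complex.log z) = z :=
  Units.ext (Complex.exp_log z.ne_zero)

theorem expUnit_int_mul (k : ℤ) (w : ℂ) : expUnit (k * w) = expUnit w ^ k :=
  Units.ext (by rw [Units.val_zpow_eq_zpow_val, coe_expUnit, coe_expUnit, Complex.exp_int_mul])

theorem continuous_expUnit : Continuous expUnit := by
  refine Units.isEmbedding_val₀.continuous_iff.2 ?_
  exact Complex.continuous_exp

section

variable {R : Type*} [NormedRing R] [NormedAlgebra ℂ R] [FiniteDimensional ℂ R]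

/-- The one-parameter group `w ↦ exp (w N)`. -/
noncomputable def oneParam (N : R) (w : ℂ) : R := NormedSpace.exp (w • N)

theorem oneParam_add (N : R) (w w' : ℂ) : oneParam N (w + w') = oneParam N w * oneParam N w' := by
  have : CompleteSpace R := FiniteDimensional.complete ℂ R
  let _ : NormedAlgebra ℚ R := NormedAlgebra.restrictScalars ℚ ℂ R
  rw [oneParam, add_smul, NormedSpace.exp_add_of_commute]
  · rfl
  · exact ((Commute.refl N).smul_left w).smul_right w'

omit [FiniteDimensional ℂ R] in
theorem oneParam_zero (N : R) : oneParam N 0 = 1 := by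
  rw [oneParam, zero_smul, NormedSpace.exp_zero]

theorem oneParam_mul_neg (N : R) (w : ℂ) : oneParam N w * oneParam N (-w) = 1 := by
  rw [← oneParam_add, add_neg_cancel, oneParam_zero]

theorem isUnit_oneParam (N : R) (w : ℂ) : IsUnit (oneParam N w) :=
  ⟨⟨oneParam N w, oneParam N (-w), oneParam_mul_neg N w, by
    simpa using oneParam_mul_neg N (-w)⟩, rfl⟩

theorem oneParam_commute {N M : R} (h : Commute N M) (w : ℂ) : Commute (oneParam N w) M := by
  have : CompleteSpace R := FiniteDimensional.complete ℂ R
  let _ : NormedAlgebra ℚ R := NormedAlgebra.restrictScalars ℚ ℂ R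
  exact (h.smul_left w).exp_left

/-- The exponential of a finite-dimensional algebra is analytic everywhere, and here it is composed
with a linear map; this makes the corrected frames holomorphic. -/
theorem contDiff_oneParam (N : R) : ContDiff ℂ ω (oneParam N) := by
  have : CompleteSpace R := FiniteDimensional.complete ℂ R
  have h : AnalyticOnNhd ℂ (oneParam N) Set.univ := fun w _ =>
    AnalyticAt.fun_comp (g := NormedSpace.exp) (f := fun w : ℂ => w • N)
      (NormedSpace.exp_analytic (𝕂 := ℂ) (w • N)) (analyticAt_id.smul analyticAt_const)
  exact h.contDiff

/-- An invertible element `M` is the value at `c ≠ 0` of a one-parameter group which commutes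
with everything that commutes with `M`. -/
theorem exists_oneParam_eq {M : R} (hM : IsUnit M) {c : ℂ} (hc : c ≠ 0) :
    ∃ N, oneParam N c = M ∧ ∀ P, Commute M P → Commute N P := by
  obtain ⟨L, h1, h2⟩ := NormedSpace.exists_exp_eq hM
  refine ⟨c⁻¹ • L, ?_, fun P hP => (h2 P hP).smul_left _⟩
  rw [oneParam, smul_inv_smul₀ hc, h1]

end

variable {q : ℂˣ} [hq : Fact (1 < ‖(q : ℂ)‖)]

variable (q) in
/-- The universal covering `w ↦ exp w` of `ℂˣ / q^ℤ`. -/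
noncomputable def uniProj : C(ℂ, EllCurve q) where
  toFun w := proj q (expUnit w)
  continuous_toFun := QuotientGroup.continuous_mk.comp continuous_expUnit

omit hq in
theorem uniProj_apply (w : ℂ) : uniProj q w = proj q (expUnit w) := rfl

omit hq in
theorem uniProj_add {w c : ℂ} {k : ℤ} (hc : expUnit c = q ^ k) :
    uniProj q (w + c) = uniProj q w := by
  rw [uniProj_apply, uniProj_apply, expUnit_add, hc, mul_comm]
  exact (proj_eq_iff.2 ⟨k, rfl⟩).symm

/-- A family of frames of the pull-back of a bundle to `ℂ`, with constant multipliers `1` and `A`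
with respect to the translations by `2πi` and by a logarithm of `q`. -/
structure EquivariantFrame {n : ℕ} {E : EllCurve q → Type} [∀ x, AddCommGroup (E x)]
    [∀ x, Module ℂ (E x)] (F : FrameAtlas n E) where
  toFun : ∀ w x, uniProj q w = x → ((Fin n → ℂ) →ₗ[ℂ] E x)
  mat : GL (Fin n) ℂ
  bijective : ∀ w x h, Function.Bijective (toFun w x h)
  shift : ∀ w w' x h h' (k : ℤ), expUnit w' = q ^ k * expUnit w → ∀ v,
    toFun w' x h' (((mat ^ k : GL (Fin n) ℂ) : Matrix (Fin n) (Fin n) ℂ).mulVec v) = toFun w x h v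
  gen : (Fin n → ℂ) →L[ℂ] (Fin n → ℂ)
  eq_oneParam : ∀ i w, uniProj q w ∈ F.U i → ∃ P : (Fin n → ℂ) ≃ₗ[ℂ] (Fin n → ℂ),
    ∀ᶠ w' in 𝓝 w, ∀ x h v, F.toCoord i x (toFun w' x h v) = P (oneParam gen w' v)

omit hq in
-- Behaviour under one translation by `c` gives the behaviour under all its integral multiples. The
-- condition on `c` ensures that translating by `c` does not change the point of the curve.
theorem shift_zpow {n : ℕ} {E : EllCurve q → Type} [∀ x, AddCommGroup (E x)]
    [∀ x, Module ℂ (E x)] {S : ∀ w x, uniProj q w = x → ((Fin n → ℂ) →ₗ[ℂ] E x)} {c : ℂ}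
    {G : GL (Fin n) ℂ} {l : ℤ} (hc : expUnit c = q ^ l)
    (h : ∀ w x h h' v, S (w + c) x h' ((G : Matrix (Fin n) (Fin n) ℂ).mulVec v) = S w x h v)
    (k : ℤ) : ∀ w x h h' v,
      S (w + k * c) x h' (((G ^ k : GL (Fin n) ℂ) : Matrix (Fin n) (Fin n) ℂ).mulVec v) =
        S w x h v := by
  have hk (k : ℤ) : expUnit (k * c) = q ^ (l * k) := by rw [expUnit_int_mul, hc, zpow_mul]
  have tr : ∀ w w' x (h1 : uniProj q w = x) (h2 : uniProj q w' = x), w = w' →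
      S w x h1 = S w' x h2 := by
    rintro w _ x h1 h2 rfl
    rfl
  let Φ (k : ℤ) : Prop := ∀ w x h h' v,
    S (w + k * c) x h' (((G ^ k : GL (Fin n) ℂ) : Matrix (Fin n) (Fin n) ℂ).mulVec v) = S w x h v
  -- An equivalence rather than an implication is proved, so that the induction can also run towards
  -- negative `k`.
  have step (k : ℤ) : Φ k ↔ Φ (k + 1) := by
    refine forall₃_congr fun w x h1 => ?_
    have e : w + (k + 1 : ℤ) * c = w + k * c + c := by push_cast; ring
    have h2 : uniProj q (w + k * c) = x := (uniProj_add (hk k)).trans h1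
    have h3 : uniProj q (w + (k + 1 : ℤ) * c) = x := (uniProj_add (hk (k + 1))).trans h1
    rw [forall_prop_of_true h2, forall_prop_of_true h3]
    refine forall_congr' fun v => ?_
    have hG : ((G ^ (k + 1) : GL (Fin n) ℂ) : Matrix (Fin n) (Fin n) ℂ).mulVec v =
        (G : Matrix (Fin n) (Fin n) ℂ).mulVec
          (((G ^ k : GL (Fin n) ℂ) : Matrix (Fin n) (Fin n) ℂ).mulVec v) := by
      rw [add_comm k 1, zpow_add, zpow_one, Units.val_mul, ← Matrix.mulVec_mulVec]
    rw [hG, tr _ _ x h3 (by rw [← e, h3]) e, h _ _ h2]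
  suffices H : ∀ k, Φ k from H k
  intro k
  induction k with
  | zero =>
    intro w x h1 h2 v
    rw [zpow_zero, Units.val_one, Matrix.one_mulVec]
    exact LinearMap.congr_fun (tr _ _ _ _ _ (by simp)) v
  | succ k ih => exact (step _).1 ih
  | pred k ih => exact (step _).2 (by rwa [sub_add_cancel])

end QDiff

/-! ### Essential surjectivity: from monodromy to a constant system -/

namespace QDiff

variable {q : ℂˣ} [hq : Fact (1 < ‖(q : ℂ)‖)] {n : ℕ} {E : EllCurve q → Type}
  [∀ x, AddCommGroup (E x)] [∀ x, Module ℂ (E x)]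

/-- The matrix group as the group of units of the continuous endomorphisms. -/
noncomputable def clmToGL (n : ℕ) : ((Fin n → ℂ) →L[ℂ] (Fin n → ℂ))ˣ →* GL (Fin n) ℂ :=
  Units.map
    { toFun := fun f => LinearMap.toMatrix' f.toLinearMap
      map_one' := LinearMap.toMatrix'_one
      map_mul' := fun f g => LinearMap.toMatrix'_mul f.toLinearMap g.toLinearMap }

theorem clmToGL_mulVec (u : ((Fin n → ℂ) →L[ℂ] (Fin n → ℂ))ˣ) (v : Fin n → ℂ) :
    (clmToGL n u : Matrix (Fin n) (Fin n) ℂ).mulVec v = (u : (Fin n → ℂ) →L[ℂ] (Fin n → ℂ)) v :=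
  LinearMap.toMatrix'_mulVec _ v

/-- The flat frame `T` on `ℂ` has monodromy `M₁` along `2πi` and `M₂` along `log q`. Multiplying it
by `exp(wN)` with `exp(-2πi N) = M₁` removes the first; as `N` commutes with `M₂`, the second stays
constant. -/
theorem FrameAtlas.IsConst.exists_equivariantFrame {F : FrameAtlas n E} (hF : F.IsConst) :
    Nonempty (EquivariantFrame F) := by
  obtain ⟨T, hT, h0⟩ := F.exists_isFlatFamily hF (uniProj q) 0
  have hb := hT.bijective (uniProj q).continuous h0
  have hb' (w x h) : Function.Bijective (T w x h) := by
    subst h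
    exact hb w
  set c₁ : ℂ := 2 * Real.pi * Complex.I with hc₁
  have e₁ : expUnit c₁ = q ^ (0 : ℤ) :=
    Units.ext (by rw [coe_expUnit, hc₁, Complex.exp_two_pi_mul_I, zpow_zero, Units.val_one])
  set c₂ : ℂ := Complex.log q with hc₂
  have e₂ : expUnit c₂ = q ^ (1 : ℤ) := by rw [hc₂, expUnit_log, zpow_one]
  obtain ⟨M₁, hM₁⟩ := hT.exists_comp (hT.comp (σ := fun w => w + c₁) (by fun_prop)
    fun w => uniProj_add e₁) (uniProj q).continuous hb
  obtain ⟨M₂, hM₂⟩ := hT.exists_comp (hT.comp (σ := fun w => w + c₂) (by fun_prop)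
    fun w => uniProj_add e₂) (uniProj q).continuous hb
  -- The monodromy matrix is invertible because `T(c) = T(0) M` with `T(c)` and `T(0)` bijective.
  have bij {M : (Fin n → ℂ) →ₗ[ℂ] (Fin n → ℂ)} {c : ℂ} {k : ℤ} (hc : expUnit c = q ^ k)
      (hM : ∀ y x h, T (y + c) x ((uniProj_add hc).trans h) = T y x h ∘ₗ M) :
      IsUnit (LinearMap.toContinuousLinearMap M) := by
    rw [ContinuousLinearMap.isUnit_iff_bijective]
    have h1 := hb' (0 + c) _ ((uniProj_add hc).trans rfl)
    rw [hM 0 _ rfl, LinearMap.coe_comp] at h1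
    exact (Function.Bijective.of_comp_iff' (hb 0) _).1 h1
  have u₁ := bij e₁ hM₁
  have u₂ := bij e₂ hM₂
  have hcomm : Commute (LinearMap.toContinuousLinearMap M₁) (LinearMap.toContinuousLinearMap M₂) := by
    refine ContinuousLinearMap.ext fun v => (hb 0).1 ?_
    have tr : ∀ w w' x (h1 : uniProj q w = x) (h2 : uniProj q w' = x), w = w' →
        T w x h1 = T w' x h2 := by
      rintro w _ x h1 h2 rfl
      rfl
    -- Evaluating `T(c₁ + c₂)` in the two possible orders gives `T(0) M₂ M₁ = T(0) M₁ M₂`.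
    have a1 := hM₁ (0 + c₂) _ (uniProj_add e₂)
    have a2 := hM₂ (0 + c₁) _ (uniProj_add e₁)
    have a3 := tr (0 + c₂ + c₁) (0 + c₁ + c₂) _ ((uniProj_add e₁).trans (uniProj_add e₂))
      ((uniProj_add e₂).trans (uniProj_add e₁)) (by ring)
    have b1 := hM₁ 0 _ rfl
    have b2 := hM₂ 0 _ rfl
    rw [a1, a2, b1, b2] at a3
    exact (LinearMap.congr_fun a3 v).symm
  -- The sign of `-c₁` makes `M₁ exp((w + c₁)N) = exp(wN)`, so that the corrected frame has period
  -- `c₁`.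
  obtain ⟨N, hN, hNc⟩ := exists_oneParam_eq u₁ (c := -c₁) (by
    rw [hc₁, neg_ne_zero]; exact Complex.two_pi_I_ne_zero)
  have hN₂ := hNc _ hcomm
  -- The unit `u = M₂ exp(c₂ N)` is the multiplier of the corrected frame under translation by `c₂ =
  -- log q`. Its inverse is taken as the matrix of the system, since `[qz, AX] = [z, X]` requires
  -- `S(w + c₂) A = S(w)`.
  obtain ⟨u, hu⟩ := u₂.mul (isUnit_oneParam N c₂)
  have hDu (w : ℂ) : Commute (oneParam N w) (u : (Fin n → ℂ) →L[ℂ] (Fin n → ℂ)) := by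
    rw [hu]
    refine (oneParam_commute hN₂ w).mul_right ?_
    exact (oneParam_add N w c₂).symm.trans ((congrArg _ (add_comm w c₂)).trans
      (oneParam_add N c₂ w))
  let S : ∀ w x, uniProj q w = x → ((Fin n → ℂ) →ₗ[ℂ] E x) := fun w x h =>
    T w x h ∘ₗ (oneParam N w).toLinearMap
  have s₁ : ∀ w x h h' v, S (w + c₁) x h' (((1 : GL (Fin n) ℂ) :
      Matrix (Fin n) (Fin n) ℂ).mulVec v) = S w x h v := by
    intro w x h h' v
    have e : LinearMap.toContinuousLinearMap M₁ * oneParam N (w + c₁) = oneParam N w := by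
      rw [← hN, ← oneParam_add]
      congr 1
      ring
    rw [Units.val_one, Matrix.one_mulVec]
    refine (LinearMap.congr_fun (hM₁ w x h) _).trans ?_
    exact congrArg (fun f => T w x h (f v)) e
  have s₂ : ∀ w x h h' v, S (w + c₂) x h' ((clmToGL n u⁻¹ :
      Matrix (Fin n) (Fin n) ℂ).mulVec v) = S w x h v := by
    intro w x h h' v
    have e : LinearMap.toContinuousLinearMap M₂ * oneParam N (w + c₂) *
        ((u⁻¹ : ((Fin n → ℂ) →L[ℂ] (Fin n → ℂ))ˣ) : (Fin n → ℂ) →L[ℂ] (Fin n → ℂ)) =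
          oneParam N w := by
      rw [add_comm, oneParam_add, ← mul_assoc, ← hu, ← (hDu w).eq, mul_assoc, Units.mul_inv,
        mul_one]
    rw [clmToGL_mulVec]
    refine (LinearMap.congr_fun (hM₂ w x h) _).trans ?_
    exact congrArg (fun f => T w x h (f v)) e
  refine ⟨⟨S, clmToGL n u⁻¹, fun w x h => ?_, fun w w' x h h' k hk v => ?_, N, fun i w hw => ?_⟩⟩
  · exact (hb' w x h).comp ((ContinuousLinearMap.isUnit_iff_bijective).1 (isUnit_oneParam N w))
  -- If `exp w' = qᵏ exp w`, then `w'` differs from `w + k c₂` by a multiple of `c₁`, for which the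
  -- multiplier is `1`.
  · have hk2 : expUnit (w + k * c₂) = expUnit w' := by
      rw [expUnit_add, expUnit_int_mul, e₂, zpow_one, hk, mul_comm]
    obtain ⟨m, hm⟩ := Complex.exp_eq_exp_iff_exists_int.1 (congrArg Units.val hk2.symm)
    have h1 : uniProj q (w + k * c₂) = x := by rw [uniProj_apply, hk2, ← uniProj_apply, h']
    rw [← shift_zpow e₂ s₂ k w x h h1]
    have h2 := shift_zpow e₁ s₁ m (w + k * c₂) x h1 (by rw [← hm, h'])
      (((clmToGL n u⁻¹ ^ k : GL (Fin n) ℂ) : Matrix (Fin n) (Fin n) ℂ).mulVec v)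
    rw [one_zpow, Units.val_one, Matrix.one_mulVec] at h2
    rw [← h2]
    congr 2
  -- In a flat frame `T` is locally constant, so its value at `w` serves as `P` and only the factor
  -- `exp(w'N)` varies.
  · refine ⟨LinearEquiv.ofBijective (F.toCoord i (uniProj q w) ∘ₗ T w _ rfl)
      ((F.toCoord_bijective hw).comp (hb w)), ?_⟩
    filter_upwards [hT i w hw] with w' hw'
    rintro _ rfl v
    exact LinearMap.congr_fun hw' (oneParam N w' v)

variable {F : FrameAtlas n E} (S : EquivariantFrame F)

namespace EquivariantFrame

/-- The isomorphism `[z, X] ↦ S(log z) X` between the fibres. -/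
noncomputable def fibEquiv (x : EllCurve q) : Fib q S.mat x ≃ₗ[ℂ] E x :=
  (clsEquiv S.mat (Quotient.out x) (QuotientGroup.out_eq' x)).symm.trans
    (LinearEquiv.ofBijective (S.toFun (Complex.log ((Quotient.out x : ℂˣ) : ℂ)) x (by
      rw [uniProj_apply, expUnit_log]; exact QuotientGroup.out_eq' x)) (S.bijective _ _ _))

/-- The field `shift` absorbs both choices made in `fibEquiv`: the representative in `ℂˣ` and its
logarithm. -/
theorem fibEquiv_cls (w : ℂ) (z : ℂˣ) (hw : expUnit w = z) {x : EllCurve q} (h : proj q z = x)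
    (h' : uniProj q w = x) (v : Fin n → ℂ) :
    S.fibEquiv x (cls S.mat z h v) = S.toFun w x h' v := by
  obtain ⟨k, hk⟩ := proj_eq_iff.1 (h.trans (QuotientGroup.out_eq' x).symm)
  rw [fibEquiv, LinearEquiv.trans_apply, clsEquiv_symm_shift S.mat h k hk,
    LinearEquiv.ofBijective_apply]
  exact S.shift _ _ _ _ _ _ (by rw [expUnit_log, hk, hw]) v

/-- In a flat frame on each side the comparison map is `P exp(w(x) N)`, with `w` a local holomorphic
logarithm of the lift of `x`. This single formula gives holomorphy of the map and of its inverse. -/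
theorem exists_local_form {s : ℝ} {i : F.ι} {x₀ : EllCurve q} (hs : x₀ ∈ proj q '' annulus q s)
    (hi : x₀ ∈ F.U i) : ∃ (P : (Fin n → ℂ) ≃ₗ[ℂ] (Fin n → ℂ)) (w : EllCurve q → ℂ),
      ContMDiffAt 𝓘(ℂ) 𝓘(ℂ) ω w x₀ ∧ ∀ᶠ x in 𝓝 x₀, ∀ v,
        F.toCoord i x (S.fibEquiv x ((flatFrames S.mat).ofCoord s x v)) =
          P (oneParam S.gen (w x) v) := by
  set z₀ := lift q s x₀ with hz₀
  -- The quotient by `z₀` is near `1`, away from the cut of the logarithm, whatever the argument of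
  -- `z₀`.
  let w (x : EllCurve q) : ℂ := Complex.log z₀ + Complex.log ((lift q s x : ℂ) / z₀)
  have hz : (z₀ : ℂ) ≠ 0 := z₀.ne_zero
  have hexp (x : EllCurve q) : expUnit (w x) = lift q s x := by
    refine Units.ext ?_
    rw [coe_expUnit, Complex.exp_add, Complex.exp_log hz,
      Complex.exp_log (div_ne_zero (Units.ne_zero _) hz), mul_div_cancel₀ _ hz]
  have hw0 : w x₀ = Complex.log z₀ := by simp [w, ← hz₀]
  have hx (x : EllCurve q) : uniProj q (w x) = x := by rw [uniProj_apply, hexp, proj_lift]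
  have hw : ContMDiffAt 𝓘(ℂ) 𝓘(ℂ) ω w x₀ := by
    have h1 : ContDiffAt ℂ ω (fun y : ℂ => Complex.log (z₀ : ℂ) + Complex.log (y / z₀))
        ((lift q s x₀ : ℂˣ) : ℂ) := by
      refine contDiffAt_const.add ((Complex.contDiffAt_log ?_).comp _ (contDiffAt_id.div_const _))
      rw [← hz₀, div_self hz]
      exact Complex.one_mem_slitPlane
    exact ContMDiffAt.comp (g := fun y : ℂ => Complex.log (z₀ : ℂ) + Complex.log (y / z₀))
      (f := fun x => ((lift q s x : ℂˣ) : ℂ)) x₀ h1.contMDiffAt (lift_val_holo q hs)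
  obtain ⟨P, hP⟩ := S.eq_oneParam i (w x₀) (by rwa [hx])
  refine ⟨P, w, hw, ?_⟩
  filter_upwards [hw.continuousAt.eventually hP] with x h v
  rw [← h x (hx x) v, ← S.fibEquiv_cls (w x) _ (hexp x) (proj_lift q s x) (hx x)]
  rfl

theorem fibEquiv_holo {E : HolBundle (EllCurve q)} {F : FrameAtlas E.rank E.fiber}
    (hF : E.Compat F) (S : EquivariantFrame F) :
    (bundleOf S.mat).IsHol E fun x => (S.fibEquiv x).toLinearMap := by
  refine (HolBundle.isHol_iff (flatFrames S.mat).compat hF _).2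
    fun (s : ℝ) i v x₀ hx₀ => ContMDiffAt.contMDiffWithinAt ?_
  obtain ⟨P, w, hw, h⟩ := S.exists_local_form hx₀.1 hx₀.2
  have h1 : ContDiff ℂ ω fun y : ℂ => P.toLinearMap.toContinuousLinearMap
      (oneParam S.gen y v) :=
    (ContinuousLinearMap.contDiff _).comp ((contDiff_oneParam S.gen).clm_apply contDiff_const)
  refine (h1.contMDiff.contMDiffAt.comp x₀ hw).congr_of_eventuallyEq ?_
  filter_upwards [h] with x hx
  exact hx v

/-- The inverse of `P exp(wN)` is `exp(-wN) P⁻¹`, which is again holomorphic in `w`. -/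
theorem fibEquiv_symm_holo {E : HolBundle (EllCurve q)} {F : FrameAtlas E.rank E.fiber}
    (hF : E.Compat F) (S : EquivariantFrame F) :
    E.IsHol (bundleOf S.mat) fun x => (S.fibEquiv x).symm.toLinearMap := by
  refine (HolBundle.isHol_iff hF (flatFrames S.mat).compat _).2
    fun i (s : ℝ) v x₀ hx₀ => ContMDiffAt.contMDiffWithinAt ?_
  obtain ⟨P, w, hw, h⟩ := S.exists_local_form hx₀.2 hx₀.1
  have h1 : ContDiff ℂ ω fun y : ℂ => oneParam S.gen (-y) (P.symm v) :=
    ((contDiff_oneParam S.gen).comp contDiff_neg).clm_apply contDiff_const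
  refine (h1.contMDiff.contMDiffAt.comp x₀ hw).congr_of_eventuallyEq ?_
  filter_upwards [h, (F.isOpen i).mem_nhds hx₀.1,
    (isOpen_image_annulus q s).mem_nhds hx₀.2] with x hx hxi hxs
  have h2 := hx (oneParam S.gen (-(w x)) (P.symm v))
  have h3 : oneParam S.gen (w x) (oneParam S.gen (-(w x)) (P.symm v)) = P.symm v :=
    congrArg (fun f => f (P.symm v)) (oneParam_mul_neg S.gen (w x))
  rw [h3, LinearEquiv.apply_symm_apply] at h2
  have h4 : (S.fibEquiv x).symm (F.ofCoord i x v) =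
      (flatFrames S.mat).ofCoord s x (oneParam S.gen (-(w x)) (P.symm v)) := by
    rw [LinearEquiv.symm_apply_eq]
    refine F.toCoord_injective hxi ?_
    rw [F.to_of i x hxi, h2]
  refine (congrArg ((flatFrames S.mat).toCoord s x) h4).trans ?_
  exact (flatFrames S.mat).to_of s x hxs _

end EquivariantFrame

instance : (flatFunctor q).EssSurj where
  mem_essImage := by
    rintro ⟨E, F, hF, hc⟩
    obtain ⟨S⟩ := FrameAtlas.IsConst.exists_equivariantFrame (F := F) hc
    exact ⟨⟨E.rank, S.mat⟩, ⟨ObjectProperty.isoMk _ (HolBundle.mkIso (E := bundleOf S.mat) (E' := E)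
      S.fibEquiv (S.fibEquiv_holo hF) (S.fibEquiv_symm_holo hF))⟩⟩

end QDiff

/-! ### The equivalence of tensor categories -/

theorem mainTheorem7 (q : ℂˣ) [Fact (1 < ‖(q : ℂ)‖)] :
    (QDiff.flatFunctor q).IsEquivalence ∧
    (QDiff.flatFunctor q).Additive ∧ (QDiff.flatFunctor q).Linear ℂ ∧
    ∃ _ : (QDiff.flatFunctor q).Braided,
      (∀ (z : ℂˣ) (c : ℂ),
        QDiff.HolBundle.app (Functor.LaxMonoidal.ε (QDiff.flatFunctor q)).hom (QDiff.proj q z) c =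
          QDiff.point (𝟙_ (QDiff.FlatSystem q)) z (fun _ => c)) ∧
      ∀ (A B : QDiff.FlatSystem q) (z : ℂˣ) (X : Fin A.rank → ℂ) (Y : Fin B.rank → ℂ),
        QDiff.HolBundle.app (Functor.LaxMonoidal.μ (QDiff.flatFunctor q) A B).hom (QDiff.proj q z)
            (QDiff.point A z X ⊗ₜ[ℂ] QDiff.point B z Y) =
          QDiff.point (A ⊗ B) z (QDiff.kronVec X Y) :=
  -- The empty structure is filled by the instances found above: faithful, full and essentially
  -- surjective.
  ⟨{}, inferInstance, inferInstance, QDiff.flatBraided q,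
    fun z c => QDiff.flatUnitIso_cls z rfl c,
    fun A B z X Y => QDiff.flatTensorIso_cls A B z rfl X Y⟩
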